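/- Let $k\ge 2$, let $\varepsilon\in\{+1,-1\}$, and let $f:(\mathbb R^2,0)\to(\mathbb R^3,0)$ be a frontal, i.e. a $C^\infty$ map-germ for which there is a $C^\infty$ never-vanishing $\nu:(\mathbb R^2,0)\to\mathbb R^3$ with $\langle df_p(X),\nu(p)\rangle=0$ for all $p$ near $0$ and all $X\in T_p\mathbb R^2$. Fix such a $\nu$ and put $\lambda=\det(f_u,f_v,\nu)$. Let $S(f)$ be the set-germ at $0$ of the points where $\operatorname{rank} df<2$. Call $0$ a non-degenerate singular point if $0\in S(f)$ and $d\lambda(0)\ne0$. In that case $S(f)$ is the image of a $C^\infty$ regular curve-germ $\gamma:(\mathbb R,0)\to(\mathbb R^2,0)$, and there is a $C^\infty$ never-vanishing vector field $\eta(t)$ along $\gamma$ (a null vector field) spanning $\ker df_{\gamma(t)}$. Put $\hat\gamma=f\circ\gamma$ and $$\psi(t)=\det\bigl(\hat\gamma'(t),\,\nu(\gamma(t)),\,d\nu_{\gamma(t)}(\eta(t))\bigr).$$ Two map-germs $f_1,f_2:(\mathbb R^2,0)\to(\mathbb R^3,0)$ are $\mathcal A$-equivalent if $d_t\circ f_1=f_2\circ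 d_s$ for some germs of $C^\infty$-diffeomorphisms $d_s$ of $(\mathbb R^2,0)$ and $d_t$ of $(\mathbb R^3,0)$. **Theorem.** The germ $f$ is $\mathcal A$-equivalent to the cuspidal $S_{k-1}^{\pm}$ singularity $(u,v)\mapsto\bigl(u,\,v^2,\,v^3(u^k+\varepsilon v^2)\bigr)$, with $\pm$ the sign of $\varepsilon$, if and only if the following conditions (a)–(d) hold: (a) $0$ is a non-degenerate singular point, and $\eta(0)$ is transverse to $S(f)$ at $0$, i.e. $\gamma'(0)$ and $\eta(0)$ are linearly independent; (b) there are a $C^\infty$ curve-germ $c:(\mathbb R,0)\to(\mathbb R^2,0)$ and a number $\ell\in\mathbb R$ such that $c'(0)$ is a non-zero multiple of $\eta(0)$ and $\hat c=f\circ c$ satisfies $\hat c'(0)=0$, $\hat c''(0)\neq0$, $\hat c'''(0)=\ell\,\hat c''(0)$ and $$a:=\det\bigl(\hat\gamma',\ \hat c'',\ 3\hat c^{(5)}-10\ell\,\hat c^{(4)}\bigr)(0)\neq0;$$ (c) $\psi(0)=\psi'(0)=\dots=\psi^{(k-1)}(0)=0$ and $b:=\psi^{(k)}(0)\ne0$;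 (d) if $k$ is even, then the sign of $ab$ is $\varepsilon$, where $\gamma,\eta,c$ are chosen so that $c'(0)$ is a positive multiple of $\eta(0)$ and $(\gamma'(0),\eta(0))$ is positively oriented. The equivalence holds both when the conditions are required for every choice of the auxiliary data and when they are required for some choice. In the first reading, (a)–(c) are required for all $\gamma,\eta$ as above, and (d) for all $\gamma,\eta$ and all $c,\ell$ as in (b) subject to the orientation conventions of (d). In the second, (a)–(d) are required for one common choice of $\gamma,\eta,c,\ell$, satisfying the orientation conventions of (d) if $k$ is even. -/

import Mathlib

open Filter Topology
open scoped ContDiff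

/-- A function `g`, defined on the whole space, represents a `C^∞` map-germ at `p`: it is `C^∞` at
all points of some neighbourhood of `p`. (For the order `∞`, `ContDiffAt` at `p` alone would allow
neighbourhoods that shrink with the order of differentiability.) -/
def IsSmoothGerm {E F : Type*} [NormedAddCommGroup E] [NormedSpace ℝ E]
    [NormedAddCommGroup F] [NormedSpace ℝ F] (g : E → F) (p : E) : Prop :=
  ∀ᶠ x in 𝓝 p, ContDiffAt ℝ ∞ g x

/-- `d : (E, 0) → (E, 0)` represents a germ of a `C^∞`-diffeomorphism: it is a smooth germ
with a smooth inverse germ `e`. -/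
def IsDiffeoGerm {E : Type*} [NormedAddCommGroup E] [NormedSpace ℝ E] (d : E → E) : Prop :=
  IsSmoothGerm d 0 ∧ d 0 = 0 ∧
    ∃ e : E → E, IsSmoothGerm e 0 ∧ e 0 = 0 ∧
      (∀ᶠ x in 𝓝 (0 : E), e (d x) = x) ∧ (∀ᶠ y in 𝓝 (0 : E), d (e y) = y)

/-- `𝒜`-equivalence of map-germs `f₁, f₂ : (ℝ², 0) → (ℝ³, 0)`: there are germs of diffeomorphisms
of the source and of the target with `d_t ∘ f₁ = f₂ ∘ d_s` as germs at `0`. -/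
def AEquivalent (f₁ f₂ : (Fin 2 → ℝ) → (Fin 3 → ℝ)) : Prop :=
  ∃ (ds : (Fin 2 → ℝ) → (Fin 2 → ℝ)) (dt : (Fin 3 → ℝ) → (Fin 3 → ℝ)),
    IsDiffeoGerm ds ∧ IsDiffeoGerm dt ∧ ∀ᶠ x in 𝓝 (0 : Fin 2 → ℝ), dt (f₁ x) = f₂ (ds x)

/-- The normal form `(u, v) ↦ (u, v², v³ (u^(m+1) + ε v²))` of the cuspidal `S_m^±` singularity,
where `ε = 1` for the sign `+` and `ε = -1` for the sign `-`. -/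
def cuspidalS (m : ℕ) (ε : ℝ) (p : Fin 2 → ℝ) : Fin 3 → ℝ :=
  ![p 0, p 1 ^ 2, p 1 ^ 3 * (p 0 ^ (m + 1) + ε * p 1 ^ 2)]

/-- The determinant of two vectors of the plane. -/
def det₂ (x y : Fin 2 → ℝ) : ℝ := Matrix.det (Matrix.of ![x, y])

/-- The determinant of three vectors of space. -/
def det₃ (x y z : Fin 3 → ℝ) : ℝ := Matrix.det (Matrix.of ![x, y, z])

/-- `ν` is a normal vector of `f` near `0`: a smooth never-vanishing vector field along `f` that is
orthogonal to the image of `df`. -/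
structure IsNormalVector (f ν : (Fin 2 → ℝ) → (Fin 3 → ℝ)) : Prop where
  smooth : IsSmoothGerm ν 0
  ne_zero : ∀ᶠ p in 𝓝 (0 : Fin 2 → ℝ), ν p ≠ 0
  orthogonal : ∀ᶠ p in 𝓝 (0 : Fin 2 → ℝ), ∀ X : Fin 2 → ℝ, fderiv ℝ f p X ⬝ᵥ ν p = 0

/-- `f : (ℝ², 0) → (ℝ³, 0)` is a frontal (a smooth map-germ that has a normal vector) and `ν` is
a representative of its normal vector. -/
structure IsFrontalWithNormal (f ν : (Fin 2 → ℝ) → (Fin 3 → ℝ)) : Prop where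
  smooth : IsSmoothGerm f 0
  map_zero : f 0 = 0
  normal : IsNormalVector f ν

/-- The set `S(f)` of singular points of `f`. -/
def singularSet (f : (Fin 2 → ℝ) → (Fin 3 → ℝ)) : Set (Fin 2 → ℝ) :=
  {p | ¬ Function.Injective (fderiv ℝ f p)}

/-- The signed area density function `λ = det(f_u, f_v, ν)`. -/
noncomputable def areaDensity (f ν : (Fin 2 → ℝ) → (Fin 3 → ℝ)) (p : Fin 2 → ℝ) : ℝ :=
  det₃ (fderiv ℝ f p ![1, 0]) (fderiv ℝ f p ![0, 1]) (ν p)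

/-- `0` is a non-degenerate singular point of the frontal `f` with normal vector `ν`. -/
def IsNondegenerateSingularPoint (f ν : (Fin 2 → ℝ) → (Fin 3 → ℝ)) : Prop :=
  (0 : Fin 2 → ℝ) ∈ singularSet f ∧ fderiv ℝ (areaDensity f ν) 0 ≠ 0

/-- `γ : (ℝ, 0) → (ℝ², 0)` is a regular curve whose image is `S(f)`, as germs at `0`: it runs in
`S(f)`, and each of its restrictions to an interval `(-δ, δ)` covers `S(f)` near `0`. -/
structure IsSingularCurve (f : (Fin 2 → ℝ) → (Fin 3 → ℝ)) (γ : ℝ → (Fin 2 → ℝ)) : Prop where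
  smooth : IsSmoothGerm γ 0
  map_zero : γ 0 = 0
  regular : deriv γ 0 ≠ 0
  mem : ∀ᶠ t in 𝓝 (0 : ℝ), γ t ∈ singularSet f
  covers : ∀ δ > 0, ∀ᶠ p in 𝓝 (0 : Fin 2 → ℝ), p ∈ singularSet f → ∃ t ∈ Set.Ioo (-δ) δ, γ t = p

/-- `η` is a null vector field along `γ`: a smooth never-vanishing vector field along `γ` that
spans the kernel of `df` at the points of `γ`. -/
structure IsNullField (f : (Fin 2 → ℝ) → (Fin 3 → ℝ)) (γ η : ℝ → (Fin 2 → ℝ)) : Prop where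
  smooth : IsSmoothGerm η 0
  ne_zero : ∀ᶠ t in 𝓝 (0 : ℝ), η t ≠ 0
  ker_eq : ∀ᶠ t in 𝓝 (0 : ℝ), ∀ X : Fin 2 → ℝ, fderiv ℝ f (γ t) X = 0 ↔ ∃ s : ℝ, X = s • η t

/-- The function `ψ(t) = det((f ∘ γ)'(t), ν(γ(t)), dν_{γ(t)}(η(t)))`. -/
noncomputable def psi (f ν : (Fin 2 → ℝ) → (Fin 3 → ℝ)) (γ η : ℝ → (Fin 2 → ℝ)) (t : ℝ) : ℝ :=
  det₃ (deriv (f ∘ γ) t) (ν (γ t)) (fderiv ℝ ν (γ t) (η t))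

/-- The number `a = det(γ̂', ĉ'', 3 ĉ⁽⁵⁾ - 10 ℓ ĉ⁽⁴⁾)(0)` with `γ̂ = f ∘ γ` and `ĉ = f ∘ c`. -/
noncomputable def cuspNumber (f : (Fin 2 → ℝ) → (Fin 3 → ℝ)) (γ c : ℝ → (Fin 2 → ℝ)) (l : ℝ) : ℝ :=
  det₃ (deriv (f ∘ γ) 0) (iteratedDeriv 2 (f ∘ c) 0)
    ((3 : ℝ) • iteratedDeriv 5 (f ∘ c) 0 - (10 * l) • iteratedDeriv 4 (f ∘ c) 0)

/-- The curve `c : (ℝ, 0) → (ℝ², 0)` has velocity at `0` parallel to `η(0)`, and `ĉ = f ∘ c`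
satisfies `ĉ'(0) = 0`, `ĉ''(0) ≠ 0`, `ĉ'''(0) = ℓ ĉ''(0)` and `a ≠ 0`. -/
structure IsCuspCurve (f : (Fin 2 → ℝ) → (Fin 3 → ℝ)) (γ η c : ℝ → (Fin 2 → ℝ)) (l : ℝ) :
    Prop where
  smooth : IsSmoothGerm c 0
  map_zero : c 0 = 0
  parallel : ∃ s : ℝ, s ≠ 0 ∧ deriv c 0 = s • η 0
  first : deriv (f ∘ c) 0 = 0
  second : iteratedDeriv 2 (f ∘ c) 0 ≠ 0
  third : iteratedDeriv 3 (f ∘ c) 0 = l • iteratedDeriv 2 (f ∘ c) 0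
  number_ne_zero : cuspNumber f γ c l ≠ 0

/-- The function `ψ` vanishes at `0` to order exactly `k`. -/
def PsiVanishesToOrder (f ν : (Fin 2 → ℝ) → (Fin 3 → ℝ)) (γ η : ℝ → (Fin 2 → ℝ)) (k : ℕ) : Prop :=
  (∀ i < k, iteratedDeriv i (psi f ν γ η) 0 = 0) ∧ iteratedDeriv k (psi f ν γ η) 0 ≠ 0

/-- The choices made for the sign rule: `(γ', η)(0)` is positively oriented and `c'(0)` points in
the direction of `η(0)`. -/
def IsOrientedChoice (γ η c : ℝ → (Fin 2 → ℝ)) : Prop :=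
  0 < det₂ (deriv γ 0) (η 0) ∧ ∃ s : ℝ, 0 < s ∧ deriv c 0 = s • η 0

/-- The sign of `ab` is `ε`, where `b = ψ⁽ᵏ⁾(0)`. -/
def SignRule (f ν : (Fin 2 → ℝ) → (Fin 3 → ℝ)) (γ η c : ℝ → (Fin 2 → ℝ)) (l : ℝ) (k : ℕ)
    (ε : ℝ) : Prop :=
  Real.sign (cuspNumber f γ c l * iteratedDeriv k (psi f ν γ η) 0) = ε

/-! ## Criteria for the cuspidal `S_{k-1}^±` singularity

Call `F_φ(u, v) = (u, v², v³ φ(u, v²))` a prepared form (`cuspForm φ`); the singularity in question is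
the one with `φ(u, w) = uᵏ + ε w`. The proof compares the frontal `f` with prepared forms.

*Preparation.* Let `0` be a non-degenerate singular point with `η` transverse to the singular curve.
In the coordinates `(u, v) ↦ γ(u) + v η(u)` one has `f_v(u, 0) = 0`, and non-degeneracy says that
`f_u`, `f_vv` and `ν` are independent at `0` (`fderiv_areaDensity_null`). Hadamard's lemma and changes
of coordinates bring `f` to `(u, v², v² N(u, v))`. Whitney's theorem on even functions
(`exists_eq_comp_sq_of_even`) splits `N` into `G(u, v²) + v φ(u, v²)`, and the first summand is removed
by a diffeomorphism of the target. Hence `f` is equivalent to a prepared form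
(`exists_aEquivalent_cuspForm_of_transverse`). Whitney's theorem is proved by Fourier inversion: a
compactly supported even function is a superposition of waves `cos(2πξv)`, each of which is a smooth
function of `v²` that extends to negative arguments with bounds polynomial in `ξ`.

*Invariants.* Let `f = Φ ∘ F_φ ∘ D` near `0`. The functions `ψ` and `a` can be computed in the
prepared form. Along the singular curve, `ψ` is a multiple of `det(df(γ'), f_ηη, f_ηηη)` by a function
that has a known sign and involves `ν` only through `|ν|²` (`psi_mul_gram`), and this determinant is
a multiple of `φ(α(t), 0)`, where `α` is a reparametrization of the `u`-axis
(`PreparedData.exists_psi_eq`). If `φ` and `φ_u` vanish at `0`, then `a` is a multiple of `φ_w(0)`, for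
every choice of `c`: the combination `3 ĉ⁽⁵⁾ - 10 ℓ ĉ⁽⁴⁾` is made so that it transforms linearly under
`Φ` (`iteratedDeriv_comp_of_deriv_eq_zero`, `PreparedData.cuspNumber_eq`). So the condition on `ψ`
says that `φ(u, 0) = uᵏ θ(u)` with `θ(0) ≠ 0`, the condition on `a` says that `φ_w(0) ≠ 0`, and for even
`k` the unknown signs cancel in `ab`, whose sign is that of `θ(0) φ_w(0)`
(`PreparedData.sign_cuspNumber_mul`). For `φ = uᵏ + ε w` this gives all the conditions, for all choices.

*Recognition.* Conversely, under these conditions `φ = uᵏ θ(u) + w φ₁(u, w)` with `φ₁(0) = φ_w(0)`, and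
scaling the first and the third coordinate turns `φ` into `uᵏ ± w`, the sign being that of
`θ(0) φ_w(0)` (`aEquivalent_normalForm`). For odd `k` reversing `u` exchanges the two signs.

The two readings of the conditions are equivalent because admissible data exist: the singular curve and
a null field by the inverse function theorem (`exists_isSingularCurve`, `exists_isNullField`), with
the orientation corrected by replacing `η` by `-η` and `c(t)` by `c(-t)`. -/

/-! ### Parametric integrals and Hadamard's lemma -/

open MeasureTheory in
/-- Iterated differentiation under the integral sign, for a class `P` of integrands that is closed
under the two partial derivatives in the parameter and whose members are dominated locally uniformly
in the parameter. -/
theorem contDiff_integral_of_family {α : Type*} [NormedAddCommGroup α] [NormedSpace ℝ α]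
    [MeasurableSpace α] [BorelSpace α] [SecondCountableTopology α] {F : Type*}
    [NormedAddCommGroup F] [NormedSpace ℝ F] (μ : Measure α) (P : ((ℝ × ℝ) → α → F) → Prop)
    (hsmooth : ∀ Φ, P Φ → ContDiff ℝ ∞ (fun q : (ℝ × ℝ) × α ↦ Φ q.1 q.2))
    (hbound : ∀ Φ, P Φ → ∀ x₀, ∃ s ∈ 𝓝 x₀, ∃ B : α → ℝ, Integrable B μ ∧
      ∀ᵐ a ∂μ, ∀ x ∈ s, ‖Φ x a‖ ≤ B a)
    (hder : ∀ Φ, P Φ → ∃ Φ₁ Φ₂, P Φ₁ ∧ P Φ₂ ∧ ∀ x a, HasFDerivAt (fun x ↦ Φ x a)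
      ((ContinuousLinearMap.fst ℝ ℝ ℝ).smulRight (Φ₁ x a) +
        (ContinuousLinearMap.snd ℝ ℝ ℝ).smulRight (Φ₂ x a)) x)
    (Φ : (ℝ × ℝ) → α → F) (hΦ : P Φ) : ContDiff ℝ ∞ (fun x ↦ ∫ a, Φ x a ∂μ) := by
  have hcont : ∀ Φ, P Φ → ∀ x, Continuous (Φ x) := fun Φ h x ↦
    (hsmooth Φ h).continuous.comp (by fun_prop : Continuous fun a : α ↦ ((x, a) : (ℝ × ℝ) × α))
  have hmeas : ∀ Φ, P Φ → ∀ x, AEStronglyMeasurable (Φ x) μ := fun Φ h x ↦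
    (hcont Φ h x).aestronglyMeasurable
  have hint : ∀ Φ, P Φ → ∀ x, Integrable (Φ x) μ := by
    intro Φ h x
    obtain ⟨s, hs, B, hB, hle⟩ := hbound Φ h x
    exact hB.mono' (hmeas Φ h x) (hle.mono fun a ha ↦ ha x (mem_of_mem_nhds hs))
  have key : ∀ Φ, P Φ → ∃ Φ₁ Φ₂, P Φ₁ ∧ P Φ₂ ∧ ∀ x, HasFDerivAt (fun x ↦ ∫ a, Φ x a ∂μ)
      ((ContinuousLinearMap.fst ℝ ℝ ℝ).smulRight (∫ a, Φ₁ x a ∂μ) +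
        (ContinuousLinearMap.snd ℝ ℝ ℝ).smulRight (∫ a, Φ₂ x a ∂μ)) x := by
    intro Φ h
    obtain ⟨Φ₁, Φ₂, h₁, h₂, hd⟩ := hder Φ h
    refine ⟨Φ₁, Φ₂, h₁, h₂, fun x ↦ ?_⟩
    obtain ⟨s, hs, B, hB, hle⟩ := hbound Φ₁ h₁ x
    obtain ⟨t, ht, B', hB', hle'⟩ := hbound Φ₂ h₂ x
    have hm : AEStronglyMeasurable (fun a ↦ (ContinuousLinearMap.fst ℝ ℝ ℝ).smulRight (Φ₁ x a) +
        (ContinuousLinearMap.snd ℝ ℝ ℝ).smulRight (Φ₂ x a)) μ := by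
      refine Continuous.aestronglyMeasurable ?_
      have e₁ : Continuous fun a ↦ (ContinuousLinearMap.fst ℝ ℝ ℝ).smulRight (Φ₁ x a) :=
        (ContinuousLinearMap.smulRightL ℝ (ℝ × ℝ) F
          (ContinuousLinearMap.fst ℝ ℝ ℝ)).continuous.comp (hcont Φ₁ h₁ x)
      have e₂ : Continuous fun a ↦ (ContinuousLinearMap.snd ℝ ℝ ℝ).smulRight (Φ₂ x a) :=
        (ContinuousLinearMap.smulRightL ℝ (ℝ × ℝ) F
          (ContinuousLinearMap.snd ℝ ℝ ℝ)).continuous.comp (hcont Φ₂ h₂ x)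
      exact e₁.add e₂
    have hI : Integrable (fun a ↦ (ContinuousLinearMap.fst ℝ ℝ ℝ).smulRight (Φ₁ x a) +
        (ContinuousLinearMap.snd ℝ ℝ ℝ).smulRight (Φ₂ x a)) μ :=
      ((ContinuousLinearMap.smulRightL ℝ (ℝ × ℝ) F
          (ContinuousLinearMap.fst ℝ ℝ ℝ)).integrable_comp (hint Φ₁ h₁ x)).add
        ((ContinuousLinearMap.smulRightL ℝ (ℝ × ℝ) F
          (ContinuousLinearMap.snd ℝ ℝ ℝ)).integrable_comp (hint Φ₂ h₂ x))
    have := hasFDerivAt_integral_of_dominated_of_fderiv_le (𝕜 := ℝ) (μ := μ)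
      (F := Φ) (x₀ := x) (s := s ∩ t) (bound := fun a ↦ B a + B' a)
      (F' := fun x a ↦ (ContinuousLinearMap.fst ℝ ℝ ℝ).smulRight (Φ₁ x a) +
        (ContinuousLinearMap.snd ℝ ℝ ℝ).smulRight (Φ₂ x a)) (inter_mem hs ht)
      (Eventually.of_forall (hmeas Φ h)) (hint Φ h x) hm ?_ (hB.add hB')
      (Eventually.of_forall fun a y _ ↦ hd y a)
    · refine this.congr_fderiv ?_
      ext <;> simp [ContinuousLinearMap.integral_apply hI]
    · filter_upwards [hle, hle'] with a ha ha' y hy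
      refine (norm_add_le _ _).trans (add_le_add ?_ ?_)
      · rw [ContinuousLinearMap.norm_smulRight_apply]
        calc _ ≤ 1 * ‖Φ₁ y a‖ := by
              gcongr; exact ContinuousLinearMap.norm_fst_le ℝ ℝ ℝ
          _ ≤ _ := by rw [one_mul]; exact ha y hy.1
      · rw [ContinuousLinearMap.norm_smulRight_apply]
        calc _ ≤ 1 * ‖Φ₂ y a‖ := by
              gcongr; exact ContinuousLinearMap.norm_snd_le ℝ ℝ ℝ
          _ ≤ _ := by rw [one_mul]; exact ha' y hy.2
  have main : ∀ n : ℕ, ∀ Φ, P Φ → ContDiff ℝ n (fun x ↦ ∫ a, Φ x a ∂μ) := by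
    intro n
    induction n with
    | zero =>
      intro Φ h
      obtain ⟨_, _, _, _, hd⟩ := key Φ h
      exact contDiff_zero.2 (continuous_iff_continuousAt.2 fun x ↦ (hd x).continuousAt)
    | succ n ih =>
      intro Φ h
      obtain ⟨Φ₁, Φ₂, h₁, h₂, hd⟩ := key Φ h
      have := contDiff_succ_iff_hasFDerivAt (𝕜 := ℝ) (n := n) (f := fun x ↦ ∫ a, Φ x a ∂μ)
      push_cast
      refine this.2 ⟨_, ?_, hd⟩
      exact (contDiff_const.smulRight (ih Φ₁ h₁)).add (contDiff_const.smulRight (ih Φ₂ h₂))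
  exact contDiff_infty.2 fun n ↦ main n Φ hΦ

/-- Hadamard's lemma with a parameter: `S(u, v)` is the integral of `∂R/∂v (u, τ v)` over
`0 ≤ τ ≤ 1`. -/
theorem exists_hadamard {F : Type*} [NormedAddCommGroup F] [NormedSpace ℝ F] [CompleteSpace F]
    (R : ℝ × ℝ → F) (hR : ContDiff ℝ ∞ R) :
    ∃ S : ℝ × ℝ → F, ContDiff ℝ ∞ S ∧ ∀ u v, R (u, v) = R (u, 0) + v • S (u, v) := by
  let P : ((ℝ × ℝ) → ℝ → F) → Prop := fun Φ ↦ ContDiff ℝ ∞ (fun q : (ℝ × ℝ) × ℝ ↦ Φ q.1 q.2)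
  let Φ : (ℝ × ℝ) → ℝ → F := fun x τ ↦ fderiv ℝ R (x.1, τ * x.2) (0, 1)
  have hR' : ContDiff ℝ ∞ (fderiv ℝ R) := hR.fderiv_right le_rfl
  have hΦ : P Φ := by
    have : ContDiff ℝ ∞ fun q : (ℝ × ℝ) × ℝ ↦ (q.1.1, q.2 * q.1.2) := by fun_prop
    exact (hR'.comp this).clm_apply contDiff_const
  refine ⟨fun x ↦ ∫ τ, Φ x τ ∂(MeasureTheory.volume.restrict (Set.Icc (0 : ℝ) 1)),
    contDiff_integral_of_family _ P (fun _ h ↦ h) ?_ ?_ Φ hΦ, ?_⟩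
  · intro Ψ hΨ x₀
    obtain ⟨K, hK⟩ := ((isCompact_closedBall x₀ 1).prod
      (isCompact_Icc (a := (0 : ℝ)) (b := 1))).exists_bound_of_continuousOn hΨ.continuous.continuousOn
    refine ⟨_, Metric.closedBall_mem_nhds x₀ one_pos, fun _ ↦ K, ?_, ?_⟩
    · exact MeasureTheory.integrable_const K
    · filter_upwards [MeasureTheory.ae_restrict_mem measurableSet_Icc] with a ha x hx
      exact hK (x, a) ⟨hx, ha⟩
  · intro Ψ hΨ
    have hΨ' : ContDiff ℝ ∞ (fderiv ℝ fun q : (ℝ × ℝ) × ℝ ↦ Ψ q.1 q.2) := hΨ.fderiv_right le_rfl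
    refine ⟨fun x a ↦ fderiv ℝ (fun q : (ℝ × ℝ) × ℝ ↦ Ψ q.1 q.2) (x, a) ((1, 0), 0),
      fun x a ↦ fderiv ℝ (fun q : (ℝ × ℝ) × ℝ ↦ Ψ q.1 q.2) (x, a) ((0, 1), 0),
      hΨ'.clm_apply contDiff_const, hΨ'.clm_apply contDiff_const, fun x a ↦ ?_⟩
    have h1 : HasFDerivAt (fun x : ℝ × ℝ ↦ (x, a)) (ContinuousLinearMap.inl ℝ (ℝ × ℝ) ℝ) x :=
      hasFDerivAt_prodMk_left x a
    have := ((hΨ.differentiable (by simp)) (x, a)).hasFDerivAt.comp x h1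
    refine HasFDerivAt.congr_fderiv (f := fun x ↦ Ψ x a) this ?_
    ext <;> simp
  · intro u v
    have hd : ∀ τ : ℝ, HasDerivAt (fun τ : ℝ ↦ R (u, τ * v)) (v • Φ (u, v) τ) τ := by
      intro τ
      have h1 : HasDerivAt (fun τ : ℝ ↦ ((u, τ * v) : ℝ × ℝ)) (0, v) τ := by
        have := (hasDerivAt_const τ u).prodMk ((hasDerivAt_id τ).mul_const v)
        simpa using this
      have := ((hR.differentiable (by simp)) (u, τ * v)).hasFDerivAt.comp_hasDerivAt τ h1
      refine HasDerivAt.congr_deriv (f := fun τ ↦ R (u, τ * v)) this ?_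
      change fderiv ℝ R (u, τ * v) (0, v) = v • fderiv ℝ R (u, τ * v) (0, 1)
      rw [← map_smul]; simp
    have hc : Continuous fun τ ↦ v • Φ (u, v) τ := by
      have : Continuous fun τ : ℝ ↦ (((u, v), τ) : (ℝ × ℝ) × ℝ) := by fun_prop
      exact (hΦ.continuous.comp this).const_smul v
    have := intervalIntegral.integral_eq_sub_of_hasDerivAt (a := 0) (b := 1)
      (fun τ _ ↦ hd τ) (hc.intervalIntegrable _ _)
    rw [intervalIntegral.integral_smul, intervalIntegral.integral_of_le zero_le_one,
      ← MeasureTheory.integral_Icc_eq_integral_Ioc] at this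
    simp only [one_mul, zero_mul] at this
    rw [this]; abel

/-! ### Even functions -/

/-- The entire function `s ↦ ∑ (-s)ⁿ / (2n)!`, whose value at `r²` is `cos r`. -/
theorem exists_contDiff_cos_sqrt : ∃ y : ℝ → ℝ, ContDiff ℝ ∞ y ∧ ∀ r, y (r ^ 2) = Real.cos r := by
  let c : ℕ → ℝ := fun n ↦ (-1) ^ n / ((2 * n).factorial : ℝ)
  have hc : ∀ n, ‖c n‖ = 1 / ((2 * n).factorial : ℝ) := by
    intro n
    simp [c]
  have hrad : (FormalMultilinearSeries.ofScalars ℝ c).radius = ⊤ := by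
    refine FormalMultilinearSeries.ofScalars_radius_eq_top_of_tendsto ℝ c
      (Eventually.of_forall fun n ↦ ?_) ?_
    · simp [c, Nat.factorial_ne_zero]
    · refine squeeze_zero (fun n ↦ by positivity) (fun n ↦ ?_)
        (tendsto_one_div_add_atTop_nhds_zero_nat (𝕜 := ℝ))
      rw [hc, hc, Nat.succ_eq_add_one, show 2 * (n + 1) = 2 * n + 1 + 1 by ring,
        Nat.factorial_succ, Nat.factorial_succ]
      push_cast
      have : (0 : ℝ) < (2 * n).factorial := by positivity
      rw [div_div_eq_mul_div, one_div_mul_eq_div, div_div, div_le_div_iff₀ (by positivity) (by positivity)]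
      have h2 : (0 : ℝ) ≤ n := by positivity
      nlinarith [mul_nonneg this.le h2, mul_nonneg this.le (mul_nonneg h2 h2)]
  have hps := (FormalMultilinearSeries.ofScalars ℝ c).hasFPowerSeriesOnBall (by rw [hrad]; simp)
  refine ⟨(FormalMultilinearSeries.ofScalars ℝ c).sum, ?_, fun r ↦ ?_⟩
  · refine AnalyticOnNhd.contDiff (𝕜 := ℝ) ?_
    have := hps.analyticOnNhd
    rwa [hrad, Metric.eball_top] at this
  · have h1 := FormalMultilinearSeries.ofScalars_sum_eq c (r ^ 2)
    rw [FormalMultilinearSeries.ofScalarsSum] at h1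
    rw [h1, ← (Real.hasSum_cos r).tsum_eq]
    refine tsum_congr fun n ↦ ?_
    simp only [c, smul_eq_mul, ← pow_mul]
    ring

/-- On `s > 0` all derivatives of `cos √s` are combinations of `cos √s` and `sin √s` with
coefficients polynomial in `1 / √s`; hence they stay bounded as `s → ∞`. -/
theorem iteratedDeriv_cos_sqrt (y : ℝ → ℝ) (hy : ∀ r, y (r ^ 2) = Real.cos r) (n : ℕ) :
    ∃ p q : Polynomial ℝ, ∀ s > 0, iteratedDeriv n y s =
      p.eval (√s)⁻¹ * Real.cos √s + q.eval (√s)⁻¹ * Real.sin √s := by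
  induction n with
  | zero =>
    refine ⟨1, 0, fun s hs ↦ ?_⟩
    simp only [iteratedDeriv_zero, Polynomial.eval_one, Polynomial.eval_zero]
    rw [← hy, Real.sq_sqrt hs.le]; ring
  | succ n ih =>
    obtain ⟨p, q, hpq⟩ := ih
    refine ⟨-Polynomial.C (1 / 2) * Polynomial.X ^ 3 * p.derivative
        + Polynomial.C (1 / 2) * Polynomial.X * q,
      -Polynomial.C (1 / 2) * Polynomial.X ^ 3 * q.derivative
        - Polynomial.C (1 / 2) * Polynomial.X * p, fun s hs ↦ ?_⟩
    have hev : iteratedDeriv n y =ᶠ[𝓝 s] fun s ↦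
        p.eval (√s)⁻¹ * Real.cos √s + q.eval (√s)⁻¹ * Real.sin √s :=
      (eventually_gt_nhds hs).mono fun t ht ↦ hpq t ht
    rw [iteratedDeriv_succ, hev.deriv_eq]
    have hsq : √s ≠ 0 := (Real.sqrt_pos.2 hs).ne'
    have h1 := Real.hasDerivAt_sqrt hs.ne'
    have h2 := h1.fun_inv hsq
    have hp := (p.hasDerivAt (√s)⁻¹).comp s h2
    have hq := (q.hasDerivAt (√s)⁻¹).comp s h2
    have hcos := (Real.hasDerivAt_cos √s).comp s h1
    have hsin := (Real.hasDerivAt_sin √s).comp s h1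
    refine ((hp.mul hcos).add (hq.mul hsin)).deriv.trans ?_
    simp
    field_simp
    ring

/-- A smooth extension of `s ↦ cos √s` to the whole line with bounded derivatives of all orders. -/
theorem exists_bounded_cos_sqrt : ∃ C : ℝ → ℝ, ContDiff ℝ ∞ C ∧
    (∀ n, ∃ K, ∀ s, |iteratedDeriv n C s| ≤ K) ∧ ∀ r, C (r ^ 2) = Real.cos r := by
  obtain ⟨y, hy, hyc⟩ := exists_contDiff_cos_sqrt
  have hC : ContDiff ℝ ∞ fun s ↦ Real.smoothTransition (s + 1) * y s :=
    (Real.smoothTransition.contDiff.comp (contDiff_id.add contDiff_const)).mul hy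
  refine ⟨fun s ↦ Real.smoothTransition (s + 1) * y s, hC, fun n ↦ ?_, fun r ↦ ?_⟩
  · obtain ⟨p, q, hpq⟩ := iteratedDeriv_cos_sqrt y hyc n
    obtain ⟨K₁, hK₁⟩ := (isCompact_Icc (a := (-1 : ℝ)) (b := 1)).exists_bound_of_continuousOn
      (hC.continuous_iteratedDeriv n (by exact_mod_cast le_top)).continuousOn
    obtain ⟨K₂, hK₂⟩ := (isCompact_Icc (a := (0 : ℝ)) (b := 1)).exists_bound_of_continuousOn
      p.continuous.continuousOn
    obtain ⟨K₃, hK₃⟩ := (isCompact_Icc (a := (0 : ℝ)) (b := 1)).exists_bound_of_continuousOn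
      q.continuous.continuousOn
    refine ⟨max K₁ (K₂ + K₃), fun s ↦ ?_⟩
    rcases lt_or_ge s (-1) with h | h
    · have hev : (fun s ↦ Real.smoothTransition (s + 1) * y s) =ᶠ[𝓝 s] fun _ ↦ (0 : ℝ) :=
        (eventually_lt_nhds h).mono fun t ht ↦ by
          simp [Real.smoothTransition.zero_of_nonpos (by linarith : t + 1 ≤ 0)]
      rw [hev.iteratedDeriv_eq]
      have h0 : iteratedDeriv n (fun _ : ℝ ↦ (0 : ℝ)) s = 0 := by simp
      rw [h0, abs_zero]
      exact le_max_of_le_left ((norm_nonneg _).trans (hK₁ 0 (by norm_num)))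
    rcases le_or_gt s 1 with h' | h'
    · exact le_max_of_le_left (hK₁ s ⟨h, h'⟩)
    · have hs : 0 < s := by linarith
      have hev : (fun s ↦ Real.smoothTransition (s + 1) * y s) =ᶠ[𝓝 s] y :=
        (eventually_gt_nhds hs).mono fun t ht ↦ by
          simp [Real.smoothTransition.one_of_one_le (by linarith : 1 ≤ t + 1)]
      rw [hev.iteratedDeriv_eq, hpq s hs]
      have hr : (√s)⁻¹ ∈ Set.Icc (0 : ℝ) 1 :=
        ⟨by positivity, inv_le_one_of_one_le₀ (Real.one_le_sqrt.2 h'.le)⟩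
      refine le_max_of_le_right ((abs_add_le _ _).trans (add_le_add ?_ ?_))
      · rw [abs_mul]
        exact (mul_le_of_le_one_right (abs_nonneg _) (Real.abs_cos_le_one _)).trans (hK₂ _ hr)
      · rw [abs_mul]
        exact (mul_le_of_le_one_right (abs_nonneg _) (Real.abs_sin_le_one _)).trans (hK₃ _ hr)
  · simp [Real.smoothTransition.one_of_one_le (by nlinarith [sq_nonneg r] : 1 ≤ r ^ 2 + 1), hyc]

open MeasureTheory in
/-- Superpositions of the waves `e^{2πiζu} C(4π²ξ²w)` with rapidly decreasing amplitude are
smooth. -/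
theorem contDiff_wave_integral (C : ℝ → ℝ) (hC : ContDiff ℝ ∞ C)
    (hCb : ∀ n, ∃ K, ∀ s, |iteratedDeriv n C s| ≤ K)
    (H : EuclideanSpace ℝ (Fin 2) → ℂ) (hH : ContDiff ℝ ∞ H)
    (hHi : ∀ n : ℕ, Integrable fun ξ ↦ ‖ξ‖ ^ n * ‖H ξ‖) :
    ContDiff ℝ ∞ fun x : ℝ × ℝ ↦ ∫ ξ, H ξ *
      Complex.exp ((2 * Real.pi * (ξ 0 * x.1) : ℝ) * Complex.I) *
        (C (4 * Real.pi ^ 2 * ξ 1 ^ 2 * x.2) : ℂ) := by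
  let W : (EuclideanSpace ℝ (Fin 2) → ℂ) → (ℝ → ℝ) → (ℝ × ℝ) → EuclideanSpace ℝ (Fin 2) → ℂ :=
    fun H C x ξ ↦ H ξ * Complex.exp ((2 * Real.pi * (ξ 0 * x.1) : ℝ) * Complex.I) *
        (C (4 * Real.pi ^ 2 * ξ 1 ^ 2 * x.2) : ℂ)
  let P : ((ℝ × ℝ) → EuclideanSpace ℝ (Fin 2) → ℂ) → Prop := fun Φ ↦ ∃ H C, ContDiff ℝ ∞ H ∧
    (∀ n : ℕ, Integrable fun ξ ↦ ‖ξ‖ ^ n * ‖H ξ‖) ∧ ContDiff ℝ ∞ C ∧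
    (∀ n, ∃ K, ∀ s, |iteratedDeriv n C s| ≤ K) ∧ Φ = W H C
  have hco : ∀ i : Fin 2, ContDiff ℝ ∞ fun ξ : EuclideanSpace ℝ (Fin 2) ↦ ξ i := fun i ↦
    (EuclideanSpace.proj i : EuclideanSpace ℝ (Fin 2) →L[ℝ] ℝ).contDiff
  have hof : ContDiff ℝ ∞ (fun r : ℝ ↦ (r : ℂ)) := Complex.ofRealCLM.contDiff
  have hle : ∀ (ξ : EuclideanSpace ℝ (Fin 2)) i, |ξ i| ≤ ‖ξ‖ := fun ξ i ↦ by
    simpa using PiLp.norm_apply_le ξ i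
  have hmul : ∀ H : EuclideanSpace ℝ (Fin 2) → ℂ, ContDiff ℝ ∞ H →
      (∀ n : ℕ, Integrable fun ξ ↦ ‖ξ‖ ^ n * ‖H ξ‖) → ∀ (i : Fin 2) (c : ℂ),
      ContDiff ℝ ∞ (fun ξ ↦ c * (ξ i : ℂ) * H ξ) ∧
        ∀ n : ℕ, Integrable fun ξ ↦ ‖ξ‖ ^ n * ‖c * (ξ i : ℂ) * H ξ‖ := by
    intro H hH hHi i c
    refine ⟨(contDiff_const.mul (hof.comp (hco i))).mul hH, fun n ↦ ?_⟩
    refine ((hHi (n + 1)).const_mul ‖c‖).mono' ?_ (Eventually.of_forall fun ξ ↦ ?_)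
    · refine Continuous.aestronglyMeasurable ?_
      have := ((contDiff_const (c := c)).mul (hof.comp (hco i))).mul hH
      exact (continuous_norm.pow n).mul this.continuous.norm
    · rw [Real.norm_of_nonneg (by positivity), norm_mul, norm_mul, Complex.norm_real]
      calc ‖ξ‖ ^ n * (‖c‖ * ‖ξ i‖ * ‖H ξ‖) ≤ ‖ξ‖ ^ n * (‖c‖ * ‖ξ‖ * ‖H ξ‖) := by
            gcongr; exact hle ξ i
        _ = _ := by ring
  refine contDiff_integral_of_family volume P ?_ ?_ ?_ (W H C) ⟨H, C, hH, hHi, hC, hCb, rfl⟩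
  · rintro _ ⟨H, C, hH, -, hC, -, rfl⟩
    have h0 : ContDiff ℝ ∞ fun q : (ℝ × ℝ) × EuclideanSpace ℝ (Fin 2) ↦ q.2 0 :=
      (hco 0).comp contDiff_snd
    have h1 : ContDiff ℝ ∞ fun q : (ℝ × ℝ) × EuclideanSpace ℝ (Fin 2) ↦ q.2 1 :=
      (hco 1).comp contDiff_snd
    have h2 : ContDiff ℝ ∞ fun q : (ℝ × ℝ) × EuclideanSpace ℝ (Fin 2) ↦
        2 * Real.pi * (q.2 0 * q.1.1) := by fun_prop
    have h3 : ContDiff ℝ ∞ fun q : (ℝ × ℝ) × EuclideanSpace ℝ (Fin 2) ↦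
        4 * Real.pi ^ 2 * q.2 1 ^ 2 * q.1.2 := by fun_prop
    exact ((hH.comp contDiff_snd).mul (((hof.comp h2).mul contDiff_const).cexp)).mul
      (hof.comp (hC.comp h3))
  · rintro _ ⟨H, C, hH, hHi, hC, hCb, rfl⟩ x₀
    obtain ⟨K, hK⟩ := hCb 0
    refine ⟨Set.univ, univ_mem, fun ξ ↦ K * ‖H ξ‖, ?_, Eventually.of_forall fun ξ x _ ↦ ?_⟩
    · have := (hHi 0).const_mul K
      simpa using this
    · simp only [W]
      rw [norm_mul, norm_mul, Complex.norm_exp_ofReal_mul_I, mul_one, Complex.norm_real, mul_comm]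
      gcongr
      simpa using hK _
  · rintro _ ⟨H, C, hH, hHi, hC, hCb, rfl⟩
    obtain ⟨a1, a2⟩ := hmul H hH hHi 0 (2 * Real.pi * Complex.I)
    obtain ⟨b1, b2⟩ := hmul H hH hHi 1 1
    obtain ⟨c1, c2⟩ := hmul _ b1 b2 1 (4 * Real.pi ^ 2)
    refine ⟨_, _, ⟨_, C, a1, a2, hC, hCb, rfl⟩, ⟨_, deriv C, c1, c2, ?_, fun n ↦ ?_, rfl⟩,
      fun x ξ ↦ ?_⟩
    · exact ((contDiff_infty_iff_deriv (𝕜 := ℝ)).1 hC).2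
    · obtain ⟨K, hK⟩ := hCb (n + 1)
      exact ⟨K, fun s ↦ by simpa [iteratedDeriv_succ'] using hK s⟩
    · have e1 : HasFDerivAt (fun x : ℝ × ℝ ↦ ((2 * Real.pi * (ξ 0 * x.1) : ℝ) : ℂ))
          (Complex.ofRealCLM.comp ((2 * Real.pi * ξ 0) • ContinuousLinearMap.fst ℝ ℝ ℝ)) x := by
        refine Complex.ofRealCLM.hasFDerivAt.comp x ?_
        refine (((hasFDerivAt_fst (p := x)).const_mul (2 * Real.pi * ξ 0))).congr_of_eventuallyEq ?_
        exact Eventually.of_forall fun x ↦ mul_assoc (2 * Real.pi) (ξ 0) x.1 |>.symm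
      have e2 : HasFDerivAt (fun x : ℝ × ℝ ↦ 4 * Real.pi ^ 2 * ξ 1 ^ 2 * x.2)
          ((4 * Real.pi ^ 2 * ξ 1 ^ 2) • ContinuousLinearMap.snd ℝ ℝ ℝ) x :=
        (hasFDerivAt_snd (p := x)).const_mul _
      have e3 : HasFDerivAt (fun x : ℝ × ℝ ↦ (C (4 * Real.pi ^ 2 * ξ 1 ^ 2 * x.2) : ℂ)) _ x :=
        Complex.ofRealCLM.hasFDerivAt.comp x
          (((hC.differentiable (by simp)).differentiableAt.hasDerivAt (x :=
            4 * Real.pi ^ 2 * ξ 1 ^ 2 * x.2)).comp_hasFDerivAt x e2)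
      have e4 := (((e1.mul_const Complex.I).cexp).const_mul (H ξ)).mul e3
      refine HasFDerivAt.congr_fderiv (f := fun x ↦ W H C x ξ) e4 ?_
      ext <;> simp [W] <;> ring

open scoped FourierTransform in
/-- **Whitney's theorem on even functions**, with a parameter. After a cut-off the function is a
superposition of waves `e^{2πiζu} cos(2πξv)`, and `cos(2πξv)` is a smooth function of `v²` that can
be continued to negative values of `v²` without growth in `ξ`. -/
theorem exists_eq_comp_sq_of_even (R : ℝ × ℝ → ℝ) (hR : ContDiff ℝ ∞ R)
    (heven : ∀ u v, R (u, -v) = R (u, v)) :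
    ∃ G : ℝ × ℝ → ℝ, ContDiff ℝ ∞ G ∧ ∀ᶠ x in 𝓝 (0 : ℝ × ℝ), R x = G (x.1, x.2 ^ 2) := by
  obtain ⟨C, hC, hCb, hCc⟩ := exists_bounded_cos_sqrt
  let b : ContDiffBump (0 : ℝ) := ⟨1, 2, one_pos, one_lt_two⟩
  have hbc : ∀ {n : ℕ∞}, ContDiff ℝ n b := b.contDiff
  let g : EuclideanSpace ℝ (Fin 2) → ℂ := fun x ↦ ((b (x 0) * b (x 1) * R (x 0, x 1) : ℝ) : ℂ)
  have hco : ∀ i : Fin 2, ContDiff ℝ ∞ fun ξ : EuclideanSpace ℝ (Fin 2) ↦ ξ i := fun i ↦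
    (EuclideanSpace.proj i : EuclideanSpace ℝ (Fin 2) →L[ℝ] ℝ).contDiff
  have hg : ContDiff ℝ ∞ g := Complex.ofRealCLM.contDiff.comp
    (((hbc.comp (hco 0)).mul (hbc.comp (hco 1))).mul (hR.comp ((hco 0).prodMk (hco 1))))
  have hgc : HasCompactSupport g := by
    refine HasCompactSupport.intro (isCompact_closedBall (0 : EuclideanSpace ℝ (Fin 2)) 4) fun x hx ↦ ?_
    have h : ∃ i, 2 ≤ |x i| := by
      by_contra! hcon
      apply hx
      rw [mem_closedBall_zero_iff, EuclideanSpace.norm_eq, Real.sqrt_le_iff]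
      refine ⟨by norm_num, ?_⟩
      simp only [Fin.sum_univ_two, Real.norm_eq_abs]
      have h0 := hcon 0
      have h1 := hcon 1
      nlinarith [abs_nonneg (x 0), abs_nonneg (x 1)]
    obtain ⟨i, hi⟩ := h
    have hz : b (x i) = 0 := b.zero_of_le_dist (by simpa [Real.dist_eq] using hi)
    simp only [g]
    fin_cases i <;> simp_all
  let f : SchwartzMap (EuclideanSpace ℝ (Fin 2)) ℂ := hgc.toSchwartzMap hg
  let Hs : SchwartzMap (EuclideanSpace ℝ (Fin 2)) ℂ := 𝓕 f
  let H : EuclideanSpace ℝ (Fin 2) → ℂ := Hs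
  have hH : ContDiff ℝ ∞ H := Hs.smooth ⊤
  have hHi : ∀ n : ℕ, MeasureTheory.Integrable fun ξ ↦ ‖ξ‖ ^ n * ‖H ξ‖ := fun n ↦
    Hs.integrable_pow_mul MeasureTheory.volume n
  have hHint : MeasureTheory.Integrable H := Hs.integrable
  have hinv : ∀ x : EuclideanSpace ℝ (Fin 2), g x = ∫ ξ : EuclideanSpace ℝ (Fin 2),
      Complex.exp ((2 * Real.pi * (ξ 0 * x 0 + ξ 1 * x 1) : ℝ) * Complex.I) * H ξ := by
    intro x
    have h1 : g x = (𝓕⁻ (𝓕 f)) x := by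
      rw [FourierTransform.fourierInv_fourier_eq]; rfl
    rw [h1, SchwartzMap.fourierInv_coe, Real.fourierInv_eq']
    refine MeasureTheory.integral_congr_ae (Eventually.of_forall fun ξ ↦ ?_)
    have : inner ℝ ξ x = ξ 0 * x 0 + ξ 1 * x 1 := by
      simp [PiLp.inner_apply, Fin.sum_univ_two, mul_comm]
    simp only [this, smul_eq_mul]
    rfl
  have hwave := contDiff_wave_integral C hC hCb H hH hHi
  refine ⟨_, Complex.reCLM.contDiff.comp hwave, ?_⟩
  have hint : ∀ u v : ℝ, MeasureTheory.Integrable fun ξ : EuclideanSpace ℝ (Fin 2) ↦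
      Complex.exp ((2 * Real.pi * (ξ 0 * u + ξ 1 * v) : ℝ) * Complex.I) * H ξ := by
    intro u v
    refine hHint.norm.mono' ?_ (Eventually.of_forall fun ξ ↦ ?_)
    · refine Continuous.aestronglyMeasurable ?_
      have h0 := (hco 0).continuous
      have h1 := (hco 1).continuous
      have := hH.continuous
      fun_prop
    · rw [norm_mul, Complex.norm_exp_ofReal_mul_I, one_mul]
  have hball : ∀ᶠ x in 𝓝 (0 : ℝ × ℝ), |x.1| < 1 ∧ |x.2| < 1 := by
    have h1 : Continuous fun x : ℝ × ℝ ↦ |x.1| := by fun_prop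
    have h2 : Continuous fun x : ℝ × ℝ ↦ |x.2| := by fun_prop
    exact (h1.continuousAt.eventually_lt continuousAt_const (by simp)).and
      (h2.continuousAt.eventually_lt continuousAt_const (by simp))
  filter_upwards [hball] with x hx
  obtain ⟨u, v⟩ := x
  have hone : ∀ r : ℝ, |r| < 1 → b r = 1 := fun r hr ↦
    b.one_of_mem_closedBall (by simpa using hr.le)
  have e1 : (R (u, v) : ℂ) = g !₂[u, v] := by
    simp [g, hone u hx.1, hone v hx.2]
  have e2 : (R (u, v) : ℂ) = g !₂[u, -v] := by
    simp [g, hone u hx.1, hone (-v) (by simpa using hx.2), heven]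
  have e3 : (R (u, v) : ℂ) = ∫ ξ : EuclideanSpace ℝ (Fin 2), H ξ *
      Complex.exp ((2 * Real.pi * (ξ 0 * u) : ℝ) * Complex.I) *
        (C (4 * Real.pi ^ 2 * ξ 1 ^ 2 * v ^ 2) : ℂ) := by
    have : (R (u, v) : ℂ) = (1 / 2 : ℂ) * (g !₂[u, v] + g !₂[u, -v]) := by
      rw [← e1, ← e2]; ring
    rw [this, hinv, hinv, ← MeasureTheory.integral_add (by simpa using hint u v)
      (by simpa using hint u (-v)), ← MeasureTheory.integral_const_mul]
    refine MeasureTheory.integral_congr_ae (Eventually.of_forall fun ξ ↦ ?_)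
    have hc : C (4 * Real.pi ^ 2 * ξ 1 ^ 2 * v ^ 2) = Real.cos (2 * Real.pi * (ξ 1 * v)) := by
      rw [← hCc]; ring_nf
    simp only [hc, Complex.ofReal_cos, Complex.cos]
    simp
    have s1 : ∀ z w : ℂ, Complex.exp (2 * Real.pi * (z + w) * Complex.I) =
        Complex.exp (2 * Real.pi * z * Complex.I) * Complex.exp (2 * Real.pi * w * Complex.I) := by
      intro z w; rw [← Complex.exp_add]; ring_nf
    rw [s1, s1]
    have s2 : -(2 * (Real.pi : ℂ) * (ξ 1 * v) * Complex.I) =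
      2 * Real.pi * (-(ξ 1 * v)) * Complex.I := by ring
    rw [s2]; ring
  have e4 := congrArg Complex.re e3
  simpa using e4

/-! ### Germs of smooth maps and diffeomorphisms -/

section Germs

variable {E F G : Type*} [NormedAddCommGroup E] [NormedSpace ℝ E]
  [NormedAddCommGroup F] [NormedSpace ℝ F] [NormedAddCommGroup G] [NormedSpace ℝ G]

theorem ContDiff.isSmoothGerm {g : E → F} (hg : ContDiff ℝ ∞ g) (p : E) : IsSmoothGerm g p :=
  Eventually.of_forall fun _ ↦ hg.contDiffAt

theorem IsSmoothGerm.contDiffAt {g : E → F} {p : E} (hg : IsSmoothGerm g p) : ContDiffAt ℝ ∞ g p :=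
  hg.self_of_nhds

theorem IsSmoothGerm.continuousAt {g : E → F} {p : E} (hg : IsSmoothGerm g p) : ContinuousAt g p :=
  hg.contDiffAt.continuousAt

theorem IsSmoothGerm.differentiableAt {g : E → F} {p : E} (hg : IsSmoothGerm g p) :
    DifferentiableAt ℝ g p :=
  hg.contDiffAt.differentiableAt (by simp)

theorem IsSmoothGerm.comp {g : F → G} {f : E → F} {p : E} (hg : IsSmoothGerm g (f p))
    (hf : IsSmoothGerm f p) : IsSmoothGerm (g ∘ f) p := by
  filter_upwards [hf.continuousAt.eventually hg, hf] with x hx hx'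
  exact hx.comp x hx'

/-- By a cut-off, a smooth germ has a representative that is smooth on the whole space. -/
theorem IsSmoothGerm.exists_contDiff [HasContDiffBump E] {g : E → F} {p : E}
    (hg : IsSmoothGerm g p) : ∃ h : E → F, ContDiff ℝ ∞ h ∧ g =ᶠ[𝓝 p] h := by
  obtain ⟨r, hr, hball⟩ := Metric.eventually_nhds_iff_ball.1 hg
  let b : ContDiffBump p := ⟨r / 4, r / 2, by positivity, by linarith⟩
  refine ⟨fun x ↦ b x • g x, ?_, ?_⟩
  · refine contDiff_iff_contDiffAt.2 fun x ↦ ?_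
    by_cases hx : x ∈ tsupport b
    · rw [ContDiffBump.tsupport_eq] at hx
      exact (b.contDiffAt (n := ⊤)).smul (hball x (Metric.closedBall_subset_ball (by
        change r / 2 < r; linarith) hx))
    · refine (contDiffAt_const (c := (0 : F))).congr_of_eventuallyEq ?_
      filter_upwards [notMem_tsupport_iff_eventuallyEq.1 hx] with y hy
      simp [hy]
  · filter_upwards [b.eventuallyEq_one] with x hx
    simp [hx]

/-- The inverse function theorem for germs. The derivative stays invertible near `0`, so the inverse
is `C^∞` on a whole neighbourhood and not only at `0`. -/
theorem isDiffeoGerm_of_fderiv_injective [FiniteDimensional ℝ E] {d : E → E}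
    (hd : IsSmoothGerm d 0) (h0 : d 0 = 0) (hinj : ∀ X, fderiv ℝ d 0 X = 0 → X = 0) :
    IsDiffeoGerm d := by
  have : CompleteSpace E := FiniteDimensional.complete ℝ E
  let A : E ≃L[ℝ] E := (LinearEquiv.ofInjectiveEndo (fderiv ℝ d 0 : E →ₗ[ℝ] E)
    ((injective_iff_map_eq_zero _).2 hinj)).toContinuousLinearEquiv
  have hA : (A : E →L[ℝ] E) = fderiv ℝ d 0 := by ext X; rfl
  have hderiv : HasFDerivAt d (A : E →L[ℝ] E) 0 := by
    rw [hA]; exact hd.differentiableAt.hasFDerivAt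
  let e := hd.contDiffAt.toOpenPartialHomeomorph d hderiv (by simp)
  have hmem : (0 : E) ∈ e.source :=
    hd.contDiffAt.mem_toOpenPartialHomeomorph_source hderiv (by simp)
  have hed : ∀ x, e x = d x := fun x ↦ rfl
  have hmem' : (0 : E) ∈ e.target := by
    have := e.map_source hmem
    rwa [hed, h0] at this
  have hs0 : e.symm 0 = 0 := by
    have := e.left_inv hmem
    rwa [hed, h0] at this
  have hcont : ContinuousAt e.symm 0 := e.continuousAt_symm hmem'
  have hequiv : ∀ᶠ x in 𝓝 (0 : E), ∃ B : E ≃L[ℝ] E, (B : E →L[ℝ] E) = fderiv ℝ d x := by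
    have hc : ContinuousAt (fderiv ℝ d) 0 :=
      (hd.contDiffAt.fderiv_right (m := 0) (by simp)).continuousAt
    refine hc.eventually (p := fun L ↦ ∃ B : E ≃L[ℝ] E, (B : E →L[ℝ] E) = L) ?_
    rw [← hA]
    filter_upwards [ContinuousLinearEquiv.nhds A] with B hB using hB
  refine ⟨hd, h0, e.symm, ?_, hs0, ?_, ?_⟩
  · have hev : ∀ᶠ y in 𝓝 (0 : E), y ∈ e.target := e.open_target.mem_nhds hmem'
    have h1 : ∀ᶠ y in 𝓝 (0 : E), ContDiffAt ℝ ∞ d (e.symm y) := by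
      refine hcont.eventually ?_; rw [hs0]; exact hd
    have h2 : ∀ᶠ y in 𝓝 (0 : E), ∃ B : E ≃L[ℝ] E, (B : E →L[ℝ] E) = fderiv ℝ d (e.symm y) := by
      refine hcont.eventually (p := fun x ↦ ∃ B : E ≃L[ℝ] E, (B : E →L[ℝ] E) = fderiv ℝ d x) ?_
      rw [hs0]; exact hequiv
    filter_upwards [hev, h1, h2] with y hy h1 ⟨B, hB⟩
    refine e.contDiffAt_symm hy (f₀' := B) ?_ h1
    rw [hB]; exact (h1.differentiableAt (by simp)).hasFDerivAt
  · filter_upwards [e.open_source.mem_nhds hmem] with x hx using e.left_inv hx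
  · filter_upwards [e.open_target.mem_nhds hmem'] with y hy using e.right_inv hy

theorem IsDiffeoGerm.tendsto {d : E → E} (hd : IsDiffeoGerm d) : Tendsto d (𝓝 0) (𝓝 0) := by
  simpa [ContinuousAt, hd.2.1] using hd.1.continuousAt

theorem IsDiffeoGerm.id : IsDiffeoGerm (id : E → E) :=
  ⟨contDiff_id.isSmoothGerm 0, rfl, _root_.id, contDiff_id.isSmoothGerm 0, rfl,
    Eventually.of_forall fun _ ↦ rfl, Eventually.of_forall fun _ ↦ rfl⟩

theorem IsDiffeoGerm.comp {d d' : E → E} (hd : IsDiffeoGerm d) (hd' : IsDiffeoGerm d') :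
    IsDiffeoGerm (d ∘ d') := by
  have td' := hd'.tendsto
  obtain ⟨h1, h2, e, h3, h4, h5, h6⟩ := hd
  obtain ⟨h1', h2', e', h3', h4', h5', h6'⟩ := hd'
  have te : Tendsto e (𝓝 0) (𝓝 0) := by simpa [ContinuousAt, h4] using h3.continuousAt
  refine ⟨IsSmoothGerm.comp (by rwa [h2']) h1', by simp [h2, h2'], e' ∘ e,
    IsSmoothGerm.comp (by rwa [h4]) h3, by simp [h4, h4'], ?_, ?_⟩
  · filter_upwards [td'.eventually h5, h5'] with x hx hx'
    simp [hx, hx']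
  · filter_upwards [te.eventually h6', h6] with x hx hx'
    simp [hx, hx']

theorem fderiv_leftInverse_germ {d e : E → E} {x : E} (hd : DifferentiableAt ℝ d x)
    (he : DifferentiableAt ℝ e (d x)) (hed : ∀ᶠ y in 𝓝 x, e (d y) = y) (X : E) :
    fderiv ℝ e (d x) (fderiv ℝ d x X) = X := by
  have h1 : fderiv ℝ (e ∘ d) x = ContinuousLinearMap.id ℝ E := by
    have : e ∘ d =ᶠ[𝓝 x] _root_.id := hed
    rw [this.fderiv_eq]; exact fderiv_id
  rw [fderiv_comp _ he hd] at h1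
  exact congrArg (fun L : E →L[ℝ] E ↦ L X) h1

theorem IsDiffeoGerm.eventually_fderiv_injective {d : E → E} (hd : IsDiffeoGerm d) :
    ∀ᶠ x in 𝓝 (0 : E), ∀ X, fderiv ℝ d x X = 0 → X = 0 := by
  have ht := hd.tendsto
  obtain ⟨h1, h2, e, h3, h4, h5, h6⟩ := hd
  filter_upwards [h1, ht.eventually h3, h5.eventually_nhds] with x hx hx' hx'' X hX
  have := fderiv_leftInverse_germ (hx.differentiableAt (by simp)) (hx'.differentiableAt (by simp))
    hx'' X
  rw [hX, map_zero] at this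
  exact this.symm

end Germs

/-! ### `𝒜`-equivalence -/

theorem AEquivalent.trans {f₁ f₂ f₃ : (Fin 2 → ℝ) → (Fin 3 → ℝ)} (h₁₂ : AEquivalent f₁ f₂)
    (h₂₃ : AEquivalent f₂ f₃) : AEquivalent f₁ f₃ := by
  obtain ⟨ds, dt, hs, ht, h⟩ := h₁₂
  obtain ⟨ds', dt', hs', ht', h'⟩ := h₂₃
  refine ⟨ds' ∘ ds, dt' ∘ dt, hs'.comp hs, ht'.comp ht, ?_⟩
  filter_upwards [h, hs.tendsto.eventually h'] with x hx hx'
  simp [hx, hx']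

theorem AEquivalent.of_source {f f' : (Fin 2 → ℝ) → (Fin 3 → ℝ)} {d : (Fin 2 → ℝ) → (Fin 2 → ℝ)}
    (hd : IsDiffeoGerm d) (h : ∀ᶠ x in 𝓝 0, f x = f' (d x)) : AEquivalent f f' :=
  ⟨d, id, hd, IsDiffeoGerm.id, h⟩

theorem AEquivalent.of_target {f f' : (Fin 2 → ℝ) → (Fin 3 → ℝ)} {d : (Fin 3 → ℝ) → (Fin 3 → ℝ)}
    (hd : IsDiffeoGerm d) (h : ∀ᶠ x in 𝓝 0, d (f x) = f' x) : AEquivalent f f' :=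
  ⟨id, d, IsDiffeoGerm.id, hd, h⟩

theorem AEquivalent.of_eventuallyEq {f f' : (Fin 2 → ℝ) → (Fin 3 → ℝ)} (h : f =ᶠ[𝓝 0] f') :
    AEquivalent f f' :=
  ⟨id, id, IsDiffeoGerm.id, IsDiffeoGerm.id, h⟩

/-- A germ that is `𝒜`-equivalent to `F` factors through `F`. -/
theorem AEquivalent.exists_factorization {f F : (Fin 2 → ℝ) → (Fin 3 → ℝ)} (h : AEquivalent f F)
    (hf : ContinuousAt f 0) (hf0 : f 0 = 0) :
    ∃ (Φ : (Fin 3 → ℝ) → (Fin 3 → ℝ)) (D : (Fin 2 → ℝ) → (Fin 2 → ℝ)), IsDiffeoGerm Φ ∧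
      IsDiffeoGerm D ∧ f =ᶠ[𝓝 0] Φ ∘ F ∘ D := by
  obtain ⟨ds, dt, hs, ht, h⟩ := h
  obtain ⟨h1, h2, e, h3, h4, h5, h6⟩ := ht
  refine ⟨e, ds, ⟨h3, h4, dt, h1, h2, h6, h5⟩, hs, ?_⟩
  have hf' : Tendsto f (𝓝 0) (𝓝 0) := by simpa [ContinuousAt, hf0] using hf
  filter_upwards [h, hf'.eventually h5] with x hx hx'
  simp [← hx, hx']

/-- The map-germ `(u, v) ↦ (u, v², v³ φ(u, v²))`. -/
def cuspForm (φ : ℝ × ℝ → ℝ) (p : Fin 2 → ℝ) : Fin 3 → ℝ :=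
  ![p 0, p 1 ^ 2, p 1 ^ 3 * φ (p 0, p 1 ^ 2)]

theorem cuspidalS_eq_cuspForm {k : ℕ} (hk : 2 ≤ k) (ε : ℝ) :
    cuspidalS (k - 1) ε = cuspForm fun x ↦ x.1 ^ k + ε * x.2 := by
  funext p
  simp [cuspidalS, cuspForm, Nat.sub_add_cancel (by omega : 1 ≤ k)]

/-! ### Reduction to the form `(u, v², v³ φ(u, v²))` -/

section Vectors

variable {E : Type*} [NormedAddCommGroup E] [NormedSpace ℝ E]

theorem ContDiffAt.vec2 {a b : E → ℝ} {x : E} {n : WithTop ℕ∞} (ha : ContDiffAt ℝ n a x)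
    (hb : ContDiffAt ℝ n b x) : ContDiffAt ℝ n (fun x ↦ ![a x, b x]) x := by
  rw [contDiffAt_pi]
  intro i; fin_cases i <;> simpa

theorem ContDiffAt.vec3 {a b c : E → ℝ} {x : E} {n : WithTop ℕ∞} (ha : ContDiffAt ℝ n a x)
    (hb : ContDiffAt ℝ n b x) (hc : ContDiffAt ℝ n c x) :
    ContDiffAt ℝ n (fun x ↦ ![a x, b x, c x]) x := by
  rw [contDiffAt_pi]
  intro i; fin_cases i <;> simpa

theorem ContDiff.vec2 {a b : E → ℝ} {n : WithTop ℕ∞} (ha : ContDiff ℝ n a)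
    (hb : ContDiff ℝ n b) : ContDiff ℝ n (fun x ↦ ![a x, b x]) :=
  contDiff_iff_contDiffAt.2 fun _ ↦ ha.contDiffAt.vec2 hb.contDiffAt

theorem ContDiff.vec3 {a b c : E → ℝ} {n : WithTop ℕ∞} (ha : ContDiff ℝ n a)
    (hb : ContDiff ℝ n b) (hc : ContDiff ℝ n c) : ContDiff ℝ n (fun x ↦ ![a x, b x, c x]) :=
  contDiff_iff_contDiffAt.2 fun _ ↦ ha.contDiffAt.vec3 hb.contDiffAt hc.contDiffAt

theorem fderiv_vec2_apply {a b : E → ℝ} {a' b' : E →L[ℝ] ℝ} {x : E} (ha : HasFDerivAt a a' x)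
    (hb : HasFDerivAt b b' x) (X : E) : fderiv ℝ (fun x ↦ ![a x, b x]) x X = ![a' X, b' X] := by
  have : HasFDerivAt (fun x ↦ ![a x, b x]) (ContinuousLinearMap.pi ![a', b']) x := by
    rw [hasFDerivAt_pi]
    intro i; fin_cases i <;> simpa
  rw [this.fderiv]
  ext i; fin_cases i <;> simp

theorem fderiv_vec3_apply {a b c : E → ℝ} {a' b' c' : E →L[ℝ] ℝ} {x : E} (ha : HasFDerivAt a a' x)
    (hb : HasFDerivAt b b' x) (hc : HasFDerivAt c c' x) (X : E) :
    fderiv ℝ (fun x ↦ ![a x, b x, c x]) x X = ![a' X, b' X, c' X] := by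
  have : HasFDerivAt (fun x ↦ ![a x, b x, c x]) (ContinuousLinearMap.pi ![a', b', c']) x := by
    rw [hasFDerivAt_pi]
    intro i; fin_cases i <;> simpa
  rw [this.fderiv]
  ext i; fin_cases i <;> simp

theorem hasFDerivAt_coord {n : ℕ} (i : Fin n) (x : Fin n → ℝ) :
    HasFDerivAt (fun p : Fin n → ℝ ↦ p i) (ContinuousLinearMap.proj i : (Fin n → ℝ) →L[ℝ] ℝ) x :=
  (ContinuousLinearMap.proj (R := ℝ) (φ := fun _ : Fin n ↦ ℝ) i).hasFDerivAt

/-- The derivative at `0` of a coordinate times a function. -/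
theorem hasFDerivAt_coord_mul {n : ℕ} (i : Fin n) {q : (Fin n → ℝ) → ℝ}
    (hq : DifferentiableAt ℝ q 0) :
    HasFDerivAt (fun p : Fin n → ℝ ↦ p i * q p)
      (q 0 • (ContinuousLinearMap.proj i : (Fin n → ℝ) →L[ℝ] ℝ)) 0 := by
  refine ((hasFDerivAt_coord i (0 : Fin n → ℝ)).mul hq.hasFDerivAt).congr_fderiv ?_
  ext; simp

end Vectors

theorem isDiffeoGerm_shear (b : ℝ → ℝ) (c : ℝ × ℝ → ℝ) (hb : ContDiff ℝ ∞ b) (hc : ContDiff ℝ ∞ c)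
    (hb0 : b 0 = 0) (hc0 : c 0 = 0) :
    IsDiffeoGerm fun q : Fin 3 → ℝ ↦ ![q 0, q 1 - b (q 0), q 2 - c (q 0, q 1)] := by
  have hc0' : c (0, 0) = 0 := hc0
  refine ⟨ContDiff.isSmoothGerm (ContDiff.vec3 ?_ ?_ ?_) 0, ?_,
    fun q ↦ ![q 0, q 1 + b (q 0), q 2 + c (q 0, q 1 + b (q 0))],
    ContDiff.isSmoothGerm (ContDiff.vec3 ?_ ?_ ?_) 0, ?_, Eventually.of_forall fun q ↦ ?_,
    Eventually.of_forall fun q ↦ ?_⟩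
  any_goals fun_prop
  · ext i; fin_cases i <;> simp [hb0, hc0']
  · ext i; fin_cases i <;> simp [hb0, hc0']
  · ext i; fin_cases i <;> simp
  · ext i; fin_cases i <;> simp

/-- Splitting `N` into its even and odd part in `v` gives `N = E(u, v²) + v φ(u, v²)`. -/
theorem exists_even_odd_decomposition (N : (Fin 2 → ℝ) → ℝ) (hN : ContDiff ℝ ∞ N) :
    ∃ G φ : ℝ × ℝ → ℝ, ContDiff ℝ ∞ G ∧ ContDiff ℝ ∞ φ ∧
      ∀ᶠ p in 𝓝 (0 : Fin 2 → ℝ), N p = G (p 0, p 1 ^ 2) + p 1 * φ (p 0, p 1 ^ 2) := by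
  have h1 : ContDiff ℝ ∞ fun x : ℝ × ℝ ↦ N ![x.1, x.2] :=
    hN.comp (contDiff_fst.vec2 contDiff_snd)
  have h2 : ContDiff ℝ ∞ fun x : ℝ × ℝ ↦ N ![x.1, -x.2] :=
    hN.comp (contDiff_fst.vec2 contDiff_snd.neg)
  obtain ⟨G, hG, hGe⟩ := exists_eq_comp_sq_of_even
    (fun x ↦ (N ![x.1, x.2] + N ![x.1, -x.2]) / 2) ((h1.add h2).div_const 2)
    (fun u v ↦ by simp [add_comm])
  obtain ⟨S, hS, hSe⟩ := exists_hadamard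
    (fun x ↦ (N ![x.1, x.2] - N ![x.1, -x.2]) / 2) ((h1.sub h2).div_const 2)
  obtain ⟨φ, hφ, hφe⟩ := exists_eq_comp_sq_of_even S hS (fun u v ↦ by
    rcases eq_or_ne v 0 with rfl | hv
    · simp
    · have e1 := hSe u v
      have e2 := hSe u (-v)
      simp only [neg_zero, sub_self, zero_div, zero_add, neg_neg, smul_eq_mul] at e1 e2
      apply mul_left_cancel₀ hv
      linarith)
  refine ⟨G, φ, hG, hφ, ?_⟩
  have hc : Tendsto (fun p : Fin 2 → ℝ ↦ (p 0, p 1)) (𝓝 0) (𝓝 (0 : ℝ × ℝ)) := by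
    have : Continuous (fun p : Fin 2 → ℝ ↦ (p 0, p 1)) := by fun_prop
    exact this.continuousAt (x := 0)
  filter_upwards [hc.eventually hGe, hc.eventually hφe] with p hp hp'
  have e1 := hSe (p 0) (p 1)
  simp only [neg_zero, sub_self, zero_div, zero_add, smul_eq_mul] at e1
  rw [← hp, ← hp', ← e1]
  have : ![p 0, p 1] = p := by ext i; fin_cases i <;> rfl
  simp only [this]; ring

/-- The even part of the third component is a function of the other two components and is removed by
a shear of the target; the odd part gives `v³ φ(u, v²)`. -/
theorem aEquivalent_cuspForm_of_sq (N : (Fin 2 → ℝ) → ℝ) (hN : ContDiff ℝ ∞ N) :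
    ∃ φ : ℝ × ℝ → ℝ, ContDiff ℝ ∞ φ ∧
      AEquivalent (fun p ↦ ![p 0, p 1 ^ 2, p 1 ^ 2 * N p]) (cuspForm φ) := by
  obtain ⟨G, φ, hG, hφ, h⟩ := exists_even_odd_decomposition N hN
  refine ⟨φ, hφ, AEquivalent.of_target (isDiffeoGerm_shear (fun _ ↦ 0) (fun x ↦ x.2 * G x)
    contDiff_const (contDiff_snd.mul hG) rfl (by simp)) ?_⟩
  filter_upwards [h] with p hp
  ext i; fin_cases i
  · simp [cuspForm]
  · simp [cuspForm]
  · simp [cuspForm, hp]; ring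

/-- A map `(a, v² Q, v² R)`, where `a` has the form `A(u) + v² T` and `Q > 0`, is normalized by
taking `a` and `v √Q` as coordinates. -/
theorem aEquivalent_cuspForm_of_fold (A : ℝ → ℝ) (T Q R : (Fin 2 → ℝ) → ℝ) (hA : ContDiff ℝ ∞ A)
    (hT : ContDiff ℝ ∞ T) (hQ : ContDiff ℝ ∞ Q) (hR : ContDiff ℝ ∞ R) (hA0 : A 0 = 0)
    (hA' : deriv A 0 ≠ 0) (hQ0 : 0 < Q 0) :
    ∃ φ : ℝ × ℝ → ℝ, ContDiff ℝ ∞ φ ∧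
      AEquivalent (fun p ↦ ![A (p 0) + p 1 ^ 2 * T p, p 1 ^ 2 * Q p, p 1 ^ 2 * R p])
        (cuspForm φ) := by
  have hpos : ∀ᶠ p in 𝓝 (0 : Fin 2 → ℝ), 0 < Q p :=
    hQ.continuous.continuousAt.eventually_const_lt hQ0
  have hsqrt : ∀ p, 0 < Q p → ContDiffAt ℝ ∞ (fun p ↦ √(Q p)) p := fun p hp ↦
    hQ.contDiffAt.sqrt hp.ne'
  have hd : IsDiffeoGerm fun p : Fin 2 → ℝ ↦ ![A (p 0) + p 1 ^ 2 * T p, p 1 * √(Q p)] := by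
    refine isDiffeoGerm_of_fderiv_injective ?_ ?_ fun X hX ↦ ?_
    · filter_upwards [hpos] with p hp
      have := hsqrt p hp
      exact ContDiffAt.vec2 (ContDiff.contDiffAt (by fun_prop)) (by fun_prop)
    · ext i; fin_cases i <;> simp [hA0]
    · have e0 : HasFDerivAt (fun p : Fin 2 → ℝ ↦ A (p 0) + p 1 ^ 2 * T p)
          (deriv A 0 • (ContinuousLinearMap.proj 0 : (Fin 2 → ℝ) →L[ℝ] ℝ)) 0 := by
        have a1 : HasFDerivAt (fun p : Fin 2 → ℝ ↦ A (p 0))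
            (deriv A 0 • (ContinuousLinearMap.proj 0 : (Fin 2 → ℝ) →L[ℝ] ℝ)) 0 :=
          ((hA.differentiable (by simp) 0).hasDerivAt).comp_hasFDerivAt_of_eq _
            (hasFDerivAt_coord 0 0) rfl
        have a2 := hasFDerivAt_coord_mul (1 : Fin 2) (q := fun p ↦ p 1 * T p)
          (ContDiff.differentiable (n := ∞) (by fun_prop) (by simp) 0)
        refine ((a1.add a2).congr_fderiv ?_).congr_of_eventuallyEq
          (Eventually.of_forall fun p ↦ ?_)
        · ext; simp
        · simp; ring
      have e1 := hasFDerivAt_coord_mul (1 : Fin 2) ((hsqrt 0 hQ0).differentiableAt (by simp))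
      rw [fderiv_vec2_apply e0 e1] at hX
      have x0 := congrFun hX 0
      have x1 := congrFun hX 1
      have hs := (Real.sqrt_pos.2 hQ0).ne'
      simp [hA', hs] at x0 x1
      ext i; fin_cases i <;> simp [x0, x1]
  obtain ⟨-, -, e, he, he0, hed, -⟩ := id hd
  have hN : IsSmoothGerm (fun q ↦ R (e q) / Q (e q)) 0 := by
    have hc : Tendsto e (𝓝 0) (𝓝 0) := by simpa [ContinuousAt, he0] using he.continuousAt
    filter_upwards [he, hc.eventually hpos] with q hq hq'
    exact (hR.contDiffAt.comp q hq).div (hQ.contDiffAt.comp q hq) hq'.ne'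
  obtain ⟨N, hNs, hNe⟩ := hN.exists_contDiff
  obtain ⟨φ, hφ, hequiv⟩ := aEquivalent_cuspForm_of_sq N hNs
  refine ⟨φ, hφ, (AEquivalent.of_source hd ?_).trans hequiv⟩
  filter_upwards [hed, hpos, hd.tendsto.eventually hNe] with p hp hp' hp''
  rw [hp] at hp''
  ext i; fin_cases i
  · simp
  · simp [mul_pow, Real.sq_sqrt hp'.le]
  · simp [mul_pow, Real.sq_sqrt hp'.le, ← hp'']
    field_simp

theorem exists_linear_normalization {a b : Fin 3 → ℝ} (h : LinearIndependent ℝ ![a, b]) :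
    ∃ L : (Fin 3 → ℝ) ≃L[ℝ] (Fin 3 → ℝ), L a = ![1, 0, 0] ∧ L b = ![0, 1, 0] := by
  obtain ⟨c, hc⟩ := exists_linearIndependent_snoc_of_lt_finrank h (by simp)
  let B := basisOfLinearIndependentOfCardEqFinrank hc (by simp)
  have hB : ∀ i, B i = (Fin.snoc ![a, b] c : Fin 3 → (Fin 3 → ℝ)) i := fun i ↦ by simp [B]
  refine ⟨B.equivFun.toContinuousLinearEquiv, ?_, ?_⟩
  · have : a = B 0 := (hB 0).symm
    rw [this]
    ext i; fin_cases i <;> simp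
  · have : b = B 1 := (hB 1).symm
    rw [this]
    ext i; fin_cases i <;> simp

/-- The second-order Hadamard expansion `g = A(u) + v² T(u, v)` of a map with `g_v(u, 0) = 0`. -/
theorem exists_fold_expansion (g : (Fin 2 → ℝ) → (Fin 3 → ℝ)) (hg : ContDiff ℝ ∞ g)
    (hv : ∀ᶠ u in 𝓝 (0 : ℝ), fderiv ℝ g ![u, 0] ![0, 1] = 0) :
    ∃ T : ℝ × ℝ → (Fin 3 → ℝ), ContDiff ℝ ∞ T ∧
      (∀ᶠ u in 𝓝 (0 : ℝ), ∀ v, g ![u, v] = g ![u, 0] + v ^ 2 • T (u, v)) ∧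
      iteratedDeriv 2 (fun v ↦ g ![0, v]) 0 = (2 : ℝ) • T (0, 0) := by
  have hG : ContDiff ℝ ∞ fun x : ℝ × ℝ ↦ g ![x.1, x.2] :=
    hg.comp (contDiff_fst.vec2 contDiff_snd)
  obtain ⟨S, hS, hSe⟩ := exists_hadamard _ hG
  obtain ⟨T, hT, hTe⟩ := exists_hadamard S hS
  have hS0 : ∀ u, fderiv ℝ g ![u, 0] ![0, 1] = 0 → S (u, 0) = 0 := by
    intro u hu
    have h1 : HasDerivAt (fun v : ℝ ↦ (![u, v] : Fin 2 → ℝ)) ![0, 1] 0 := by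
      rw [hasDerivAt_pi]
      intro i; fin_cases i
      · exact hasDerivAt_const 0 u
      · exact hasDerivAt_id 0
    have h2 := ((hg.differentiable (by simp)) ![u, 0]).hasFDerivAt.comp_hasDerivAt (0 : ℝ) h1
    have hSd : DifferentiableAt ℝ (fun v : ℝ ↦ S (u, v)) 0 :=
      ContDiff.differentiable (n := ∞) (hS.comp (contDiff_const.prodMk contDiff_id)) (by simp) 0
    have h3 : HasDerivAt (fun v : ℝ ↦ g ![u, 0] + v • S (u, v)) (S (u, 0)) 0 := by
      have := ((hasDerivAt_id (0 : ℝ)).smul hSd.hasDerivAt).const_add (g ![u, 0])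
      simpa using this
    have h4 : (g ∘ fun v : ℝ ↦ ![u, v]) = fun v : ℝ ↦ g ![u, 0] + v • S (u, v) :=
      funext fun v ↦ hSe u v
    rw [h4, hu] at h2
    exact h3.unique h2
  have hmain : ∀ u, fderiv ℝ g ![u, 0] ![0, 1] = 0 →
      ∀ v, g ![u, v] = g ![u, 0] + v ^ 2 • T (u, v) := by
    intro u hu v
    have := hSe u v
    rw [hTe, hS0 u hu, zero_add, smul_smul, ← pow_two] at this
    exact this
  refine ⟨T, hT, hv.mono hmain, ?_⟩
  have hτ : ContDiff ℝ ∞ fun v : ℝ ↦ T (0, v) := hT.comp (contDiff_const.prodMk contDiff_id)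
  have hτd : Differentiable ℝ fun v : ℝ ↦ T (0, v) := hτ.differentiable (by simp)
  have hτ' : Differentiable ℝ (deriv fun v : ℝ ↦ T (0, v)) :=
    ((contDiff_infty_iff_deriv.1 hτ).2).differentiable (by simp)
  have e1 : (fun v ↦ g ![0, v]) = fun v ↦ g ![0, 0] + v ^ 2 • T (0, v) :=
    funext (hmain 0 hv.self_of_nhds)
  have e2 : deriv (fun v ↦ g ![0, v]) =
      fun v ↦ v • ((2 : ℝ) • T (0, v) + v • deriv (fun v : ℝ ↦ T (0, v)) v) := by
    funext v
    rw [e1]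
    have := (((hasDerivAt_pow 2 v).smul (hτd v).hasDerivAt).const_add (g ![0, 0])).deriv
    refine this.trans ?_
    simp only [Nat.cast_ofNat, Nat.add_one_sub_one, pow_one, smul_add, smul_smul]
    rw [add_comm]; congr 2 <;> ring
  rw [iteratedDeriv_succ, iteratedDeriv_one, e2]
  have h5 : DifferentiableAt ℝ
      (fun v : ℝ ↦ (2 : ℝ) • T (0, v) + v • deriv (fun v : ℝ ↦ T (0, v)) v) 0 :=
    ((hτd 0).const_smul (2 : ℝ)).add (differentiableAt_id.smul (hτ' 0))
  have := ((hasDerivAt_id (0 : ℝ)).smul h5.hasDerivAt).deriv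
  refine this.trans ?_
  simp

/-- The preparation theorem: a map with `g_v(u, 0) = 0` and with `g_u(0)`, `g_vv(0)` linearly
independent can be brought to the form `(u, v², v³ φ(u, v²))`. After a linear change of the target
the image of the line `v = 0` is a graph over the first coordinate axis; subtracting this graph makes
the other two components divisible by `v²`. -/
theorem exists_aEquivalent_cuspForm (g : (Fin 2 → ℝ) → (Fin 3 → ℝ)) (hg : ContDiff ℝ ∞ g)
    (hg0 : g 0 = 0) (hv : ∀ᶠ u in 𝓝 (0 : ℝ), fderiv ℝ g ![u, 0] ![0, 1] = 0)
    (hlin : LinearIndependent ℝ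
      ![fderiv ℝ g 0 ![1, 0], iteratedDeriv 2 (fun v ↦ g ![0, v]) 0]) :
    ∃ φ : ℝ × ℝ → ℝ, ContDiff ℝ ∞ φ ∧ AEquivalent g (cuspForm φ) := by
  obtain ⟨T, hT, hexp, h2⟩ := exists_fold_expansion g hg hv
  have hlin' : LinearIndependent ℝ ![fderiv ℝ g 0 ![1, 0], T (0, 0)] := by
    rw [h2] at hlin
    have := hlin.units_smul ![1, Units.mk0 (1 / 2 : ℝ) (by norm_num)]
    convert this using 1
    ext i; fin_cases i <;> simp [Units.smul_def]
  obtain ⟨L, hL1, hL2⟩ := exists_linear_normalization hlin'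
  have hLs : ContDiff ℝ ∞ L := L.contDiff
  let A : Fin 3 → ℝ → ℝ := fun i u ↦ L (g ![u, 0]) i
  let τ : Fin 3 → (Fin 2 → ℝ) → ℝ := fun i p ↦ L (T (p 0, p 1)) i
  have hcoord : ∀ i, ContDiff ℝ ∞ fun q : Fin 3 → ℝ ↦ q i := fun i ↦ contDiff_apply ℝ ℝ i
  have hA : ∀ i, ContDiff ℝ ∞ (A i) := fun i ↦
    (hcoord i).comp (hLs.comp (hg.comp (contDiff_id.vec2 contDiff_const)))
  have hτ : ∀ i, ContDiff ℝ ∞ (τ i) := fun i ↦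
    (hcoord i).comp (hLs.comp (hT.comp (by fun_prop)))
  have hz : (![0, 0] : Fin 2 → ℝ) = 0 := by ext i; fin_cases i <;> rfl
  have hA0 : ∀ i, A i 0 = 0 := fun i ↦ by simp [A, hz, hg0]
  have hA' : deriv (A 0) 0 = 1 := by
    have h1 : HasDerivAt (fun u : ℝ ↦ (![u, 0] : Fin 2 → ℝ)) ![1, 0] 0 := by
      rw [hasDerivAt_pi]
      intro i; fin_cases i
      · exact hasDerivAt_id 0
      · exact hasDerivAt_const 0 (0 : ℝ)
    have h2 : HasDerivAt (fun u : ℝ ↦ g ![u, 0]) (fderiv ℝ g 0 ![1, 0]) 0 :=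
      ((hg.differentiable (by simp)) 0).hasFDerivAt.comp_hasDerivAt_of_eq (0 : ℝ) h1 hz.symm
    have h3 := (L : (Fin 3 → ℝ) →L[ℝ] (Fin 3 → ℝ)).hasFDerivAt.comp_hasDerivAt (0 : ℝ) h2
    have h4 := (hasDerivAt_pi.1 h3 0).deriv
    refine h4.trans ?_
    simp [hL1]
  have hτ0 : τ 0 0 = 0 := by simp [τ, hL2]
  have hτ1 : τ 1 0 = 1 := by simp [τ, hL2]
  have hgexp : ∀ᶠ p in 𝓝 (0 : Fin 2 → ℝ), ∀ i, L (g p) i = A i (p 0) + p 1 ^ 2 * τ i p := by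
    have hc : Tendsto (fun p : Fin 2 → ℝ ↦ p 0) (𝓝 0) (𝓝 0) :=
      (continuous_apply (0 : Fin 2)).continuousAt (x := (0 : Fin 2 → ℝ))
    filter_upwards [hc.eventually hexp] with p hp i
    have e : p = ![p 0, p 1] := by ext i; fin_cases i <;> rfl
    have := hp (p 1)
    rw [← e] at this
    rw [this]
    simp [A, τ]
  -- `β` is the inverse of the first component along the singular curve
  have hdA : IsDiffeoGerm (A 0) := by
    refine isDiffeoGerm_of_fderiv_injective ((hA 0).isSmoothGerm 0) (hA0 0) fun X hX ↦ ?_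
    rw [fderiv_eq_smul_deriv, hA'] at hX
    simpa using hX
  obtain ⟨-, -, β', hβ', hβ0', hβA', -⟩ := id hdA
  obtain ⟨β, hβ, hβe⟩ := hβ'.exists_contDiff
  have hβ0 : β 0 = 0 := by rw [← hβe.self_of_nhds, hβ0']
  have hβA : ∀ᶠ u in 𝓝 (0 : ℝ), β (A 0 u) = u := by
    filter_upwards [hβA', hdA.tendsto.eventually hβe] with u h1 h2
    rw [← h2, h1]
  let B : Fin 3 → ℝ → ℝ := fun i ↦ A i ∘ β
  have hB : ∀ i, ContDiff ℝ ∞ (B i) := fun i ↦ (hA i).comp hβ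
  have hB0 : ∀ i, B i 0 = 0 := fun i ↦ by simp [B, hβ0, hA0]
  have hhad : ∀ i, ∃ S : ℝ × ℝ → ℝ, ContDiff ℝ ∞ S ∧
      ∀ s w, B i (s + w) = B i s + w * S (s, w) := by
    intro i
    obtain ⟨S, hS, h⟩ := exists_hadamard (fun x : ℝ × ℝ ↦ B i (x.1 + x.2))
      ((hB i).comp (contDiff_fst.add contDiff_snd))
    exact ⟨S, hS, fun s w ↦ by simpa using h s w⟩
  choose S hS hSe using hhad
  let Q : Fin 3 → (Fin 2 → ℝ) → ℝ := fun i p ↦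
    τ i p - τ 0 p * S i (A 0 (p 0), p 1 ^ 2 * τ 0 p)
  have hQ : ∀ i, ContDiff ℝ ∞ (Q i) := fun i ↦ by
    have := hτ i; have := hτ 0; have := hS i; have := hA 0
    fun_prop
  have hQ0 : 0 < Q 1 0 := by simp [Q, hτ0, hτ1]
  obtain ⟨φ, hφ, hfold⟩ := aEquivalent_cuspForm_of_fold (A 0) (τ 0) (Q 1) (Q 2) (hA 0) (hτ 0)
    (hQ 1) (hQ 2) (hA0 0) (by rw [hA']; exact one_ne_zero) hQ0
  refine ⟨φ, hφ, AEquivalent.trans (AEquivalent.of_target (f' := L ∘ g) (d := L) ?_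
    (Eventually.of_forall fun x ↦ rfl)) (AEquivalent.trans (AEquivalent.of_target
    (isDiffeoGerm_shear (B 1) (fun x ↦ B 2 x.1) (hB 1) ((hB 2).comp contDiff_fst) (hB0 1)
      (hB0 2)) ?_) hfold)⟩
  · exact ⟨hLs.isSmoothGerm 0, map_zero L, L.symm, L.symm.contDiff.isSmoothGerm 0, map_zero _,
      Eventually.of_forall fun x ↦ by simp, Eventually.of_forall fun x ↦ by simp⟩
  · have hc : Tendsto (fun p : Fin 2 → ℝ ↦ p 0) (𝓝 0) (𝓝 0) :=
      (continuous_apply (0 : Fin 2)).continuousAt (x := (0 : Fin 2 → ℝ))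
    filter_upwards [hgexp, hc.eventually hβA] with p hp hp'
    have key : ∀ i, L (g p) i - B i (L (g p) 0) = p 1 ^ 2 * Q i p := by
      intro i
      rw [hp i, hp 0, hSe]
      simp only [B, Function.comp_apply, hp', Q]
      ring
    ext i; fin_cases i
    · simpa using hp 0
    · simpa using key 1
    · simpa using key 2

/-! ### Recognition of the normal form -/

/-- If `φ(u, w) = uᵏ θ(u) + w φ₁(u, w)` with `θ(0), φ₁(0) ≠ 0`, then dividing the third component by
`|φ₁|` and taking `u |θ/φ₁|^(1/k)` as a coordinate in source and target gives the normal form. -/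
theorem aEquivalent_normalForm (φ φ₁ : ℝ × ℝ → ℝ) (θ : ℝ → ℝ) {k : ℕ} (hk : k ≠ 0)
    (hφ₁ : ContDiff ℝ ∞ φ₁) (hθ : ContDiff ℝ ∞ θ)
    (h : ∀ u w, φ (u, w) = u ^ k * θ u + w * φ₁ (u, w)) (hφ₁0 : φ₁ 0 ≠ 0) (hθ0 : θ 0 ≠ 0) :
    AEquivalent (cuspForm φ)
      (cuspForm fun x ↦ x.1 ^ k + Real.sign (θ 0) * Real.sign (φ₁ 0) * x.2) := by
  set σ := Real.sign (φ₁ 0) with hσ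
  set τ := Real.sign (θ 0) with hτ
  have sq_sign : ∀ r : ℝ, r ≠ 0 → Real.sign r * Real.sign r = 1 := fun r hr ↦ by
    rcases Real.sign_apply_eq_of_ne_zero r hr with h | h <;> rw [h] <;> norm_num
  have hσ2 : σ * σ = 1 := sq_sign _ hφ₁0
  have hτ2 : τ * τ = 1 := sq_sign _ hθ0
  have hτ0 : τ ≠ 0 := fun h0 ↦ by simp [h0] at hτ2
  -- `ρ = |φ₁|` and `ϑ = |θ|` near the origin
  let ρ : ℝ × ℝ → ℝ := fun x ↦ σ * φ₁ x
  let ϑ : ℝ × ℝ → ℝ := fun x ↦ τ * θ x.1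
  have hρs : ContDiff ℝ ∞ ρ := contDiff_const.mul hφ₁
  have hϑs : ContDiff ℝ ∞ ϑ := contDiff_const.mul (hθ.comp contDiff_fst)
  have hρ0 : 0 < ρ 0 := Real.sign_mul_pos_of_ne_zero _ hφ₁0
  have hϑ0 : 0 < ϑ 0 := Real.sign_mul_pos_of_ne_zero _ hθ0
  have hρ : ∀ᶠ x in 𝓝 (0 : ℝ × ℝ), 0 < ρ x := hρs.continuous.continuousAt.eventually_const_lt hρ0
  have hϑ : ∀ᶠ x in 𝓝 (0 : ℝ × ℝ), 0 < ϑ x := hϑs.continuous.continuousAt.eventually_const_lt hϑ0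
  let m : ℝ × ℝ → ℝ := fun x ↦ (ϑ x / ρ x) ^ (1 / (k : ℝ))
  have hm : ∀ x, 0 < ρ x → 0 < ϑ x → ContDiffAt ℝ ∞ m x := fun x h1 h2 ↦
    (hϑs.contDiffAt.div hρs.contDiffAt h1.ne').rpow_const_of_ne (div_pos h2 h1).ne'
  have hmk : ∀ x, 0 < ρ x → 0 < ϑ x → m x ^ k = ϑ x / ρ x := fun x h1 h2 ↦ by
    simp only [m, one_div]
    exact Real.rpow_inv_natCast_pow (div_pos h2 h1).le hk
  have hm0 : m 0 ≠ 0 := (Real.rpow_pos_of_pos (div_pos hϑ0 hρ0) _).ne'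
  have hsrc : Tendsto (fun p : Fin 2 → ℝ ↦ (p 0, p 1 ^ 2)) (𝓝 0) (𝓝 (0 : ℝ × ℝ)) := by
    have : Continuous fun p : Fin 2 → ℝ ↦ (p 0, p 1 ^ 2) := by fun_prop
    exact this.tendsto' _ _ (by simp)
  have htgt : Tendsto (fun q : Fin 3 → ℝ ↦ (q 0, q 1)) (𝓝 0) (𝓝 (0 : ℝ × ℝ)) := by
    have : Continuous fun q : Fin 3 → ℝ ↦ (q 0, q 1) := by fun_prop
    exact this.continuousAt (x := 0)
  have hms : ∀ p : Fin 2 → ℝ, 0 < ρ (p 0, p 1 ^ 2) → 0 < ϑ (p 0, p 1 ^ 2) →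
      ContDiffAt ℝ ∞ (fun p : Fin 2 → ℝ ↦ m (p 0, p 1 ^ 2)) p := fun p h1 h2 ↦
    ContDiffAt.comp p (hm _ h1 h2) (ContDiff.contDiffAt (by fun_prop))
  have hmt : ∀ q : Fin 3 → ℝ, 0 < ρ (q 0, q 1) → 0 < ϑ (q 0, q 1) →
      ContDiffAt ℝ ∞ (fun q : Fin 3 → ℝ ↦ m (q 0, q 1)) q := fun q h1 h2 ↦
    ContDiffAt.comp q (hm _ h1 h2) (ContDiff.contDiffAt (by fun_prop))
  have hrt : ∀ q : Fin 3 → ℝ, 0 < ρ (q 0, q 1) →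
      ContDiffAt ℝ ∞ (fun q : Fin 3 → ℝ ↦ τ / ρ (q 0, q 1)) q := fun q h1 ↦
    contDiffAt_const.div (hρs.contDiffAt.comp q (ContDiff.contDiffAt (by fun_prop))) h1.ne'
  have z2 : (((0 : Fin 2 → ℝ) 0, (0 : Fin 2 → ℝ) 1 ^ 2) : ℝ × ℝ) = 0 := by simp
  have z3 : (((0 : Fin 3 → ℝ) 0, (0 : Fin 3 → ℝ) 1) : ℝ × ℝ) = 0 := rfl
  refine ⟨fun p ↦ ![p 0 * m (p 0, p 1 ^ 2), p 1],
    fun q ↦ ![q 0 * m (q 0, q 1), q 1, q 2 * (τ / ρ (q 0, q 1))], ?_, ?_, ?_⟩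
  · refine isDiffeoGerm_of_fderiv_injective ?_ ?_ fun X hX ↦ ?_
    · filter_upwards [hsrc.eventually hρ, hsrc.eventually hϑ] with p h1 h2
      have := hms p h1 h2
      exact ContDiffAt.vec2 (by fun_prop) (by fun_prop)
    · ext i; fin_cases i <;> simp
    · have e0 := hasFDerivAt_coord_mul (0 : Fin 2)
        ((hms 0 (by rwa [z2]) (by rwa [z2])).differentiableAt (by simp))
      rw [fderiv_vec2_apply e0 (hasFDerivAt_coord 1 0)] at hX
      have x0 := congrFun hX 0
      have x1 := congrFun hX 1
      simp only [z2] at x0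
      simp [hm0] at x0 x1
      ext i; fin_cases i <;> simp [x0, x1]
  · refine isDiffeoGerm_of_fderiv_injective ?_ ?_ fun X hX ↦ ?_
    · filter_upwards [htgt.eventually hρ, htgt.eventually hϑ] with q h1 h2
      have := hmt q h1 h2
      have := hrt q h1
      exact ContDiffAt.vec3 (by fun_prop) (by fun_prop) (by fun_prop)
    · ext i; fin_cases i <;> simp
    · have e0 := hasFDerivAt_coord_mul (0 : Fin 3)
        ((hmt 0 (by rwa [z3]) (by rwa [z3])).differentiableAt (by simp))
      have e2 := hasFDerivAt_coord_mul (2 : Fin 3)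
        ((hrt 0 (by rwa [z3])).differentiableAt (by simp))
      rw [fderiv_vec3_apply e0 (hasFDerivAt_coord 1 0) e2] at hX
      have x0 := congrFun hX 0
      have x1 := congrFun hX 1
      have x2 := congrFun hX 2
      simp only [z3] at x0 x2
      simp [hm0, hτ0, hρ0.ne'] at x0 x1 x2
      ext i; fin_cases i <;> simp [x0, x1, x2]
  · filter_upwards [hsrc.eventually hρ, hsrc.eventually hϑ] with p h1 h2
    ext i; fin_cases i
    · simp [cuspForm]
    · simp [cuspForm]
    · have e1 : φ (p 0, p 1 ^ 2) * (τ / ρ (p 0, p 1 ^ 2)) =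
          (p 0 * m (p 0, p 1 ^ 2)) ^ k + τ * σ * p 1 ^ 2 := by
        have e2 : p 1 ^ 2 * φ₁ (p 0, p 1 ^ 2) = σ * (p 1 ^ 2 * ρ (p 0, p 1 ^ 2)) := by
          simp only [ρ]; linear_combination (-(p 1 ^ 2 * φ₁ (p 0, p 1 ^ 2))) * hσ2
        rw [mul_pow, hmk _ h1 h2, h, e2]
        have e3 : p 0 ^ k * θ (p 0) * τ = p 0 ^ k * ϑ (p 0, p 1 ^ 2) := by simp only [ϑ]; ring
        field_simp
        linear_combination e3
      simp only [cuspForm]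
      simp [mul_assoc, e1]

/-- For odd `k` the sign of the normal form can be changed by reversing both coordinates of the
source and the first coordinate of the target. -/
theorem aEquivalent_normalForm_neg {k : ℕ} (hk : Odd k) (ε : ℝ) :
    AEquivalent (cuspForm fun x ↦ x.1 ^ k + ε * x.2) (cuspForm fun x ↦ x.1 ^ k + (-ε) * x.2) := by
  have inv : ∀ q : Fin 3 → ℝ, (![-(-q 0), q 1, q 2] : Fin 3 → ℝ) = q := fun q ↦ by
    ext i; fin_cases i <;> simp
  have hs : ContDiff ℝ ∞ fun q : Fin 3 → ℝ ↦ ![-q 0, q 1, q 2] :=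
    ContDiff.vec3 (by fun_prop) (by fun_prop) (by fun_prop)
  have h0 : (![-(0 : Fin 3 → ℝ) 0, (0 : Fin 3 → ℝ) 1, (0 : Fin 3 → ℝ) 2] : Fin 3 → ℝ) = 0 := by
    ext i; fin_cases i <;> simp
  refine ⟨fun p ↦ -p, fun q ↦ ![-q 0, q 1, q 2], ⟨contDiff_neg.isSmoothGerm 0, neg_zero,
    fun p ↦ -p, contDiff_neg.isSmoothGerm 0, neg_zero, Eventually.of_forall fun p ↦ neg_neg p,
    Eventually.of_forall fun p ↦ neg_neg p⟩, ⟨hs.isSmoothGerm 0, h0, fun q ↦ ![-q 0, q 1, q 2],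
    hs.isSmoothGerm 0, h0, Eventually.of_forall fun q ↦ by simpa using inv q,
    Eventually.of_forall fun q ↦ by simpa using inv q⟩, Eventually.of_forall fun p ↦ ?_⟩
  ext i; fin_cases i
  · simp [cuspForm]
  · simp [cuspForm]
  · simp [cuspForm, hk.neg_pow, Odd.neg_pow (by decide : Odd 3)]
    ring

/-! ### Jets of curves -/

section Jets

variable {E F : Type*} [NormedAddCommGroup E] [NormedSpace ℝ E]
  [NormedAddCommGroup F] [NormedSpace ℝ F]

theorem ContDiff.hasDerivAt_iteratedDeriv {s : ℝ → E} (hs : ContDiff ℝ ∞ s) (n : ℕ) (t : ℝ) :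
    HasDerivAt (iteratedDeriv n s) (iteratedDeriv (n + 1) s t) t := by
  rw [iteratedDeriv_succ]
  exact ((hs.differentiable_iteratedDeriv n (by exact_mod_cast WithTop.coe_lt_top _)) t).hasDerivAt

theorem iteratedDeriv_apply_coord {n : ℕ} {s : ℝ → Fin n → ℝ} (hs : ContDiff ℝ ∞ s) (m : ℕ)
    (i : Fin n) (t : ℝ) : iteratedDeriv m s t i = iteratedDeriv m (fun t ↦ s t i) t := by
  induction m generalizing t with
  | zero => simp
  | succ m ih =>
    have h1 := hasDerivAt_pi.1 (hs.hasDerivAt_iteratedDeriv m t) i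
    have h2 : (fun t ↦ iteratedDeriv m s t i) = iteratedDeriv m fun t ↦ s t i := funext ih
    rw [h2] at h1
    rw [iteratedDeriv_succ (f := fun t ↦ s t i), h1.deriv]

/-- Leibniz' rule for a bilinear pairing of two curves, in orders one to four. -/
theorem iteratedDeriv_clm_apply {A : ℝ → E →L[ℝ] F} {s : ℝ → E} (hA : ContDiff ℝ ∞ A)
    (hs : ContDiff ℝ ∞ s) (t : ℝ) :
    iteratedDeriv 1 (fun t ↦ A t (s t)) t = iteratedDeriv 1 A t (s t) + A t (iteratedDeriv 1 s t) ∧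
    iteratedDeriv 2 (fun t ↦ A t (s t)) t = iteratedDeriv 2 A t (s t) +
      (2 : ℝ) • iteratedDeriv 1 A t (iteratedDeriv 1 s t) + A t (iteratedDeriv 2 s t) ∧
    iteratedDeriv 3 (fun t ↦ A t (s t)) t = iteratedDeriv 3 A t (s t) +
      (3 : ℝ) • iteratedDeriv 2 A t (iteratedDeriv 1 s t) +
      (3 : ℝ) • iteratedDeriv 1 A t (iteratedDeriv 2 s t) + A t (iteratedDeriv 3 s t) ∧
    iteratedDeriv 4 (fun t ↦ A t (s t)) t = iteratedDeriv 4 A t (s t) +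
      (4 : ℝ) • iteratedDeriv 3 A t (iteratedDeriv 1 s t) +
      (6 : ℝ) • iteratedDeriv 2 A t (iteratedDeriv 2 s t) +
      (4 : ℝ) • iteratedDeriv 1 A t (iteratedDeriv 3 s t) + A t (iteratedDeriv 4 s t) := by
  have hd : ∀ i j t, HasDerivAt (fun t ↦ iteratedDeriv i A t (iteratedDeriv j s t))
      (iteratedDeriv (i + 1) A t (iteratedDeriv j s t) +
        iteratedDeriv i A t (iteratedDeriv (j + 1) s t)) t := fun i j t ↦
    (hA.hasDerivAt_iteratedDeriv i t).clm_apply (hs.hasDerivAt_iteratedDeriv j t)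
  have e1 : iteratedDeriv 1 (fun t ↦ A t (s t)) = fun t ↦
      iteratedDeriv 1 A t (iteratedDeriv 0 s t) + iteratedDeriv 0 A t (iteratedDeriv 1 s t) := by
    funext t
    rw [iteratedDeriv_one]
    simpa using (hd 0 0 t).deriv
  have e2 : iteratedDeriv 2 (fun t ↦ A t (s t)) = fun t ↦
      iteratedDeriv 2 A t (iteratedDeriv 0 s t) +
        (2 : ℝ) • iteratedDeriv 1 A t (iteratedDeriv 1 s t) +
        iteratedDeriv 0 A t (iteratedDeriv 2 s t) := by
    funext t
    rw [iteratedDeriv_succ, e1]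
    refine ((hd 1 0 t).add (hd 0 1 t)).deriv.trans ?_
    module
  have e3 : iteratedDeriv 3 (fun t ↦ A t (s t)) = fun t ↦
      iteratedDeriv 3 A t (iteratedDeriv 0 s t) +
        (3 : ℝ) • iteratedDeriv 2 A t (iteratedDeriv 1 s t) +
        (3 : ℝ) • iteratedDeriv 1 A t (iteratedDeriv 2 s t) +
        iteratedDeriv 0 A t (iteratedDeriv 3 s t) := by
    funext t
    rw [iteratedDeriv_succ, e2]
    refine (((hd 2 0 t).add ((hd 1 1 t).const_smul (2 : ℝ))).add (hd 0 2 t)).deriv.trans ?_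
    module
  refine ⟨by simpa using congrFun e1 t, by simpa using congrFun e2 t, by simpa using congrFun e3 t,
    ?_⟩
  rw [iteratedDeriv_succ, e3]
  refine ((((hd 3 0 t).add ((hd 2 1 t).const_smul (3 : ℝ))).add
    ((hd 1 2 t).const_smul (3 : ℝ))).add (hd 0 3 t)).deriv.trans ?_
  simp only [iteratedDeriv_zero]
  module

theorem deriv_comp_eq_zero {Φ : E → F} {σ : ℝ → E} (hΦ : ContDiff ℝ ∞ Φ) (hσ : ContDiff ℝ ∞ σ)
    {t : ℝ} (h : deriv σ t = 0) : deriv (fun t ↦ Φ (σ t)) t = 0 := by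
  have := ((hΦ.differentiable (by simp)) (σ t)).hasFDerivAt.comp_hasDerivAt t
    ((hσ.differentiable (by simp)) t).hasDerivAt
  rw [h, map_zero] at this
  exact this.deriv

theorem deriv_comp_eq {Φ : E → F} {σ : ℝ → E} (hΦ : ContDiff ℝ ∞ Φ) (hσ : ContDiff ℝ ∞ σ) :
    deriv (fun t ↦ Φ (σ t)) = fun t ↦ fderiv ℝ Φ (σ t) (deriv σ t) :=
  funext fun t ↦ (((hΦ.differentiable (by simp)) (σ t)).hasFDerivAt.comp_hasDerivAt t
    ((hσ.differentiable (by simp)) t).hasDerivAt).deriv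

/-- The second and third derivative of a curve at a singular point transform linearly under maps of
the target, and so does the combination `3 σ⁽⁵⁾ - 10 ℓ σ⁽⁴⁾` if `σ''' = ℓ σ''`. -/
theorem iteratedDeriv_comp_of_deriv_eq_zero {Φ : E → F} {σ : ℝ → E} (hΦ : ContDiff ℝ ∞ Φ)
    (hσ : ContDiff ℝ ∞ σ) (h : deriv σ 0 = 0) :
    iteratedDeriv 2 (fun t ↦ Φ (σ t)) 0 = fderiv ℝ Φ (σ 0) (iteratedDeriv 2 σ 0) ∧
    iteratedDeriv 3 (fun t ↦ Φ (σ t)) 0 = fderiv ℝ Φ (σ 0) (iteratedDeriv 3 σ 0) ∧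
    ∀ l : ℝ, iteratedDeriv 3 σ 0 = l • iteratedDeriv 2 σ 0 →
      (3 : ℝ) • iteratedDeriv 5 (fun t ↦ Φ (σ t)) 0 -
          (10 * l) • iteratedDeriv 4 (fun t ↦ Φ (σ t)) 0 =
        fderiv ℝ Φ (σ 0) ((3 : ℝ) • iteratedDeriv 5 σ 0 - (10 * l) • iteratedDeriv 4 σ 0) := by
  have hΦ' : ContDiff ℝ ∞ (fderiv ℝ Φ) := hΦ.fderiv_right le_rfl
  have hΦ'' : ContDiff ℝ ∞ (fderiv ℝ (fderiv ℝ Φ)) := hΦ'.fderiv_right le_rfl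
  have hN : ContDiff ℝ ∞ fun t ↦ fderiv ℝ Φ (σ t) := hΦ'.comp hσ
  have hQ : ContDiff ℝ ∞ fun t ↦ fderiv ℝ (fderiv ℝ Φ) (σ t) := hΦ''.comp hσ
  have hs : ContDiff ℝ ∞ (deriv σ) := (contDiff_infty_iff_deriv.1 hσ).2
  have hshift : ∀ n, iteratedDeriv n (deriv σ) = iteratedDeriv (n + 1) σ := fun n ↦
    iteratedDeriv_succ'.symm
  -- the derivatives of `dΦ` along the curve at the singular point
  have n1 : iteratedDeriv 1 (fun t ↦ fderiv ℝ Φ (σ t)) 0 = 0 := by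
    rw [iteratedDeriv_one]; exact deriv_comp_eq_zero hΦ' hσ h
  have q1 : iteratedDeriv 1 (fun t ↦ fderiv ℝ (fderiv ℝ Φ) (σ t)) 0 = 0 := by
    rw [iteratedDeriv_one]; exact deriv_comp_eq_zero hΦ'' hσ h
  have hN' : deriv (fun t ↦ fderiv ℝ Φ (σ t)) =
      fun t ↦ fderiv ℝ (fderiv ℝ Φ) (σ t) (deriv σ t) := deriv_comp_eq hΦ' hσ
  obtain ⟨a1, a2, -, -⟩ := iteratedDeriv_clm_apply hQ hs 0
  have n2 : iteratedDeriv 2 (fun t ↦ fderiv ℝ Φ (σ t)) 0 =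
      fderiv ℝ (fderiv ℝ Φ) (σ 0) (iteratedDeriv 2 σ 0) := by
    rw [iteratedDeriv_succ', hN', a1, h, hshift]; simp
  have n3 : iteratedDeriv 3 (fun t ↦ fderiv ℝ Φ (σ t)) 0 =
      fderiv ℝ (fderiv ℝ Φ) (σ 0) (iteratedDeriv 3 σ 0) := by
    rw [iteratedDeriv_succ', hN', a2, h, hshift, hshift, q1]; simp
  obtain ⟨b1, b2, b3, b4⟩ := iteratedDeriv_clm_apply hN hs 0
  rw [n1, h, hshift] at b1
  rw [n1, h, hshift, hshift] at b2
  rw [n1, n2, h, hshift, hshift, hshift] at b3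
  rw [n1, n2, n3, h, hshift, hshift, hshift, hshift] at b4
  have hy : ∀ n, iteratedDeriv (n + 1) (fun t ↦ Φ (σ t)) 0 =
      iteratedDeriv n (fun t ↦ fderiv ℝ Φ (σ t) (deriv σ t)) 0 := fun n ↦ by
    rw [iteratedDeriv_succ', deriv_comp_eq hΦ hσ]
  refine ⟨by rw [hy, b1]; simp, by rw [hy, b2]; simp, fun l hl ↦ ?_⟩
  rw [hy, hy, b3, b4, hl]
  simp only [map_zero, map_smul, map_sub, zero_apply, smul_zero,
    smul_apply]
  module

/-- Taylor coefficients of `tⁿ ζ(t)`. -/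
theorem iteratedDeriv_pow_mul {ζ : ℝ → ℝ} (hζ : ContDiff ℝ ∞ ζ) (n : ℕ) :
    (∀ i < n, iteratedDeriv i (fun t ↦ t ^ n * ζ t) 0 = 0) ∧
      iteratedDeriv n (fun t ↦ t ^ n * ζ t) 0 = n.factorial * ζ 0 := by
  induction n generalizing ζ with
  | zero => simp
  | succ n ih =>
    have hζ' : ContDiff ℝ ∞ (deriv ζ) := (contDiff_infty_iff_deriv.1 hζ).2
    have hd : deriv (fun t ↦ t ^ (n + 1) * ζ t) =
        fun t ↦ t ^ n * ((n + 1 : ℝ) * ζ t + t * deriv ζ t) := by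
      funext t
      refine ((hasDerivAt_pow (n + 1) t).mul
        ((hζ.differentiable (by simp)) t).hasDerivAt).deriv.trans ?_
      simp; ring
    obtain ⟨h1, h2⟩ := ih (ζ := fun t ↦ (n + 1 : ℝ) * ζ t + t * deriv ζ t) (by fun_prop)
    refine ⟨fun i hi ↦ ?_, ?_⟩
    · cases i with
      | zero => simp
      | succ i => rw [iteratedDeriv_succ', hd]; exact h1 i (by omega)
    · rw [iteratedDeriv_succ', hd, h2, Nat.factorial_succ]
      push_cast; ring

/-- A function of one variable that vanishes to order `n` at `0` is divisible by `tⁿ`. -/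
theorem exists_eq_pow_mul {z : ℝ → ℝ} (hz : ContDiff ℝ ∞ z) (n : ℕ)
    (h : ∀ i < n, iteratedDeriv i z 0 = 0) :
    ∃ ζ : ℝ → ℝ, ContDiff ℝ ∞ ζ ∧ (∀ t, z t = t ^ n * ζ t) ∧
      iteratedDeriv n z 0 = n.factorial * ζ 0 := by
  induction n with
  | zero => exact ⟨z, hz, by simp, by simp⟩
  | succ n ih =>
    obtain ⟨ζ, hζ, h1, h2⟩ := ih fun i hi ↦ h i (by omega)
    have h0 : ζ 0 = 0 := by
      rw [h n (by omega)] at h2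
      have : (n.factorial : ℝ) ≠ 0 := by positivity
      simpa [this] using h2.symm
    obtain ⟨S, hS, hSe⟩ := exists_hadamard (fun x : ℝ × ℝ ↦ ζ x.2) (hζ.comp contDiff_snd)
    have hξ : ContDiff ℝ ∞ fun t ↦ S (0, t) := hS.comp (contDiff_const.prodMk contDiff_id)
    have he : ∀ t, z t = t ^ (n + 1) * S (0, t) := fun t ↦ by
      have := hSe 0 t
      simp only [h0, zero_add, smul_eq_mul] at this
      rw [h1, this]; ring
    refine ⟨_, hξ, he, ?_⟩
    rw [funext he]
    exact (iteratedDeriv_pow_mul hξ (n + 1)).2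

/-- Multiplication by a continuous function does not change the order of vanishing. -/
theorem iteratedDeriv_of_eq_mul {ψ χ m : ℝ → ℝ} (hψ : ContDiff ℝ ∞ ψ) (hχ : ContDiff ℝ ∞ χ)
    (hm : ContinuousAt m 0) (h : ∀ᶠ t in 𝓝 0, ψ t = m t * χ t) (k : ℕ)
    (hk : ∀ i < k, iteratedDeriv i χ 0 = 0) :
    (∀ i < k, iteratedDeriv i ψ 0 = 0) ∧ iteratedDeriv k ψ 0 = m 0 * iteratedDeriv k χ 0 := by
  have step : ∀ j ≤ k, (∀ i < j, iteratedDeriv i ψ 0 = 0) →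
      iteratedDeriv j ψ 0 = m 0 * iteratedDeriv j χ 0 := by
    intro j hj hψj
    obtain ⟨a, ha, hae, ha0⟩ := exists_eq_pow_mul hψ j hψj
    obtain ⟨b, hb, hbe, hb0⟩ := exists_eq_pow_mul hχ j fun i hi ↦ hk i (by omega)
    have hev : ∀ᶠ t in 𝓝[≠] (0 : ℝ), a t = m t * b t := by
      filter_upwards [nhdsWithin_le_nhds h, self_mem_nhdsWithin] with t ht ht'
      rw [hae, hbe] at ht
      have : t ^ j ≠ 0 := pow_ne_zero _ ht'
      apply mul_left_cancel₀ this
      linarith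
    have l1 : Tendsto a (𝓝[≠] 0) (𝓝 (a 0)) := ha.continuous.continuousAt.mono_left nhdsWithin_le_nhds
    have l2 : Tendsto (fun t ↦ m t * b t) (𝓝[≠] 0) (𝓝 (m 0 * b 0)) :=
      (hm.mul hb.continuous.continuousAt).mono_left nhdsWithin_le_nhds
    have := tendsto_nhds_unique (l1.congr' hev) l2
    rw [ha0, hb0, this]; ring
  have main : ∀ j ≤ k, ∀ i < j, iteratedDeriv i ψ 0 = 0 := by
    intro j
    induction j with
    | zero => intro _ i hi; omega
    | succ j ih =>
      intro hj i hi
      rcases Nat.lt_succ_iff_lt_or_eq.1 hi with h' | rfl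
      · exact ih (by omega) i h'
      · rw [step i (by omega) (ih (by omega)), hk i (by omega), mul_zero]
  exact ⟨main k le_rfl, step k le_rfl (main k le_rfl)⟩

theorem iteratedDeriv_comp_of_pow_mul {α θ : ℝ → ℝ} (hα : ContDiff ℝ ∞ α) (hα0 : α 0 = 0)
    (hθ : ContDiff ℝ ∞ θ) (k : ℕ) :
    (∀ i < k, iteratedDeriv i (fun t ↦ α t ^ k * θ (α t)) 0 = 0) ∧
      iteratedDeriv k (fun t ↦ α t ^ k * θ (α t)) 0 = k.factorial * (deriv α 0 ^ k * θ 0) := by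
  obtain ⟨β, hβ, h1, h2⟩ := exists_eq_pow_mul hα 1 (by simpa using hα0)
  have h2' : deriv α 0 = β 0 := by simpa [iteratedDeriv_one] using h2
  have he : (fun t ↦ α t ^ k * θ (α t)) = fun t ↦ t ^ k * (β t ^ k * θ (α t)) := by
    funext t; rw [h1 t]; ring
  have := iteratedDeriv_pow_mul (ζ := fun t ↦ β t ^ k * θ (α t)) (by fun_prop) k
  rw [he, h2']
  simpa [hα0] using this

/-- The order of vanishing is invariant under a change of the variable. -/
theorem exists_eq_pow_mul_of_comp {α χ : ℝ → ℝ} (hα : ContDiff ℝ ∞ α) (hα0 : α 0 = 0)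
    (hα' : deriv α 0 ≠ 0) (hχ : ContDiff ℝ ∞ χ) (k : ℕ)
    (hk : ∀ i < k, iteratedDeriv i (fun t ↦ χ (α t)) 0 = 0) :
    ∃ θ : ℝ → ℝ, ContDiff ℝ ∞ θ ∧ (∀ u, χ u = u ^ k * θ u) ∧
      iteratedDeriv k (fun t ↦ χ (α t)) 0 = k.factorial * (deriv α 0 ^ k * θ 0) := by
  have main : ∀ j ≤ k, ∀ i < j, iteratedDeriv i χ 0 = 0 := by
    intro j
    induction j with
    | zero => intro _ i hi; omega
    | succ j ih =>
      intro hj i hi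
      rcases Nat.lt_succ_iff_lt_or_eq.1 hi with h' | rfl
      · exact ih (by omega) i h'
      · obtain ⟨θ, hθ, h1, h2⟩ := exists_eq_pow_mul hχ i (ih (by omega))
        have h3 := (iteratedDeriv_comp_of_pow_mul hα hα0 hθ i).2
        have h4 : (fun t ↦ α t ^ i * θ (α t)) = fun t ↦ χ (α t) := funext fun t ↦ (h1 _).symm
        rw [h4, hk i (by omega)] at h3
        have : θ 0 = 0 := by
          have : (i.factorial : ℝ) ≠ 0 := by positivity
          simpa [this, hα'] using h3.symm
        rw [h2, this, mul_zero]
  obtain ⟨θ, hθ, h1, -⟩ := exists_eq_pow_mul hχ k (main k le_rfl)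
  refine ⟨θ, hθ, h1, ?_⟩
  have h3 := (iteratedDeriv_comp_of_pow_mul hα hα0 hθ k).2
  rwa [show (fun t ↦ α t ^ k * θ (α t)) = fun t ↦ χ (α t) from funext fun t ↦ (h1 _).symm] at h3

end Jets

/-! ### Determinants and dot products -/

theorem dotProduct_fin_three (a b : Fin 3 → ℝ) : a ⬝ᵥ b = a 0 * b 0 + a 1 * b 1 + a 2 * b 2 := by
  simp [dotProduct, Fin.sum_univ_three]

theorem det₂_eq (x y : Fin 2 → ℝ) : det₂ x y = x 0 * y 1 - x 1 * y 0 := by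
  simp [det₂, Matrix.det_fin_two]

theorem det₃_eq (x y z : Fin 3 → ℝ) : det₃ x y z =
    x 0 * y 1 * z 2 - x 0 * y 2 * z 1 - x 1 * y 0 * z 2 + x 1 * y 2 * z 0 + x 2 * y 0 * z 1 -
      x 2 * y 1 * z 0 := by
  simp [det₃, Matrix.det_fin_three]

/-- The product of two determinants is the determinant of the matrix of dot products. -/
theorem det₃_mul_det₃ (a b c x y z : Fin 3 → ℝ) : det₃ a b c * det₃ x y z =
    (a ⬝ᵥ x) * (b ⬝ᵥ y) * (c ⬝ᵥ z) - (a ⬝ᵥ x) * (b ⬝ᵥ z) * (c ⬝ᵥ y) -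
      (a ⬝ᵥ y) * (b ⬝ᵥ x) * (c ⬝ᵥ z) + (a ⬝ᵥ y) * (b ⬝ᵥ z) * (c ⬝ᵥ x) +
      (a ⬝ᵥ z) * (b ⬝ᵥ x) * (c ⬝ᵥ y) - (a ⬝ᵥ z) * (b ⬝ᵥ y) * (c ⬝ᵥ x) := by
  simp only [det₃_eq, dotProduct_fin_three]
  ring

theorem HasDerivAt.dotProduct_fin_three {a b : ℝ → Fin 3 → ℝ} {a' b' : Fin 3 → ℝ} {t : ℝ}
    (ha : HasDerivAt a a' t) (hb : HasDerivAt b b' t) :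
    HasDerivAt (fun t ↦ a t ⬝ᵥ b t) (a' ⬝ᵥ b t + a t ⬝ᵥ b') t := by
  simp only [_root_.dotProduct_fin_three]
  have ha := hasDerivAt_pi.1 ha
  have hb := hasDerivAt_pi.1 hb
  refine ((((ha 0).mul (hb 0)).add ((ha 1).mul (hb 1))).add ((ha 2).mul (hb 2))).congr_deriv ?_
  ring

theorem HasDerivAt.det₃ {a b c : ℝ → Fin 3 → ℝ} {a' b' c' : Fin 3 → ℝ} {t : ℝ}
    (ha : HasDerivAt a a' t) (hb : HasDerivAt b b' t) (hc : HasDerivAt c c' t) :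
    HasDerivAt (fun t ↦ det₃ (a t) (b t) (c t))
      (det₃ a' (b t) (c t) + det₃ (a t) b' (c t) + det₃ (a t) (b t) c') t := by
  simp only [det₃_eq]
  have ha := hasDerivAt_pi.1 ha
  have hb := hasDerivAt_pi.1 hb
  have hc := hasDerivAt_pi.1 hc
  have h : ∀ i j k, HasDerivAt (fun t ↦ a t i * b t j * c t k)
      (a' i * b t j * c t k + a t i * b' j * c t k + a t i * b t j * c' k) t := fun i j k ↦
    (((ha i).mul (hb j)).mul (hc k)).congr_deriv (by simp only [Pi.mul_apply]; ring)
  refine ((((((h 0 1 2).sub (h 0 2 1)).sub (h 1 0 2)).add (h 1 2 0)).add (h 2 0 1)).sub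
    (h 2 1 0)).congr_deriv ?_
  ring

theorem ContDiff.det₃ {E : Type*} [NormedAddCommGroup E] [NormedSpace ℝ E] {a b c : E → Fin 3 → ℝ}
    {n : WithTop ℕ∞} (ha : ContDiff ℝ n a) (hb : ContDiff ℝ n b) (hc : ContDiff ℝ n c) :
    ContDiff ℝ n fun x ↦ det₃ (a x) (b x) (c x) := by
  simp only [det₃_eq]
  rw [contDiff_pi] at ha hb hc
  have a0 := ha 0; have a1 := ha 1; have a2 := ha 2
  have b0 := hb 0; have b1 := hb 1; have b2 := hb 2
  have c0 := hc 0; have c1 := hc 1; have c2 := hc 2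
  fun_prop

theorem dotProduct_self_pos_fin_three {a : Fin 3 → ℝ} (ha : a ≠ 0) : 0 < a ⬝ᵥ a :=
  lt_of_le_of_ne (by
    rw [dotProduct_fin_three]; nlinarith [sq_nonneg (a 0), sq_nonneg (a 1), sq_nonneg (a 2)]) fun h ↦ ha (dotProduct_self_eq_zero.1 h.symm)

theorem exists_combination_of_det₃_eq_zero {a b c : Fin 3 → ℝ} (h : det₃ a b c = 0) :
    ∃ v : Fin 3 → ℝ, v ≠ 0 ∧ v 0 • a + v 1 • b + v 2 • c = 0 := by
  obtain ⟨v, hv, hv'⟩ := Matrix.exists_vecMul_eq_zero_iff.2 h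
  refine ⟨v, hv, ?_⟩
  rw [← hv']
  ext i
  simp [Matrix.vecMul, dotProduct, Fin.sum_univ_three]

/-- Two independent vectors and a non-zero vector orthogonal to them form a basis. -/
theorem det₃_ne_zero_of_orthogonal {a b n : Fin 3 → ℝ} (h : LinearIndependent ℝ ![a, b])
    (hn : n ≠ 0) (ha : a ⬝ᵥ n = 0) (hb : b ⬝ᵥ n = 0) : det₃ a b n ≠ 0 := by
  intro h0
  obtain ⟨v, hv, hv'⟩ := exists_combination_of_det₃_eq_zero h0
  have h2 : v 2 = 0 := by
    have := congrArg (· ⬝ᵥ n) hv'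
    simpa [add_dotProduct, smul_dotProduct, ha, hb, (dotProduct_self_pos_fin_three hn).ne'] using this
  rw [h2, zero_smul, add_zero] at hv'
  obtain ⟨h0, h1⟩ := LinearIndependent.pair_iff.1 h _ _ hv'
  apply hv
  ext i; fin_cases i <;> simp [h0, h1, h2]

theorem linearIndependent_of_det₃_ne_zero {a b n : Fin 3 → ℝ} (h : det₃ a b n ≠ 0) :
    LinearIndependent ℝ ![a, b] := by
  refine LinearIndependent.pair_iff.2 fun s t hst ↦ ?_
  have e : ∀ i, s * a i + t * b i = 0 := fun i ↦ by simpa using congrFun hst i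
  have e0 := e 0; have e1 := e 1; have e2 := e 2
  have hs : s * det₃ a b n = 0 := by
    rw [det₃_eq]
    linear_combination (b 1 * n 2 - b 2 * n 1) * e0 + (b 2 * n 0 - b 0 * n 2) * e1 +
      (b 0 * n 1 - b 1 * n 0) * e2
  have ht : t * det₃ a b n = 0 := by
    rw [det₃_eq]
    linear_combination (a 2 * n 1 - a 1 * n 2) * e0 + (a 0 * n 2 - a 2 * n 0) * e1 +
      (a 1 * n 0 - a 0 * n 1) * e2
  exact ⟨(mul_eq_zero.1 hs).resolve_right h, (mul_eq_zero.1 ht).resolve_right h⟩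

/-- The Gram determinant of two independent vectors is positive. -/
theorem gram_pos {a b : Fin 3 → ℝ} (h : LinearIndependent ℝ ![a, b]) :
    0 < (a ⬝ᵥ a) * (b ⬝ᵥ b) - (a ⬝ᵥ b) ^ 2 := by
  by_contra! hle
  have key : (a 1 * b 2 - a 2 * b 1) ^ 2 + (a 2 * b 0 - a 0 * b 2) ^ 2 +
      (a 0 * b 1 - a 1 * b 0) ^ 2 ≤ 0 := by
    refine le_trans (le_of_eq ?_) hle
    simp only [dotProduct_fin_three]; ring
  have h0 : a 1 * b 2 - a 2 * b 1 = 0 := by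
    nlinarith [sq_nonneg (a 1 * b 2 - a 2 * b 1), sq_nonneg (a 2 * b 0 - a 0 * b 2),
      sq_nonneg (a 0 * b 1 - a 1 * b 0)]
  have h1 : a 2 * b 0 - a 0 * b 2 = 0 := by
    nlinarith [sq_nonneg (a 1 * b 2 - a 2 * b 1), sq_nonneg (a 2 * b 0 - a 0 * b 2),
      sq_nonneg (a 0 * b 1 - a 1 * b 0)]
  have h2 : a 0 * b 1 - a 1 * b 0 = 0 := by
    nlinarith [sq_nonneg (a 1 * b 2 - a 2 * b 1), sq_nonneg (a 2 * b 0 - a 0 * b 2),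
      sq_nonneg (a 0 * b 1 - a 1 * b 0)]
  have hb : ∀ i, b i = 0 := by
    intro i
    have hi : b i • a + (-a i) • b = 0 := by
      ext j; fin_cases i <;> fin_cases j <;> simp <;> linarith
    exact (LinearIndependent.pair_iff.1 h _ _ hi).1
  have := (LinearIndependent.pair_iff.1 h 0 1 (by ext i; simp [hb])).2
  exact one_ne_zero this

/-- The determinant of a linear map of space. -/
noncomputable def jac (M : (Fin 3 → ℝ) →L[ℝ] (Fin 3 → ℝ)) : ℝ :=
  det₃ (M ![1, 0, 0]) (M ![0, 1, 0]) (M ![0, 0, 1])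

theorem clm_apply_eq (M : (Fin 3 → ℝ) →L[ℝ] (Fin 3 → ℝ)) (a : Fin 3 → ℝ) :
    M a = a 0 • M ![1, 0, 0] + a 1 • M ![0, 1, 0] + a 2 • M ![0, 0, 1] := by
  rw [← map_smul, ← map_smul, ← map_smul, ← map_add, ← map_add]
  congr 1
  ext i; fin_cases i <;> simp

theorem det₃_map (M : (Fin 3 → ℝ) →L[ℝ] (Fin 3 → ℝ)) (a b c : Fin 3 → ℝ) :
    det₃ (M a) (M b) (M c) = jac M * det₃ a b c := by
  rw [clm_apply_eq M a, clm_apply_eq M b, clm_apply_eq M c, jac]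
  simp only [det₃_eq, Pi.add_apply, Pi.smul_apply, smul_eq_mul]
  ring

theorem jac_ne_zero {M : (Fin 3 → ℝ) →L[ℝ] (Fin 3 → ℝ)} (hM : ∀ X, M X = 0 → X = 0) :
    jac M ≠ 0 := by
  intro h
  obtain ⟨v, hv, hv'⟩ := exists_combination_of_det₃_eq_zero h
  rw [← clm_apply_eq] at hv'
  exact hv (hM v hv')

/-! ### Frontals along the singular curve -/

section Frontal

variable {f ν : (Fin 2 → ℝ) → (Fin 3 → ℝ)}

theorem hasDerivAt_line (p Y : Fin 2 → ℝ) (v : ℝ) : HasDerivAt (fun v : ℝ ↦ p + v • Y) Y v := by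
  simpa using ((hasDerivAt_id v).smul_const Y).const_add p

theorem contDiff_line (p Y : Fin 2 → ℝ) : ContDiff ℝ ∞ fun v : ℝ ↦ p + v • Y := by fun_prop

theorem deriv_comp_line (hf : ContDiff ℝ ∞ f) (p Y : Fin 2 → ℝ) :
    deriv (fun v : ℝ ↦ f (p + v • Y)) = fun v ↦ fderiv ℝ f (p + v • Y) Y := by
  rw [deriv_comp_eq hf (contDiff_line p Y)]
  funext v
  rw [(hasDerivAt_line p Y v).deriv]

theorem hasDerivAt_fderiv_line (hf : ContDiff ℝ ∞ f) (p X Y : Fin 2 → ℝ) (v : ℝ) :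
    HasDerivAt (fun v : ℝ ↦ fderiv ℝ f (p + v • Y) X)
      (fderiv ℝ (fderiv ℝ f) (p + v • Y) Y X) v := by
  have hf' : ContDiff ℝ ∞ (fderiv ℝ f) := hf.fderiv_right le_rfl
  have h1 := ((hf'.differentiable (by simp)) (p + v • Y)).hasFDerivAt.comp_hasDerivAt v
    (hasDerivAt_line p Y v)
  simpa using h1.clm_apply (hasDerivAt_const v X)

theorem iteratedDeriv_two_line (hf : ContDiff ℝ ∞ f) (p Y : Fin 2 → ℝ) :
    iteratedDeriv 2 (fun v : ℝ ↦ f (p + v • Y)) 0 = fderiv ℝ (fderiv ℝ f) p Y Y := by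
  rw [iteratedDeriv_succ, iteratedDeriv_one, deriv_comp_line hf]
  simpa using (hasDerivAt_fderiv_line hf p Y Y 0).deriv

/-- The relations between the normal vector and the derivatives of `f` in a null direction `Y`, from
differentiating `⟨df(Y), ν⟩ = 0` once and twice along the line through `p` with direction `Y`. -/
theorem dotProduct_normal_null (hf : ContDiff ℝ ∞ f) (hν : ContDiff ℝ ∞ ν) {p Y : Fin 2 → ℝ}
    (hperp : ∀ᶠ x in 𝓝 p, ∀ X, fderiv ℝ f x X ⬝ᵥ ν x = 0) (hY : fderiv ℝ f p Y = 0) :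
    iteratedDeriv 2 (fun v : ℝ ↦ f (p + v • Y)) 0 ⬝ᵥ ν p = 0 ∧
      iteratedDeriv 3 (fun v : ℝ ↦ f (p + v • Y)) 0 ⬝ᵥ ν p +
        2 * (iteratedDeriv 2 (fun v : ℝ ↦ f (p + v • Y)) 0 ⬝ᵥ fderiv ℝ ν p Y) = 0 := by
  set q : ℝ → Fin 3 → ℝ := fun v ↦ f (p + v • Y) with hq
  have hqs : ContDiff ℝ ∞ q := hf.comp (contDiff_line p Y)
  have hns : ContDiff ℝ ∞ fun v : ℝ ↦ ν (p + v • Y) := hν.comp (contDiff_line p Y)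
  have hns' := (contDiff_infty_iff_deriv.1 hns).2
  have hq1 : iteratedDeriv 1 q 0 = 0 := by
    rw [iteratedDeriv_one, hq, deriv_comp_line hf]; simpa using hY
  have hn1 : deriv (fun v : ℝ ↦ ν (p + v • Y)) 0 = fderiv ℝ ν p Y := by
    rw [deriv_comp_line hν]; simp
  have hd : ∀ v, HasDerivAt (fun v : ℝ ↦ ν (p + v • Y)) (deriv (fun v : ℝ ↦ ν (p + v • Y)) v) v :=
    fun v ↦ ((hns.differentiable (by simp)) v).hasDerivAt
  have hd' : ∀ v, HasDerivAt (deriv fun v : ℝ ↦ ν (p + v • Y))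
      (deriv (deriv fun v : ℝ ↦ ν (p + v • Y)) v) v :=
    fun v ↦ ((hns'.differentiable (by simp)) v).hasDerivAt
  have hline : Tendsto (fun v : ℝ ↦ p + v • Y) (𝓝 0) (𝓝 p) :=
    (contDiff_line p Y).continuous.tendsto' _ _ (by simp)
  have h0 : (fun v ↦ iteratedDeriv 1 q v ⬝ᵥ ν (p + v • Y)) =ᶠ[𝓝 0] fun _ ↦ 0 := by
    filter_upwards [hline.eventually hperp] with v hv
    rw [iteratedDeriv_one, hq, deriv_comp_line hf]; exact hv Y
  have h1 : (fun v ↦ iteratedDeriv 2 q v ⬝ᵥ ν (p + v • Y) +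
      iteratedDeriv 1 q v ⬝ᵥ deriv (fun v : ℝ ↦ ν (p + v • Y)) v) =ᶠ[𝓝 0] fun _ ↦ 0 := by
    have e : deriv (fun v ↦ iteratedDeriv 1 q v ⬝ᵥ ν (p + v • Y)) =
        fun v ↦ iteratedDeriv 2 q v ⬝ᵥ ν (p + v • Y) +
          iteratedDeriv 1 q v ⬝ᵥ deriv (fun v : ℝ ↦ ν (p + v • Y)) v := funext fun v ↦
      ((hqs.hasDerivAt_iteratedDeriv 1 v).dotProduct_fin_three (hd v)).deriv
    rw [← e]
    filter_upwards [h0.deriv] with v hv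
    rw [hv, deriv_const]
  have h2 := ((((hqs.hasDerivAt_iteratedDeriv 2 0).dotProduct_fin_three (hd 0)).add
    ((hqs.hasDerivAt_iteratedDeriv 1 0).dotProduct_fin_three (hd' 0))).deriv).symm.trans
    (h1.deriv_eq.trans (deriv_const _ _))
  have h1' := h1.self_of_nhds
  simp only [hq1, hn1, zero_dotProduct, add_zero, zero_smul] at h1' h2
  exact ⟨h1', by linarith⟩

/-- Along a curve `γ` with null field `η`, the vector `dν(η)` is orthogonal to `df(γ')`. By symmetry of
the second derivative of `f`, `⟨df(γ'), dν(η)⟩ = -⟨d²f(γ', η), ν⟩`, and the derivative of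
`df(η) = 0` along `γ` gives `⟨d²f(γ', η), ν⟩ = 0`. -/
theorem dotProduct_normal_tangent (hf : ContDiff ℝ ∞ f) (hν : ContDiff ℝ ∞ ν)
    {γ η : ℝ → Fin 2 → ℝ} (hγ : ContDiff ℝ ∞ γ) (hη : ContDiff ℝ ∞ η) {t : ℝ}
    (hperp : ∀ᶠ x in 𝓝 (γ t), ∀ X, fderiv ℝ f x X ⬝ᵥ ν x = 0)
    (hnull : ∀ᶠ s in 𝓝 t, fderiv ℝ f (γ s) (η s) = 0) :
    fderiv ℝ f (γ t) (deriv γ t) ⬝ᵥ fderiv ℝ ν (γ t) (η t) = 0 := by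
  have hf' : ContDiff ℝ ∞ (fderiv ℝ f) := hf.fderiv_right le_rfl
  have hp := hperp.self_of_nhds
  have h1 : fderiv ℝ (fderiv ℝ f) (γ t) (deriv γ t) (η t) + fderiv ℝ f (γ t) (deriv η t) = 0 := by
    have hd := (((hf'.differentiable (by simp)) (γ t)).hasFDerivAt.comp_hasDerivAt t
      ((hγ.differentiable (by simp)) t).hasDerivAt).clm_apply
      ((hη.differentiable (by simp)) t).hasDerivAt
    have hz : (fun s ↦ fderiv ℝ f (γ s) (η s)) =ᶠ[𝓝 t] fun _ ↦ 0 := hnull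
    have := hz.deriv_eq
    rw [deriv_const] at this
    rw [← this]; exact hd.deriv.symm
  have h2 : fderiv ℝ (fderiv ℝ f) (γ t) (deriv γ t) (η t) ⬝ᵥ ν (γ t) = 0 := by
    have := congrArg (· ⬝ᵥ ν (γ t)) h1
    simpa [add_dotProduct, hp] using this
  have hsymm : IsSymmSndFDerivAt ℝ f (γ t) :=
    (hf.contDiffAt (x := γ t)).isSymmSndFDerivAt (by
      simpa using (mod_cast le_top : ((2 : ℕ∞) : WithTop ℕ∞) ≤ ∞))
  have hline : Tendsto (fun v : ℝ ↦ γ t + v • η t) (𝓝 0) (𝓝 (γ t)) :=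
    (contDiff_line (γ t) (η t)).continuous.tendsto' _ _ (by simp)
  have hz : (fun v : ℝ ↦ fderiv ℝ f (γ t + v • η t) (deriv γ t) ⬝ᵥ ν (γ t + v • η t))
      =ᶠ[𝓝 0] fun _ ↦ 0 := by
    filter_upwards [hline.eventually hperp] with v hv using hv _
  have hn := ((hν.differentiable (by simp)) (γ t + (0 : ℝ) • η t)).hasFDerivAt.comp_hasDerivAt
    (0 : ℝ) (hasDerivAt_line (γ t) (η t) 0)
  have h3 := ((hasDerivAt_fderiv_line hf (γ t) (deriv γ t) (η t) 0).dotProduct_fin_three hn).deriv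
  have h4 := hz.deriv_eq
  rw [deriv_const] at h4
  have h5 := h3.symm.trans h4
  simp only [zero_smul, add_zero, Function.comp_apply] at h5
  rw [hsymm.eq, h2, zero_add] at h5
  exact h5

/-- The invariant `ψ` in terms of the derivatives of `f`: up to the factor `|u|² |ν|² / 2` and a Gram
determinant it is `det(u, f_ηη, f_ηηη)`, where `u = df(γ')`. In particular only the factor `|ν|²`
depends on the normal vector, so that the sign of `ψ` does not. -/
theorem psi_mul_gram (hf : ContDiff ℝ ∞ f) (hν : ContDiff ℝ ∞ ν)
    {γ η : ℝ → Fin 2 → ℝ} (hγ : ContDiff ℝ ∞ γ) (hη : ContDiff ℝ ∞ η) {t : ℝ}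
    (hperp : ∀ᶠ x in 𝓝 (γ t), ∀ X, fderiv ℝ f x X ⬝ᵥ ν x = 0) (hνt : ν (γ t) ≠ 0)
    (hnull : ∀ᶠ s in 𝓝 t, fderiv ℝ f (γ s) (η s) = 0) (u a b : Fin 3 → ℝ)
    (hu : u = fderiv ℝ f (γ t) (deriv γ t))
    (ha : a = iteratedDeriv 2 (fun v : ℝ ↦ f (γ t + v • η t)) 0)
    (hb : b = iteratedDeriv 3 (fun v : ℝ ↦ f (γ t + v • η t)) 0)
    (hlin : LinearIndependent ℝ ![u, a]) :
    psi f ν γ η t * ((u ⬝ᵥ u) * (a ⬝ᵥ a) - (u ⬝ᵥ a) ^ 2) =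
      (u ⬝ᵥ u) * (ν (γ t) ⬝ᵥ ν (γ t)) / 2 * det₃ u a b := by
  obtain ⟨h1, h2⟩ := dotProduct_normal_null hf hν hperp hnull.self_of_nhds
  have h3 := dotProduct_normal_tangent hf hν hγ hη hperp hnull
  have h4 := hperp.self_of_nhds (deriv γ t)
  rw [← hu] at h3 h4
  rw [← ha] at h1 h2
  rw [← hb] at h2
  have hpsi : psi f ν γ η t = det₃ u (ν (γ t)) (fderiv ℝ ν (γ t) (η t)) := by
    rw [psi, hu]
    congr 1
    exact congrFun (deriv_comp_eq hf hγ) t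
  rw [hpsi]
  generalize ν (γ t) = n at *
  generalize fderiv ℝ ν (γ t) (η t) = w at *
  have hdet := det₃_ne_zero_of_orthogonal hlin hνt h4 h1
  apply mul_left_cancel₀ hdet
  have e1 := det₃_mul_det₃ u a n u n w
  have e2 := det₃_mul_det₃ u a n u a b
  have c1 : a ⬝ᵥ u = u ⬝ᵥ a := dotProduct_comm _ _
  have c2 : n ⬝ᵥ u = 0 := by rw [dotProduct_comm]; exact h4
  have c3 : n ⬝ᵥ a = 0 := by rw [dotProduct_comm]; exact h1
  have c4 : n ⬝ᵥ b = b ⬝ᵥ n := dotProduct_comm _ _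
  rw [h3, h4, h1, c1, c2] at e1
  rw [c1, c2, c3, c4] at e2
  linear_combination ((u ⬝ᵥ u) * (a ⬝ᵥ a) - (u ⬝ᵥ a) ^ 2) * e1 -
    (u ⬝ᵥ u) * (n ⬝ᵥ n) / 2 * e2 -
    (u ⬝ᵥ u) * (n ⬝ᵥ n) / 2 * ((u ⬝ᵥ u) * (a ⬝ᵥ a) - (u ⬝ᵥ a) ^ 2) * h2

/-- The derivative of the area density in a null direction. -/
theorem fderiv_areaDensity_null (hf : ContDiff ℝ ∞ f) (hν : ContDiff ℝ ∞ ν) (X Y : Fin 2 → ℝ)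
    (hY : fderiv ℝ f 0 Y = 0) :
    det₂ X Y * fderiv ℝ (areaDensity f ν) 0 Y =
      det₃ (fderiv ℝ f 0 X) (iteratedDeriv 2 (fun v : ℝ ↦ f (0 + v • Y)) 0) (ν 0) := by
  have hf' : ContDiff ℝ ∞ (fderiv ℝ f) := hf.fderiv_right le_rfl
  have hlam : ContDiff ℝ ∞ (areaDensity f ν) :=
    ContDiff.det₃ (hf'.clm_apply contDiff_const) (hf'.clm_apply contDiff_const) hν
  have hexp : ∀ x Z, fderiv ℝ f x Z =
      Z 0 • fderiv ℝ f x ![1, 0] + Z 1 • fderiv ℝ f x ![0, 1] := fun x Z ↦ by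
    rw [← map_smul, ← map_smul, ← map_add]
    congr 1
    ext i; fin_cases i <;> simp
  have hbasis : ∀ x, det₃ (fderiv ℝ f x X) (fderiv ℝ f x Y) (ν x) =
      det₂ X Y * areaDensity f ν x := fun x ↦ by
    rw [hexp x X, hexp x Y, areaDensity]
    simp only [det₃_eq, det₂_eq, Pi.add_apply, Pi.smul_apply, smul_eq_mul]
    ring
  have hn := ((hν.differentiable (by simp)) (0 + (0 : ℝ) • Y)).hasFDerivAt.comp_hasDerivAt
    (0 : ℝ) (hasDerivAt_line 0 Y 0)
  have h1 := (hasDerivAt_fderiv_line hf 0 X Y 0).det₃ (hasDerivAt_fderiv_line hf 0 Y Y 0) hn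
  have h2 := (((hlam.differentiable (by simp)) (0 + (0 : ℝ) • Y)).hasFDerivAt.comp_hasDerivAt
    (0 : ℝ) (hasDerivAt_line 0 Y 0)).const_mul (det₂ X Y)
  have h3 := h2.unique (h1.congr_of_eventuallyEq (Eventually.of_forall fun v ↦ (hbasis _).symm))
  rw [iteratedDeriv_two_line hf]
  simp only [zero_smul, add_zero, Function.comp_apply, hY] at h3
  rw [h3]
  have z1 : ∀ a b : Fin 3 → ℝ, det₃ a 0 b = 0 := fun a b ↦ by simp [det₃_eq]
  rw [z1, z1]; simp

end Frontal

/-! ### Invariants of the prepared form -/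

theorem contDiff_cuspForm {φ : ℝ × ℝ → ℝ} (hφ : ContDiff ℝ ∞ φ) : ContDiff ℝ ∞ (cuspForm φ) :=
  ContDiff.vec3 (by fun_prop) (by fun_prop) (by fun_prop)

theorem cuspForm_zero (φ : ℝ × ℝ → ℝ) : cuspForm φ 0 = 0 := by
  ext i; fin_cases i <;> simp [cuspForm]

/-- On the singular line the derivative of the prepared form has rank one. -/
theorem fderiv_cuspForm_of_eq_zero {φ : ℝ × ℝ → ℝ} (hφ : ContDiff ℝ ∞ φ) {p : Fin 2 → ℝ}
    (hp : p 1 = 0) (X : Fin 2 → ℝ) : fderiv ℝ (cuspForm φ) p X = X 0 • ![1, 0, 0] := by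
  have h1 : HasFDerivAt (fun p : Fin 2 → ℝ ↦ p 1 ^ 2) (0 : (Fin 2 → ℝ) →L[ℝ] ℝ) p := by
    refine ((hasFDerivAt_coord 1 p).pow 2).congr_fderiv ?_
    ext; simp [hp]
  have hd : DifferentiableAt ℝ (fun p : Fin 2 → ℝ ↦ φ (p 0, p 1 ^ 2)) p :=
    ContDiff.differentiable (n := ∞) (by fun_prop) (by simp) p
  have h2 : HasFDerivAt (fun p : Fin 2 → ℝ ↦ p 1 ^ 3 * φ (p 0, p 1 ^ 2))
      (0 : (Fin 2 → ℝ) →L[ℝ] ℝ) p := by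
    refine (((hasFDerivAt_coord 1 p).pow 3).mul hd.hasFDerivAt).congr_fderiv ?_
    ext; simp [hp]
  refine (fderiv_vec3_apply (hasFDerivAt_coord 0 p) h1 h2 X).trans ?_
  ext i; fin_cases i <;> simp

/-- Off the singular line the prepared form is an immersion. -/
theorem fderiv_cuspForm_injective {φ : ℝ × ℝ → ℝ} (hφ : ContDiff ℝ ∞ φ) {p : Fin 2 → ℝ}
    (hp : p 1 ≠ 0) {X : Fin 2 → ℝ} (hX : fderiv ℝ (cuspForm φ) p X = 0) : X = 0 := by
  have h1 := (hasFDerivAt_coord 1 p).pow 2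
  have hd : DifferentiableAt ℝ (fun p : Fin 2 → ℝ ↦ p 1 ^ 3 * φ (p 0, p 1 ^ 2)) p :=
    ContDiff.differentiable (n := ∞) (by fun_prop) (by simp) p
  have h := (fderiv_vec3_apply (hasFDerivAt_coord 0 p) h1 hd.hasFDerivAt X).symm.trans hX
  have x0 := congrFun h 0
  have x1 := congrFun h 1
  simp [hp] at x0 x1
  ext i; fin_cases i <;> simp [x0, x1]

/-- Taylor coefficients of the prepared form along a curve tangent to the null direction. -/
theorem jets_cuspForm_comp {φ : ℝ × ℝ → ℝ} (hφ : ContDiff ℝ ∞ φ) {K : ℝ → Fin 2 → ℝ}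
    (hK : ContDiff ℝ ∞ K) (hK1 : K 0 1 = 0) (hK0 : deriv K 0 0 = 0) :
    deriv (fun t ↦ cuspForm φ (K t)) 0 = 0 ∧
    iteratedDeriv 2 (fun t ↦ cuspForm φ (K t)) 0 1 = 2 * deriv K 0 1 ^ 2 ∧
    iteratedDeriv 2 (fun t ↦ cuspForm φ (K t)) 0 2 = 0 ∧
    iteratedDeriv 3 (fun t ↦ cuspForm φ (K t)) 0 2 = 6 * deriv K 0 1 ^ 3 * φ (K 0 0, 0) ∧
    (φ (K 0 0, 0) = 0 → fderiv ℝ φ (K 0 0, 0) (1, 0) = 0 →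
      iteratedDeriv 4 (fun t ↦ cuspForm φ (K t)) 0 2 = 0 ∧
      iteratedDeriv 5 (fun t ↦ cuspForm φ (K t)) 0 2 =
        120 * deriv K 0 1 ^ 5 * fderiv ℝ φ (K 0 0, 0) (0, 1)) := by
  have hF : ContDiff ℝ ∞ fun t ↦ cuspForm φ (K t) := (contDiff_cuspForm hφ).comp hK
  have hKd := hasDerivAt_pi.1 ((hK.differentiable (by simp)) 0).hasDerivAt
  have hx : ContDiff ℝ ∞ fun t ↦ K t 0 := contDiff_pi.1 hK 0
  have hy : ContDiff ℝ ∞ fun t ↦ K t 1 := contDiff_pi.1 hK 1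
  obtain ⟨η, hη, hye, hyd⟩ := exists_eq_pow_mul hy 1 (by simpa using hK1)
  have hη0 : deriv K 0 1 = η 0 := by
    rw [iteratedDeriv_one, (hKd 1).deriv] at hyd
    simpa using hyd
  have hχ : ContDiff ℝ ∞ fun t ↦ φ (K t 0, K t 1 ^ 2) := by fun_prop
  have c1 : (fun t ↦ cuspForm φ (K t) 1) = fun t ↦ t ^ 2 * η t ^ 2 := by
    funext t; simp [cuspForm, hye t]; ring
  have c2 : (fun t ↦ cuspForm φ (K t) 2) = fun t ↦ t ^ 3 * (η t ^ 3 * φ (K t 0, K t 1 ^ 2)) := by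
    funext t
    have : cuspForm φ (K t) 2 = K t 1 ^ 3 * φ (K t 0, K t 1 ^ 2) := rfl
    rw [this, show K t 1 ^ 3 = t ^ 3 * η t ^ 3 by rw [hye t]; ring]; ring
  have j1 := iteratedDeriv_pow_mul (ζ := fun t ↦ η t ^ 2) (by fun_prop) 2
  have j2 := iteratedDeriv_pow_mul (ζ := fun t ↦ η t ^ 3 * φ (K t 0, K t 1 ^ 2)) (by fun_prop) 3
  rw [← c1] at j1
  rw [← c2] at j2
  refine ⟨?_, ?_, ?_, ?_, fun h0 h0' ↦ ?_⟩
  · rw [deriv_comp_eq (contDiff_cuspForm hφ) hK]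
    simp only [fderiv_cuspForm_of_eq_zero hφ hK1, hK0, zero_smul]
  · rw [iteratedDeriv_apply_coord hF, j1.2, hη0]; simp
  · rw [iteratedDeriv_apply_coord hF, j2.1 2 (by norm_num)]
  · rw [iteratedDeriv_apply_coord hF, j2.2, hη0, hK1]; simp [Nat.factorial]; ring
  · -- `φ(x(t), y(t)²)` vanishes to second order
    let C : ℝ → ℝ × ℝ := fun t ↦ (K t 0, K t 1 ^ 2)
    have hC : ContDiff ℝ ∞ C := by fun_prop
    have hC0 : C 0 = (K 0 0, 0) := by simp [C, hK1]
    have hC1 : deriv C 0 = 0 := by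
      have := (hKd 0).prodMk ((hKd 1).pow 2)
      refine this.deriv.trans ?_
      simp [hK0, hK1]
    have hC2 : (iteratedDeriv 2 C 0).2 = 2 * η 0 ^ 2 := by
      have e1 := ((ContinuousLinearMap.snd ℝ ℝ ℝ).contDiff (n := ∞))
      have e2 := (iteratedDeriv_comp_of_deriv_eq_zero e1 hC hC1).1
      rw [ContinuousLinearMap.fderiv] at e2
      refine e2.symm.trans ?_
      have e3 : (fun t ↦ (ContinuousLinearMap.snd ℝ ℝ ℝ) (C t)) = fun t ↦ t ^ 2 * η t ^ 2 := by
        funext t; simp [C, hye t]; ring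
      rw [e3, (iteratedDeriv_pow_mul (ζ := fun t ↦ η t ^ 2) (by fun_prop) 2).2]; simp
    have hχ2 : iteratedDeriv 2 (fun t ↦ φ (C t)) 0 =
        fderiv ℝ φ (K 0 0, 0) (0, 1) * (2 * η 0 ^ 2) := by
      rw [(iteratedDeriv_comp_of_deriv_eq_zero hφ hC hC1).1, hC0, ← hC2]
      generalize iteratedDeriv 2 C 0 = w
      have : w = w.1 • ((1, 0) : ℝ × ℝ) + w.2 • ((0, 1) : ℝ × ℝ) := by ext <;> simp
      conv_lhs => rw [this, map_add, map_smul, map_smul, h0']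
      simp [mul_comm]
    obtain ⟨ξ, hξ, hξe, hξ2⟩ := exists_eq_pow_mul hχ 2 (by
      intro i hi
      interval_cases i
      · simp [hK1, h0]
      · rw [iteratedDeriv_one]; exact deriv_comp_eq_zero hφ hC hC1)
    have hξ0 : ξ 0 = fderiv ℝ φ (K 0 0, 0) (0, 1) * η 0 ^ 2 := by
      have := hξ2.symm.trans hχ2
      simp at this; linarith
    have c3 : (fun t ↦ cuspForm φ (K t) 2) = fun t ↦ t ^ 5 * (η t ^ 3 * ξ t) := by
      rw [c2]; funext t; rw [hξe t]; ring
    have j3 := iteratedDeriv_pow_mul (ζ := fun t ↦ η t ^ 3 * ξ t) (by fun_prop) 5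
    rw [← c3] at j3
    constructor
    · rw [iteratedDeriv_apply_coord hF, j3.1 4 (by norm_num)]
    · rw [iteratedDeriv_apply_coord hF, j3.2, hη0, hξ0]; simp [Nat.factorial]; ring

section Prepared

variable {φ : ℝ × ℝ → ℝ} {Φ : (Fin 3 → ℝ) → (Fin 3 → ℝ)} {D : (Fin 2 → ℝ) → (Fin 2 → ℝ)}

theorem contDiff_prepared (hφ : ContDiff ℝ ∞ φ) (hΦ : ContDiff ℝ ∞ Φ) (hD : ContDiff ℝ ∞ D) :
    ContDiff ℝ ∞ fun p ↦ Φ (cuspForm φ (D p)) := hΦ.comp ((contDiff_cuspForm hφ).comp hD)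

theorem fderiv_prepared (hφ : ContDiff ℝ ∞ φ) (hΦ : ContDiff ℝ ∞ Φ) (hD : ContDiff ℝ ∞ D)
    (p X : Fin 2 → ℝ) : fderiv ℝ (fun p ↦ Φ (cuspForm φ (D p))) p X =
      fderiv ℝ Φ (cuspForm φ (D p)) (fderiv ℝ (cuspForm φ) (D p) (fderiv ℝ D p X)) := by
  have h1 := ((hD.differentiable (by simp)) p).hasFDerivAt
  have h2 := (((contDiff_cuspForm hφ).differentiable (by simp)) (D p)).hasFDerivAt
  have h3 := ((hΦ.differentiable (by simp)) (cuspForm φ (D p))).hasFDerivAt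
  have h4 := h3.comp p (h2.comp p h1)
  exact congrArg (fun L : (Fin 2 → ℝ) →L[ℝ] (Fin 3 → ℝ) ↦ L X) h4.fderiv

/-- Derivatives of the prepared form at a singular point, in a tangential direction `X` and in the
null direction `Y`. -/
theorem jets_prepared (hφ : ContDiff ℝ ∞ φ) (hΦ : ContDiff ℝ ∞ Φ) (hD : ContDiff ℝ ∞ D)
    {p X Y : Fin 2 → ℝ} (hp : D p 1 = 0) (hY : fderiv ℝ D p Y 0 = 0) :
    let f := fun p ↦ Φ (cuspForm φ (D p))
    let M := fderiv ℝ Φ (cuspForm φ (D p))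
    let α := fderiv ℝ D p X 0
    let κ := fderiv ℝ D p Y 1
    fderiv ℝ f p X = M (α • ![1, 0, 0]) ∧ fderiv ℝ f p Y = 0 ∧
    (∃ β, iteratedDeriv 2 (fun v : ℝ ↦ f (p + v • Y)) 0 = M ![β, 2 * κ ^ 2, 0]) ∧
    det₃ (fderiv ℝ f p X) (iteratedDeriv 2 (fun v : ℝ ↦ f (p + v • Y)) 0)
      (iteratedDeriv 3 (fun v : ℝ ↦ f (p + v • Y)) 0) =
        jac M * (12 * α * κ ^ 5 * φ (D p 0, 0)) := by
  intro f M α κ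
  let K : ℝ → Fin 2 → ℝ := fun v ↦ D (p + v • Y)
  have hK : ContDiff ℝ ∞ K := hD.comp (contDiff_line p Y)
  have hKp : K 0 = D p := by simp [K]
  have hKd : deriv K 0 = fderiv ℝ D p Y := by
    have := congrFun (deriv_comp_eq hD (contDiff_line p Y)) 0
    rw [(hasDerivAt_line p Y 0).deriv] at this
    simpa using this
  obtain ⟨j0, j1, j2, j3, -⟩ := jets_cuspForm_comp hφ hK (by rw [hKp, hp]) (by rw [hKd, hY])
  have hF : ContDiff ℝ ∞ fun t ↦ cuspForm φ (K t) := (contDiff_cuspForm hφ).comp hK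
  obtain ⟨t2, t3, -⟩ := iteratedDeriv_comp_of_deriv_eq_zero hΦ hF j0
  rw [hKp] at t2 t3
  rw [hKd] at j1 j3
  rw [hKp] at j3
  have e1 : fderiv ℝ f p X = M (α • ![1, 0, 0]) := by
    rw [fderiv_prepared hφ hΦ hD, fderiv_cuspForm_of_eq_zero hφ hp]
  have e2 : fderiv ℝ f p Y = 0 := by
    rw [fderiv_prepared hφ hΦ hD, fderiv_cuspForm_of_eq_zero hφ hp, hY, zero_smul, map_zero]
  refine ⟨e1, e2, ⟨iteratedDeriv 2 (fun t ↦ cuspForm φ (K t)) 0 0, ?_⟩, ?_⟩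
  · refine t2.trans (congrArg M ?_)
    ext i; fin_cases i
    · rfl
    · exact j1
    · exact j2
  · have t2' : iteratedDeriv 2 (fun v : ℝ ↦ f (p + v • Y)) 0 = M _ := t2
    have t3' : iteratedDeriv 3 (fun v : ℝ ↦ f (p + v • Y)) 0 = M _ := t3
    rw [e1, t2', t3', det₃_map]
    congr 1
    rw [det₃_eq, j1, j2, j3]
    simp [α, κ]; ring

end Prepared

/-! ### The invariants `ψ` and `a` of the prepared form -/

section Prepared

variable {φ : ℝ × ℝ → ℝ} {Φ : (Fin 3 → ℝ) → (Fin 3 → ℝ)} {D : (Fin 2 → ℝ) → (Fin 2 → ℝ)}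
  {ν : (Fin 2 → ℝ) → (Fin 3 → ℝ)}

theorem linearIndependent_prepared {M : (Fin 3 → ℝ) →L[ℝ] (Fin 3 → ℝ)} (hM : ∀ X, M X = 0 → X = 0)
    {α β κ : ℝ} (hα : α ≠ 0) (hκ : κ ≠ 0) :
    LinearIndependent ℝ ![M (α • ![1, 0, 0]), M ![β, 2 * κ ^ 2, 0]] := by
  refine LinearIndependent.pair_iff.2 fun s t h ↦ ?_
  rw [← map_smul, ← map_smul, ← map_add] at h
  have h := hM _ h
  have h0 := congrFun h 0
  have h1 := congrFun h 1
  simp [hκ] at h0 h1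
  subst h1
  simp [hα] at h0
  exact ⟨h0, rfl⟩

/-- For the prepared form, with `α(t) = D(γ(t))_0`, the value `ψ(t)` is `φ(α(t), 0)` up to a factor
with a known sign: that of the product of the Jacobian of `Φ` and of the components of `dD(γ')` and
`dD(η)` along the two axes. -/
theorem exists_psi_prepared (hφ : ContDiff ℝ ∞ φ) (hΦ : ContDiff ℝ ∞ Φ) (hD : ContDiff ℝ ∞ D)
    (hν : ContDiff ℝ ∞ ν) (hν0 : ν 0 ≠ 0)
    (hperp : ∀ᶠ x in 𝓝 (0 : Fin 2 → ℝ), ∀ X,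
      fderiv ℝ (fun p ↦ Φ (cuspForm φ (D p))) x X ⬝ᵥ ν x = 0)
    (hD0 : D 0 = 0) (hinj : ∀ X, fderiv ℝ Φ 0 X = 0 → X = 0)
    {γ η : ℝ → Fin 2 → ℝ} (hγ : ContDiff ℝ ∞ γ) (hη : ContDiff ℝ ∞ η) (hγ0 : γ 0 = 0)
    (h1 : ∀ᶠ t in 𝓝 (0 : ℝ), D (γ t) 1 = 0)
    (h2 : ∀ᶠ t in 𝓝 (0 : ℝ), fderiv ℝ D (γ t) (η t) 0 = 0)
    (hα0 : fderiv ℝ D 0 (deriv γ 0) 0 ≠ 0) (hκ0 : fderiv ℝ D 0 (η 0) 1 ≠ 0) :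
    ∃ m : ℝ → ℝ, ContinuousAt m 0 ∧
      0 < m 0 * (jac (fderiv ℝ Φ 0) * fderiv ℝ D 0 (deriv γ 0) 0 * fderiv ℝ D 0 (η 0) 1) ∧
      ∀ᶠ t in 𝓝 (0 : ℝ), psi (fun p ↦ Φ (cuspForm φ (D p))) ν γ η t =
        m t * φ (D (γ t) 0, 0) := by
  set f : (Fin 2 → ℝ) → (Fin 3 → ℝ) := fun p ↦ Φ (cuspForm φ (D p)) with hfdef
  have hf : ContDiff ℝ ∞ f := contDiff_prepared hφ hΦ hD
  have hf' : ContDiff ℝ ∞ (fderiv ℝ f) := hf.fderiv_right le_rfl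
  have hf'' : ContDiff ℝ ∞ (fderiv ℝ (fderiv ℝ f)) := hf'.fderiv_right le_rfl
  have hD' : ContDiff ℝ ∞ (fderiv ℝ D) := hD.fderiv_right le_rfl
  have hΦ' : ContDiff ℝ ∞ (fderiv ℝ Φ) := hΦ.fderiv_right le_rfl
  have hγ' : ContDiff ℝ ∞ (deriv γ) := (contDiff_infty_iff_deriv.1 hγ).2
  let u : ℝ → Fin 3 → ℝ := fun t ↦ fderiv ℝ f (γ t) (deriv γ t)
  let a : ℝ → Fin 3 → ℝ := fun t ↦ fderiv ℝ (fderiv ℝ f) (γ t) (η t) (η t)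
  let n : ℝ → Fin 3 → ℝ := fun t ↦ ν (γ t)
  let J : ℝ → ℝ := fun t ↦ jac (fderiv ℝ Φ (cuspForm φ (D (γ t))))
  let α : ℝ → ℝ := fun t ↦ fderiv ℝ D (γ t) (deriv γ t) 0
  let κ : ℝ → ℝ := fun t ↦ fderiv ℝ D (γ t) (η t) 1
  have hu : ContDiff ℝ ∞ u := (hf'.comp hγ).clm_apply hγ'
  have ha : ContDiff ℝ ∞ a := ((hf''.comp hγ).clm_apply hη).clm_apply hη
  have hn : ContDiff ℝ ∞ n := hν.comp hγ
  have hM : ContDiff ℝ ∞ fun t ↦ fderiv ℝ Φ (cuspForm φ (D (γ t))) :=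
    hΦ'.comp ((contDiff_cuspForm hφ).comp (hD.comp hγ))
  have hJ : ContDiff ℝ ∞ J := ContDiff.det₃ (hM.clm_apply contDiff_const)
    (hM.clm_apply contDiff_const) (hM.clm_apply contDiff_const)
  have hα : ContDiff ℝ ∞ α := contDiff_pi.1 ((hD'.comp hγ).clm_apply hγ') 0
  have hκ : ContDiff ℝ ∞ κ := contDiff_pi.1 ((hD'.comp hγ).clm_apply hη) 1
  have hdot : ∀ {x y : ℝ → Fin 3 → ℝ}, ContDiff ℝ ∞ x → ContDiff ℝ ∞ y →
      Continuous fun t ↦ x t ⬝ᵥ y t := by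
    intro x y hx hy
    simp only [dotProduct_fin_three]
    have hx := hx.continuous
    have hy := hy.continuous
    fun_prop
  have z : cuspForm φ (D (γ 0)) = 0 := by rw [hγ0, hD0, cuspForm_zero]
  have hγt : Tendsto γ (𝓝 0) (𝓝 0) := by simpa [ContinuousAt, hγ0] using hγ.continuous.continuousAt (x := 0)
  -- the situation at the points of the curve
  have hnull : ∀ t, D (γ t) 1 = 0 → fderiv ℝ D (γ t) (η t) 0 = 0 → fderiv ℝ f (γ t) (η t) = 0 :=
    fun t e1 e2 ↦ (jets_prepared (X := 0) hφ hΦ hD e1 e2).2.1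
  have jets0 := jets_prepared (X := deriv γ 0) hφ hΦ hD h1.self_of_nhds h2.self_of_nhds
  have hlin0 : LinearIndependent ℝ ![u 0, a 0] := by
    obtain ⟨e1, -, ⟨β, e2⟩, -⟩ := jets0
    have e3 : a 0 = _ := (iteratedDeriv_two_line hf (γ 0) (η 0)).symm.trans e2
    have e4 : u 0 = _ := e1
    rw [e3, e4, z]
    refine linearIndependent_prepared hinj ?_ ?_
    · rwa [hγ0]
    · rwa [hγ0]
  have hperp0 : ∀ X, fderiv ℝ f 0 X ⬝ᵥ ν 0 = 0 := hperp.self_of_nhds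
  have hn0 : n 0 ≠ 0 := by simpa [n, hγ0] using hν0
  have hdet0 : det₃ (u 0) (a 0) (n 0) ≠ 0 := by
    refine det₃_ne_zero_of_orthogonal hlin0 hn0 ?_ ?_
    · simp only [u, n, hγ0]; exact hperp0 _
    · have := (dotProduct_normal_null hf hν (p := γ 0) (Y := η 0) (by rwa [hγ0])
        (hnull 0 h1.self_of_nhds h2.self_of_nhds)).1
      rwa [iteratedDeriv_two_line hf] at this
  have hdet : ∀ᶠ t in 𝓝 (0 : ℝ), det₃ (u t) (a t) (n t) ≠ 0 :=
    (ContDiff.det₃ hu ha hn).continuous.continuousAt.eventually_ne hdet0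
  let G : ℝ → ℝ := fun t ↦ (u t ⬝ᵥ u t) * (a t ⬝ᵥ a t) - (u t ⬝ᵥ a t) ^ 2
  have hG : Continuous G := ((hdot hu hu).mul (hdot ha ha)).sub ((hdot hu ha).pow 2)
  have hG0 : 0 < G 0 := gram_pos hlin0
  refine ⟨fun t ↦ (u t ⬝ᵥ u t) * (n t ⬝ᵥ n t) / 2 / G t * (J t * (12 * α t * κ t ^ 5)), ?_, ?_, ?_⟩
  · refine ContinuousAt.mul (ContinuousAt.div ?_ hG.continuousAt hG0.ne') ?_
    · exact (((hdot hu hu).mul (hdot hn hn)).div_const 2).continuousAt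
    · have := hJ.continuous; have := hα.continuous; have := hκ.continuous
      exact Continuous.continuousAt (by fun_prop)
  · have hu0 : u 0 ≠ 0 := hlin0.ne_zero 0
    have p1 := dotProduct_self_pos_fin_three hu0
    have p2 := dotProduct_self_pos_fin_three hn0
    have eJ : J 0 = jac (fderiv ℝ Φ 0) := by simp only [J, z]
    have eα : α 0 = fderiv ℝ D 0 (deriv γ 0) 0 := by simp only [α, hγ0]
    have eκ : κ 0 = fderiv ℝ D 0 (η 0) 1 := by simp only [κ, hγ0]
    have hJ0 := jac_ne_zero hinj
    rw [← eJ] at hJ0 ⊢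
    rw [← eα] at hα0 ⊢
    rw [← eκ] at hκ0 ⊢
    have e : ∀ c : ℝ, c * (J 0 * (12 * α 0 * κ 0 ^ 5)) * (J 0 * α 0 * κ 0) =
        c * (12 * (J 0 ^ 2 * α 0 ^ 2 * κ 0 ^ 6)) := fun c ↦ by ring
    rw [e]
    positivity
  · filter_upwards [hdet, h1.eventually_nhds, h2.eventually_nhds, hγt.eventually hperp.eventually_nhds,
      hG.continuousAt.eventually_const_lt hG0] with t ht e1 e2 e3 e4
    have hlin := linearIndependent_of_det₃_ne_zero ht
    have hnt : n t ≠ 0 := by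
      intro h0
      apply ht
      rw [h0]; simp [det₃_eq]
    have hnull' : ∀ᶠ s in 𝓝 t, fderiv ℝ f (γ s) (η s) = 0 := by
      filter_upwards [e1, e2] with s e1 e2 using hnull s e1 e2
    have key := psi_mul_gram hf hν hγ hη e3 hnt hnull' (u t) (a t) _ rfl
      (iteratedDeriv_two_line hf _ _).symm rfl hlin
    have j := (jets_prepared (X := deriv γ t) hφ hΦ hD e1.self_of_nhds e2.self_of_nhds).2.2.2
    rw [iteratedDeriv_two_line hf] at j
    have j' : det₃ (u t) (a t) (iteratedDeriv 3 (fun v : ℝ ↦ f (γ t + v • η t)) 0) =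
      J t * (12 * α t * κ t ^ 5 * φ (D (γ t) 0, 0)) := j
    rw [j'] at key
    have e4' : G t ≠ 0 := e4.ne'
    have key' : psi f ν γ η t * G t = u t ⬝ᵥ u t * n t ⬝ᵥ n t / 2 *
      (J t * (12 * α t * κ t ^ 5 * φ (D (γ t) 0, 0))) := key
    field_simp
    linear_combination 2 * key'

/-- Jets of the image of a curve `c` in the null direction, and the value of the number `a`. Only the
derivative of `D` along `c` at `0` enters, because `φ` vanishes to first order in `u` at `0`. -/
theorem cusp_jets_prepared (hφ : ContDiff ℝ ∞ φ) (hΦ : ContDiff ℝ ∞ Φ) (hD : ContDiff ℝ ∞ D)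
    (hD0 : D 0 = 0) (hinj : ∀ X, fderiv ℝ Φ 0 X = 0 → X = 0) (hφ0 : φ 0 = 0)
    (hφ1 : fderiv ℝ φ 0 (1, 0) = 0)
    {γ c : ℝ → Fin 2 → ℝ} (hγ : ContDiff ℝ ∞ γ) (hγ0 : γ 0 = 0) (hc : ContDiff ℝ ∞ c)
    (hc0 : c 0 = 0) (hc1 : fderiv ℝ D 0 (deriv c 0) 0 = 0) :
    let f := fun p ↦ Φ (cuspForm φ (D p))
    deriv (f ∘ c) 0 = 0 ∧
    (fderiv ℝ D 0 (deriv c 0) 1 ≠ 0 → iteratedDeriv 2 (f ∘ c) 0 ≠ 0) ∧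
    ∀ l, iteratedDeriv 3 (f ∘ c) 0 = l • iteratedDeriv 2 (f ∘ c) 0 →
      cuspNumber f γ c l = 720 * (jac (fderiv ℝ Φ 0) * fderiv ℝ D 0 (deriv γ 0) 0 *
        fderiv ℝ D 0 (deriv c 0) 1 ^ 7 * fderiv ℝ φ 0 (0, 1)) := by
  intro f
  let K : ℝ → Fin 2 → ℝ := fun t ↦ D (c t)
  have hK : ContDiff ℝ ∞ K := hD.comp hc
  have hK0 : K 0 = 0 := by simp [K, hc0, hD0]
  have hKd : deriv K 0 = fderiv ℝ D 0 (deriv c 0) := by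
    have := congrFun (deriv_comp_eq hD hc) 0
    rwa [hc0] at this
  obtain ⟨j0, j1, j2, j3, j45⟩ := jets_cuspForm_comp hφ hK (by rw [hK0]; rfl) (by rw [hKd, hc1])
  have hz : ((K 0 0, 0) : ℝ × ℝ) = 0 := by rw [hK0]; rfl
  rw [hz] at j3 j45
  obtain ⟨j4, j5⟩ := j45 hφ0 hφ1
  rw [hφ0, mul_zero] at j3
  have hF : ContDiff ℝ ∞ fun t ↦ cuspForm φ (K t) := (contDiff_cuspForm hφ).comp hK
  obtain ⟨t2, t3, t45⟩ := iteratedDeriv_comp_of_deriv_eq_zero hΦ hF j0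
  have hz' : cuspForm φ (K 0) = 0 := by rw [hK0, cuspForm_zero]
  simp only [hz'] at t2 t3 t45
  have hfc : f ∘ c = fun t ↦ Φ (cuspForm φ (K t)) := rfl
  rw [hfc]
  refine ⟨deriv_comp_eq_zero hΦ hF j0, fun hs h ↦ ?_, fun l hl ↦ ?_⟩
  · rw [t2] at h
    have := congrFun (hinj _ h) 1
    rw [j1, hKd] at this
    simp [hs] at this
  · have hl' : iteratedDeriv 3 (fun t ↦ cuspForm φ (K t)) 0 =
        l • iteratedDeriv 2 (fun t ↦ cuspForm φ (K t)) 0 := by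
      rw [t2, t3, ← map_smul, ← sub_eq_zero, ← map_sub] at hl
      exact sub_eq_zero.1 (hinj _ hl)
    have e1 : deriv (f ∘ γ) 0 =
        fderiv ℝ Φ 0 (fderiv ℝ D 0 (deriv γ 0) 0 • ![1, 0, 0]) := by
      have h := congrFun (deriv_comp_eq (contDiff_prepared hφ hΦ hD) hγ) 0
      refine h.trans ?_
      rw [hγ0, fderiv_prepared hφ hΦ hD, hD0, cuspForm_zero, fderiv_cuspForm_of_eq_zero hφ rfl]
    rw [cuspNumber, hfc, e1, t45 l hl', t2, det₃_map, det₃_eq]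
    simp only [Pi.sub_apply, Pi.smul_apply, j1, j2, j4, j5, hKd, smul_eq_mul]
    simp
    ring

/-- The singular points of the prepared form. -/
theorem fderiv_prepared_eq_zero_iff (hφ : ContDiff ℝ ∞ φ) (hΦ : ContDiff ℝ ∞ Φ)
    (hD : ContDiff ℝ ∞ D) {p : Fin 2 → ℝ}
    (hΦp : ∀ X, fderiv ℝ Φ (cuspForm φ (D p)) X = 0 → X = 0)
    (hDp : ∀ X, fderiv ℝ D p X = 0 → X = 0) :
    (p ∈ singularSet (fun p ↦ Φ (cuspForm φ (D p))) → D p 1 = 0) ∧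
    (D p 1 = 0 → ∀ X, fderiv ℝ (fun p ↦ Φ (cuspForm φ (D p))) p X = 0 → fderiv ℝ D p X 0 = 0) := by
  constructor
  · intro hs
    by_contra hne
    refine hs ((injective_iff_map_eq_zero _).2 fun X hX ↦ ?_)
    rw [fderiv_prepared hφ hΦ hD] at hX
    exact hDp _ (fderiv_cuspForm_injective hφ hne (hΦp _ hX))
  · intro h X hX
    rw [fderiv_prepared hφ hΦ hD, fderiv_cuspForm_of_eq_zero hφ h] at hX
    simpa using congrFun (hΦp _ hX) 0

/-- The prepared form has a non-degenerate singular point at `0`. -/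
theorem isNondegenerateSingularPoint_prepared (hφ : ContDiff ℝ ∞ φ) (hΦ : ContDiff ℝ ∞ Φ)
    (hD : ContDiff ℝ ∞ D) (hν : ContDiff ℝ ∞ ν) (hν0 : ν 0 ≠ 0)
    (hperp : ∀ᶠ x in 𝓝 (0 : Fin 2 → ℝ), ∀ X,
      fderiv ℝ (fun p ↦ Φ (cuspForm φ (D p))) x X ⬝ᵥ ν x = 0)
    (hD0 : D 0 = 0) (hinj : ∀ X, fderiv ℝ Φ 0 X = 0 → X = 0)
    (hDinj : ∀ X, fderiv ℝ D 0 X = 0 → X = 0) :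
    IsNondegenerateSingularPoint (fun p ↦ Φ (cuspForm φ (D p))) ν := by
  have hf := contDiff_prepared hφ hΦ hD
  have hsurj : Function.Surjective (fderiv ℝ D 0) :=
    LinearMap.surjective_of_injective (f := (fderiv ℝ D 0 : (Fin 2 → ℝ) →ₗ[ℝ] (Fin 2 → ℝ)))
      ((injective_iff_map_eq_zero _).2 hDinj)
  obtain ⟨X, hX⟩ := hsurj ![1, 0]
  obtain ⟨Y, hY⟩ := hsurj ![0, 1]
  obtain ⟨e1, e2, ⟨β, e3⟩, -⟩ := jets_prepared (p := 0) (X := X) (Y := Y) hφ hΦ hD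
    (by rw [hD0]; rfl) (by rw [hY]; rfl)
  simp only [hX, hY, hD0, cuspForm_zero] at e1 e3
  refine ⟨fun h ↦ ?_, fun h ↦ ?_⟩
  · have hY0 : Y = 0 := h (by rw [e2, map_zero])
    rw [hY0, map_zero] at hY
    simpa using congrFun hY 1
  · have key := fderiv_areaDensity_null hf hν X Y e2
    rw [h, zero_apply, mul_zero] at key
    refine det₃_ne_zero_of_orthogonal ?_ hν0 (hperp.self_of_nhds X)
      (dotProduct_normal_null hf hν hperp e2).1 key.symm
    rw [e1, e3]
    exact linearIndependent_prepared hinj (by simp) (by simp)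

end Prepared

/-! ### The singular curve and the null vector field -/

section Frontal

variable {f ν : (Fin 2 → ℝ) → (Fin 3 → ℝ)}

theorem fderiv_apply_eq_basis (p X : Fin 2 → ℝ) : fderiv ℝ f p X =
    X 0 • fderiv ℝ f p ![1, 0] + X 1 • fderiv ℝ f p ![0, 1] := by
  rw [← map_smul, ← map_smul, ← map_add]
  congr 1
  ext i; fin_cases i <;> simp

theorem contDiff_areaDensity (hf : ContDiff ℝ ∞ f) (hν : ContDiff ℝ ∞ ν) :
    ContDiff ℝ ∞ (areaDensity f ν) :=
  have hf' : ContDiff ℝ ∞ (fderiv ℝ f) := hf.fderiv_right le_rfl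
  ContDiff.det₃ (hf'.clm_apply contDiff_const) (hf'.clm_apply contDiff_const) hν

/-- The singular set is the zero set of the area density. -/
theorem mem_singularSet_iff {p : Fin 2 → ℝ} (hp : ∀ X, fderiv ℝ f p X ⬝ᵥ ν p = 0)
    (hν : ν p ≠ 0) : p ∈ singularSet f ↔ areaDensity f ν p = 0 := by
  constructor
  · intro hs
    by_contra hne
    have hlin := LinearIndependent.pair_iff.1 (linearIndependent_of_det₃_ne_zero hne)
    refine hs ((injective_iff_map_eq_zero _).2 fun X hX ↦ ?_)
    rw [fderiv_apply_eq_basis] at hX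
    obtain ⟨h0, h1⟩ := hlin _ _ hX
    ext i; fin_cases i <;> simp [h0, h1]
  · intro h0 hinj
    refine det₃_ne_zero_of_orthogonal ?_ hν (hp _) (hp _) h0
    refine LinearIndependent.pair_iff.2 fun s t hst ↦ ?_
    have : fderiv ℝ f p ![s, t] = 0 := by rw [fderiv_apply_eq_basis]; simpa using hst
    have := hinj (this.trans (map_zero _).symm)
    exact ⟨by simpa using congrFun this 0, by simpa using congrFun this 1⟩

theorem det₂_ne_zero_of_linearIndependent {x y : Fin 2 → ℝ} (h : LinearIndependent ℝ ![x, y]) :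
    det₂ x y ≠ 0 := by
  intro h0
  rw [det₂_eq] at h0
  have h1 := LinearIndependent.pair_iff.1 h (y 1) (-x 1) (by
    ext i; fin_cases i <;> simp <;> linarith)
  have h2 := LinearIndependent.pair_iff.1 h (y 0) (-x 0) (by
    ext i; fin_cases i <;> simp <;> linarith)
  refine h.ne_zero 1 ?_
  ext i; fin_cases i
  · exact h2.1
  · exact h1.1

/-- A regular parametrization of the singular set, from the inverse function theorem applied to the
area density and a complementary linear coordinate. -/
theorem exists_isSingularCurve (hf : ContDiff ℝ ∞ f) (hν : ContDiff ℝ ∞ ν)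
    (hperp : ∀ᶠ x in 𝓝 (0 : Fin 2 → ℝ), ∀ X, fderiv ℝ f x X ⬝ᵥ ν x = 0) (hν0 : ν 0 ≠ 0)
    (hnd : IsNondegenerateSingularPoint f ν) : ∃ γ, IsSingularCurve f γ := by
  have hlam := contDiff_areaDensity hf hν
  have hsing : ∀ᶠ p in 𝓝 (0 : Fin 2 → ℝ), p ∈ singularSet f ↔ areaDensity f ν p = 0 := by
    filter_upwards [hperp, hν.continuous.continuousAt.eventually_ne hν0] with p h1 h2
    exact mem_singularSet_iff h1 h2
  have hlam0 : areaDensity f ν 0 = 0 := hsing.self_of_nhds.1 hnd.1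
  set L := fderiv ℝ (areaDensity f ν) 0 with hL
  have hLX : ∀ X, L X = X 0 * L ![1, 0] + X 1 * L ![0, 1] := fun X ↦ by
    rw [← smul_eq_mul, ← smul_eq_mul, ← map_smul, ← map_smul, ← map_add]
    congr 1
    ext i; fin_cases i <;> simp
  have hLne : 0 < L ![1, 0] ^ 2 + L ![0, 1] ^ 2 := by
    by_contra! hle
    have h0 : L ![1, 0] = 0 := by nlinarith [sq_nonneg (L ![1, 0]), sq_nonneg (L ![0, 1])]
    have h1 : L ![0, 1] = 0 := by nlinarith [sq_nonneg (L ![1, 0]), sq_nonneg (L ![0, 1])]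
    exact hnd.2 (by ext X; rw [hLX, h0, h1]; simp)
  have hd : IsDiffeoGerm fun p : Fin 2 → ℝ ↦
      ![L ![1, 0] * p 1 - L ![0, 1] * p 0, areaDensity f ν p] := by
    refine isDiffeoGerm_of_fderiv_injective (ContDiff.isSmoothGerm
      (ContDiff.vec2 (by fun_prop) hlam) 0) ?_ fun X hX ↦ ?_
    · ext i; fin_cases i <;> simp [hlam0]
    · have e0 := ((hasFDerivAt_coord (1 : Fin 2) 0).const_mul (L ![1, 0])).sub
        ((hasFDerivAt_coord (0 : Fin 2) 0).const_mul (L ![0, 1]))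
      have h := (fderiv_vec2_apply e0 ((hlam.differentiable (by simp)) 0).hasFDerivAt X).symm.trans
        hX
      have x0 := congrFun h 0
      have x1 := congrFun h 1
      simp only [← hL, hLX X] at x1
      simp at x0 x1
      have y0 : (L ![1, 0] ^ 2 + L ![0, 1] ^ 2) * X 0 = 0 := by
        linear_combination L ![1, 0] * x1 - L ![0, 1] * x0
      have y1 : (L ![1, 0] ^ 2 + L ![0, 1] ^ 2) * X 1 = 0 := by
        linear_combination L ![0, 1] * x1 + L ![1, 0] * x0
      ext i; fin_cases i
      · simpa [hLne.ne'] using y0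
      · simpa [hLne.ne'] using y1
  have hdt := hd.tendsto
  obtain ⟨hd1, hd0, e, he, he0, hed, hde⟩ := hd
  have hline : ContDiff ℝ ∞ fun t : ℝ ↦ (![t, 0] : Fin 2 → ℝ) := contDiff_id.vec2 contDiff_const
  have hl0 : (![0, 0] : Fin 2 → ℝ) = 0 := by ext i; fin_cases i <;> rfl
  have hlt : Tendsto (fun t : ℝ ↦ (![t, 0] : Fin 2 → ℝ)) (𝓝 0) (𝓝 0) :=
    hline.continuous.tendsto' _ _ hl0
  have hγs : IsSmoothGerm (e ∘ fun t : ℝ ↦ (![t, 0] : Fin 2 → ℝ)) 0 :=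
    IsSmoothGerm.comp (by rwa [hl0]) (hline.isSmoothGerm 0)
  have het : Tendsto e (𝓝 0) (𝓝 0) := by simpa [ContinuousAt, he0] using he.continuousAt
  have hγt := het.comp hlt
  have hγe : ∀ᶠ t in 𝓝 (0 : ℝ), L ![1, 0] * (e ![t, 0]) 1 - L ![0, 1] * (e ![t, 0]) 0 = t ∧
      areaDensity f ν (e ![t, 0]) = 0 := by
    filter_upwards [hlt.eventually hde] with t ht
    exact ⟨by simpa using congrFun ht 0, by simpa using congrFun ht 1⟩
  refine ⟨e ∘ fun t : ℝ ↦ ![t, 0], hγs, by simp [hl0, he0], fun h0 ↦ ?_, ?_, fun δ hδ ↦ ?_⟩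
  · have h1 := hasDerivAt_pi.1 hγs.differentiableAt.hasDerivAt
    rw [h0] at h1
    have h2 := ((h1 1).const_mul (L ![1, 0])).sub ((h1 0).const_mul (L ![0, 1]))
    have h3 := (hasDerivAt_id (0 : ℝ)).congr_of_eventuallyEq (hγe.mono fun t ht ↦ ht.1)
    have := h3.unique h2
    simp at this
  · filter_upwards [hγe, hγt.eventually hsing] with t h1 h2
    exact h2.2 h1.2
  · have hp0 : Tendsto (fun p : Fin 2 → ℝ ↦ L ![1, 0] * p 1 - L ![0, 1] * p 0) (𝓝 0) (𝓝 0) := by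
      have : Continuous fun p : Fin 2 → ℝ ↦ L ![1, 0] * p 1 - L ![0, 1] * p 0 := by fun_prop
      exact this.tendsto' _ _ (by simp)
    filter_upwards [hed, hsing, hp0.eventually (Ioo_mem_nhds (neg_lt_zero.2 hδ) hδ)]
      with p h1 h2 h3 hp
    refine ⟨_, h3, ?_⟩
    rw [h2.1 hp] at h1
    exact h1

/-- Along the singular curve the kernel of `df` is the kernel of a non-zero row of its matrix. -/
theorem exists_isNullField (hf : ContDiff ℝ ∞ f) (hν : ContDiff ℝ ∞ ν)
    (hnd : IsNondegenerateSingularPoint f ν) {γ : ℝ → Fin 2 → ℝ} (hγ : IsSingularCurve f γ) :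
    ∃ η, IsNullField f γ η := by
  have hf' : ContDiff ℝ ∞ (fderiv ℝ f) := hf.fderiv_right le_rfl
  have hrow : ∃ i, fderiv ℝ f 0 ![1, 0] i ≠ 0 ∨ fderiv ℝ f 0 ![0, 1] i ≠ 0 := by
    by_contra! hcon
    have h0 : fderiv ℝ f 0 ![1, 0] = 0 := funext fun i ↦ (hcon i).1
    have h1 : fderiv ℝ f 0 ![0, 1] = 0 := funext fun i ↦ (hcon i).2
    have k0 := fderiv_areaDensity_null hf hν ![0, 1] ![1, 0] h0
    have k1 := fderiv_areaDensity_null hf hν ![1, 0] ![0, 1] h1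
    rw [h1] at k0
    rw [h0] at k1
    simp [det₂_eq, det₃_eq] at k0 k1
    refine hnd.2 ?_
    ext X
    have : X = X 0 • ![1, 0] + X 1 • ![0, 1] := by ext i; fin_cases i <;> simp
    rw [this, map_add, map_smul, map_smul, k0, k1]; simp
  obtain ⟨i, hi⟩ := hrow
  let r : ℝ → (Fin 2 → ℝ) → ℝ := fun t X ↦ fderiv ℝ f (γ t) X i
  have hr : ∀ X, ∀ g : ℝ → Fin 2 → ℝ, IsSmoothGerm g 0 →
      IsSmoothGerm (fun t ↦ fderiv ℝ f (g t) X i) 0 := fun X g hg ↦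
    IsSmoothGerm.comp (g := fun p ↦ fderiv ℝ f p X i)
      ((contDiff_pi.1 (hf'.clm_apply contDiff_const) i).isSmoothGerm _) hg
  have h0 := hr ![1, 0] γ hγ.smooth
  have h1 := hr ![0, 1] γ hγ.smooth
  have hne : ∀ᶠ t in 𝓝 (0 : ℝ), 0 < r t ![1, 0] ^ 2 + r t ![0, 1] ^ 2 := by
    have hc : ContinuousAt (fun t ↦ r t ![1, 0] ^ 2 + r t ![0, 1] ^ 2) 0 :=
      (h0.continuousAt.pow 2).add (h1.continuousAt.pow 2)
    refine hc.eventually_const_lt ?_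
    simp only [r, hγ.map_zero]
    rcases hi with hi | hi
    · have := sq_nonneg (fderiv ℝ f 0 ![0, 1] i); positivity
    · have := sq_nonneg (fderiv ℝ f 0 ![1, 0] i); positivity
  have hker : ∀ t, 0 < r t ![1, 0] ^ 2 + r t ![0, 1] ^ 2 → ∀ X, fderiv ℝ f (γ t) X = 0 →
      X = ((X 0 * r t ![0, 1] - X 1 * r t ![1, 0]) / (r t ![1, 0] ^ 2 + r t ![0, 1] ^ 2)) •
        ![r t ![0, 1], -r t ![1, 0]] := by
    intro t ht X hX
    have hX' : X 0 * r t ![1, 0] + X 1 * r t ![0, 1] = 0 := by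
      rw [fderiv_apply_eq_basis] at hX
      simpa using congrFun hX i
    have ht' := ht.ne'
    ext j; fin_cases j
    · simp
      field_simp
      linear_combination r t ![1, 0] * hX'
    · simp
      field_simp
      linear_combination r t ![0, 1] * hX'
  refine ⟨fun t ↦ ![r t ![0, 1], -r t ![1, 0]], ?_, ?_, ?_⟩
  · filter_upwards [h0, h1] with t a b using ContDiffAt.vec2 b a.neg
  · filter_upwards [hne] with t ht h
    have a := congrFun h 0
    have b := congrFun h 1
    simp at a b
    simp [a, b] at ht
  · filter_upwards [hne, hγ.mem] with t ht hs X
    refine ⟨fun hX ↦ ⟨_, hker t ht X hX⟩, ?_⟩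
    rintro ⟨s, rfl⟩
    have : ∃ Z, Z ≠ 0 ∧ fderiv ℝ f (γ t) Z = 0 := by
      by_contra! hcon
      exact hs ((injective_iff_map_eq_zero _).2 fun Z hZ ↦ by
        by_contra hZ0; exact hcon Z hZ0 hZ)
    obtain ⟨Z, hZ0, hZ⟩ := this
    have hZe := hker t ht Z hZ
    generalize (Z 0 * r t ![0, 1] - Z 1 * r t ![1, 0]) / (r t ![1, 0] ^ 2 + r t ![0, 1] ^ 2) = a
      at hZe
    have ha : a ≠ 0 := by rintro rfl; exact hZ0 (by rw [hZe, zero_smul])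
    rw [hZe, map_smul] at hZ
    rw [map_smul, (smul_eq_zero.1 hZ).resolve_left ha, smul_zero]

/-- The preparation theorem for a frontal whose null direction is transverse to the singular
curve. -/
theorem exists_aEquivalent_cuspForm_of_transverse (hf : ContDiff ℝ ∞ f) (hν : ContDiff ℝ ∞ ν)
    (hf0 : f 0 = 0) (hperp : ∀ᶠ x in 𝓝 (0 : Fin 2 → ℝ), ∀ X, fderiv ℝ f x X ⬝ᵥ ν x = 0)
    (hν0 : ν 0 ≠ 0) (hnd : IsNondegenerateSingularPoint f ν)
    {γ η : ℝ → Fin 2 → ℝ} (hγ : ContDiff ℝ ∞ γ) (hη : ContDiff ℝ ∞ η) (hγ0 : γ 0 = 0)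
    (hmem : ∀ᶠ t in 𝓝 (0 : ℝ), γ t ∈ singularSet f)
    (hnull : ∀ᶠ t in 𝓝 (0 : ℝ), fderiv ℝ f (γ t) (η t) = 0)
    (hlin : LinearIndependent ℝ ![deriv γ 0, η 0]) :
    ∃ φ : ℝ × ℝ → ℝ, ContDiff ℝ ∞ φ ∧ AEquivalent f (cuspForm φ) := by
  have hlam := contDiff_areaDensity hf hν
  have hγt : Tendsto γ (𝓝 0) (𝓝 0) := hγ.continuous.tendsto' _ _ hγ0
  have hn0 : fderiv ℝ f 0 (η 0) = 0 := by have := hnull.self_of_nhds; rwa [hγ0] at this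
  have hdet := det₂_ne_zero_of_linearIndependent hlin
  -- `dλ(0)` vanishes on `γ'(0)`, hence not on `η(0)`
  have hγ' : fderiv ℝ (areaDensity f ν) 0 (deriv γ 0) = 0 := by
    have h1 := congrFun (deriv_comp_eq hlam hγ) 0
    rw [hγ0] at h1
    rw [← h1]
    have : (fun t ↦ areaDensity f ν (γ t)) =ᶠ[𝓝 0] fun _ ↦ 0 := by
      filter_upwards [hmem, hγt.eventually hperp,
        hγt.eventually (hν.continuous.continuousAt.eventually_ne hν0)] with t h1 h2 h3
      exact (mem_singularSet_iff h2 h3).1 h1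
    rw [this.deriv_eq, deriv_const]
  have hη' : fderiv ℝ (areaDensity f ν) 0 (η 0) ≠ 0 := by
    intro h
    refine hnd.2 ?_
    ext X
    have hX : det₂ (deriv γ 0) (η 0) • X =
        (X 0 * η 0 1 - X 1 * η 0 0) • deriv γ 0 +
          (deriv γ 0 0 * X 1 - deriv γ 0 1 * X 0) • η 0 := by
      rw [det₂_eq]
      ext i; fin_cases i <;> simp <;> ring
    have := congrArg (fderiv ℝ (areaDensity f ν) 0) hX
    rw [map_add, map_smul, map_smul, map_smul, hγ', h] at this
    simpa [hdet] using this
  have key := fderiv_areaDensity_null hf hν (deriv γ 0) (η 0) hn0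
  have hlin' := linearIndependent_of_det₃_ne_zero (key ▸ mul_ne_zero hdet hη')
  -- the coordinates `(u, v) ↦ γ(u) + v η(u)`
  let H : (Fin 2 → ℝ) → (Fin 2 → ℝ) := fun p ↦ γ (p 0) + p 1 • η (p 0)
  have hH : ContDiff ℝ ∞ H := by fun_prop
  have hH0 : H 0 = 0 := by simp [H, hγ0]
  have hHd : ∀ u, ∀ X, fderiv ℝ H ![u, 0] X = X 0 • deriv γ u + X 1 • η u := by
    intro u X
    have c0 := hasFDerivAt_coord (0 : Fin 2) ![u, 0]
    have c1 := hasFDerivAt_coord (1 : Fin 2) ![u, 0]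
    have a1 : HasFDerivAt (fun p : Fin 2 → ℝ ↦ γ (p 0)) _ ![u, 0] :=
      ((hγ.differentiable (by simp)) u).hasDerivAt.hasFDerivAt.comp ![u, 0] c0
    have a2 : HasFDerivAt (fun p : Fin 2 → ℝ ↦ η (p 0)) _ ![u, 0] :=
      ((hη.differentiable (by simp)) u).hasDerivAt.hasFDerivAt.comp ![u, 0] c0
    have := (a1.add (c1.smul a2)).fderiv
    refine (congrArg (fun L : (Fin 2 → ℝ) →L[ℝ] (Fin 2 → ℝ) ↦ L X) this).trans ?_
    simp
  have hz : (![0, 0] : Fin 2 → ℝ) = 0 := by ext i; fin_cases i <;> rfl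
  have hHdiff : IsDiffeoGerm H := by
    refine isDiffeoGerm_of_fderiv_injective (hH.isSmoothGerm 0) hH0 fun X hX ↦ ?_
    rw [← hz, hHd, hz] at hX
    obtain ⟨h0, h1⟩ := LinearIndependent.pair_iff.1 hlin _ _ hX
    ext i; fin_cases i <;> simp [h0, h1]
  have hg : ContDiff ℝ ∞ (f ∘ H) := hf.comp hH
  have hgd : ∀ u X, fderiv ℝ (f ∘ H) ![u, 0] X = fderiv ℝ f (γ u) (fderiv ℝ H ![u, 0] X) := by
    intro u X
    rw [fderiv_comp _ ((hf.differentiable (by simp)) _) ((hH.differentiable (by simp)) _)]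
    simp [H]
  obtain ⟨φ, hφ, hequiv⟩ := exists_aEquivalent_cuspForm (f ∘ H) hg (by simp [hH0, hf0]) (by
      filter_upwards [hnull] with u hu
      rw [hgd, hHd]; simpa using hu) (by
      rw [← hz, hgd, hHd, hγ0]
      convert hlin' using 3
      · simp
      · simp [H, hγ0])
  obtain ⟨h1, h2, e, he, he0, hed, hde⟩ := hHdiff
  refine ⟨φ, hφ, (AEquivalent.of_source (d := e) ⟨he, he0, H, h1, h2, hde, hed⟩ ?_).trans hequiv⟩
  filter_upwards [hde] with x hx
  simp [hx]

end Frontal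

/-! ### Invariants of germs equivalent to the prepared form -/

theorem psi_eventuallyEq {f f' ν ν' : (Fin 2 → ℝ) → (Fin 3 → ℝ)} {γ γ' η η' : ℝ → Fin 2 → ℝ}
    (hf : f =ᶠ[𝓝 0] f') (hν : ν =ᶠ[𝓝 0] ν') (hγ : γ =ᶠ[𝓝 0] γ') (hη : η =ᶠ[𝓝 0] η')
    (hγt : Tendsto γ (𝓝 0) (𝓝 0)) : psi f ν γ η =ᶠ[𝓝 0] psi f' ν' γ' η' := by
  have hfγ : f ∘ γ =ᶠ[𝓝 0] f' ∘ γ' := by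
    filter_upwards [hγt.eventually hf, hγ] with t h1 h2
    simp [h1, ← h2]
  filter_upwards [hfγ.eventuallyEq_nhds, hγ, hη, hγt.eventually hν.eventuallyEq_nhds]
    with t h1 h2 h3 h4
  rw [psi, psi, h1.deriv_eq, ← h2, ← h3, h4.self_of_nhds, h4.fderiv_eq]

theorem contDiff_psi {f ν : (Fin 2 → ℝ) → (Fin 3 → ℝ)} {γ η : ℝ → Fin 2 → ℝ} (hf : ContDiff ℝ ∞ f)
    (hν : ContDiff ℝ ∞ ν) (hγ : ContDiff ℝ ∞ γ) (hη : ContDiff ℝ ∞ η) :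
    ContDiff ℝ ∞ (psi f ν γ η) :=
  have hν' : ContDiff ℝ ∞ (fderiv ℝ ν) := hν.fderiv_right le_rfl
  ContDiff.det₃ (contDiff_infty_iff_deriv.1 (hf.comp hγ)).2 (hν.comp hγ)
    ((hν'.comp hγ).clm_apply hη)

theorem Filter.EventuallyEq.comp_germ {f f' : (Fin 2 → ℝ) → (Fin 3 → ℝ)} {c c' : ℝ → Fin 2 → ℝ}
    (hf : f =ᶠ[𝓝 0] f') (hc : c =ᶠ[𝓝 0] c') (hct : Tendsto c (𝓝 0) (𝓝 0)) :
    f ∘ c =ᶠ[𝓝 0] f' ∘ c' := by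
  filter_upwards [hct.eventually hf, hc] with t h1 h2
  simp [h1, ← h2]

theorem cuspNumber_congr {f f' : (Fin 2 → ℝ) → (Fin 3 → ℝ)} {γ γ' c c' : ℝ → Fin 2 → ℝ}
    (hf : f =ᶠ[𝓝 0] f') (hγ : γ =ᶠ[𝓝 0] γ') (hc : c =ᶠ[𝓝 0] c') (hγt : Tendsto γ (𝓝 0) (𝓝 0))
    (hct : Tendsto c (𝓝 0) (𝓝 0)) (l : ℝ) : cuspNumber f γ c l = cuspNumber f' γ' c' l := by
  have h1 := hf.comp_germ hγ hγt
  have h2 := hf.comp_germ hc hct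
  rw [cuspNumber, cuspNumber, h1.deriv_eq, h2.iteratedDeriv_eq, h2.iteratedDeriv_eq,
    h2.iteratedDeriv_eq]

/-- A presentation of the germ of the frontal `f` with normal vector `ν` as `Φ ∘ cuspForm φ ∘ D`. All
maps are smooth on the whole space, while the relations between them hold near `0`: `Φ` and `D` are
diffeomorphism germs, `e` is the inverse germ of `D`, and `n` represents `ν`. -/
structure PreparedData (f ν : (Fin 2 → ℝ) → (Fin 3 → ℝ)) (φ : ℝ × ℝ → ℝ)
    (Φ : (Fin 3 → ℝ) → (Fin 3 → ℝ)) (D e : (Fin 2 → ℝ) → (Fin 2 → ℝ))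
    (n : (Fin 2 → ℝ) → (Fin 3 → ℝ)) : Prop where
  smooth_φ : ContDiff ℝ ∞ φ
  smooth_Φ : ContDiff ℝ ∞ Φ
  smooth_D : ContDiff ℝ ∞ D
  smooth_e : ContDiff ℝ ∞ e
  smooth_n : ContDiff ℝ ∞ n
  D_zero : D 0 = 0
  e_zero : e 0 = 0
  D_e : ∀ᶠ x in 𝓝 (0 : Fin 2 → ℝ), D (e x) = x
  inj_Φ : ∀ᶠ x in 𝓝 (0 : Fin 3 → ℝ), ∀ X, fderiv ℝ Φ x X = 0 → X = 0
  inj_D : ∀ᶠ x in 𝓝 (0 : Fin 2 → ℝ), ∀ X, fderiv ℝ D x X = 0 → X = 0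
  f_eq : f =ᶠ[𝓝 0] fun p ↦ Φ (cuspForm φ (D p))
  ν_eq : ν =ᶠ[𝓝 0] n
  n_ne_zero : n 0 ≠ 0
  perp : ∀ᶠ x in 𝓝 (0 : Fin 2 → ℝ), ∀ X,
    fderiv ℝ (fun p ↦ Φ (cuspForm φ (D p))) x X ⬝ᵥ n x = 0

theorem IsFrontalWithNormal.exists_preparedData {f ν : (Fin 2 → ℝ) → (Fin 3 → ℝ)}
    (hf : IsFrontalWithNormal f ν) {φ : ℝ × ℝ → ℝ} (hφ : ContDiff ℝ ∞ φ)
    (h : AEquivalent f (cuspForm φ)) : ∃ Φ D e n, PreparedData f ν φ Φ D e n := by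
  obtain ⟨Φ₀, D₀, hΦ₀, hD₀, hfe⟩ := h.exists_factorization hf.smooth.continuousAt hf.map_zero
  have hinjΦ := hΦ₀.eventually_fderiv_injective
  have hinjD := hD₀.eventually_fderiv_injective
  have hDt := hD₀.tendsto
  obtain ⟨hD1, hD2, e₀, he1, he2, hed, hde⟩ := hD₀
  obtain ⟨Φ, hΦ, hΦe⟩ := hΦ₀.1.exists_contDiff
  obtain ⟨D, hD, hDe⟩ := hD1.exists_contDiff
  obtain ⟨e, he, hee⟩ := he1.exists_contDiff
  obtain ⟨n, hn, hne⟩ := hf.normal.smooth.exists_contDiff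
  have het : Tendsto e₀ (𝓝 0) (𝓝 0) := by simpa [ContinuousAt, he2] using he1.continuousAt
  have hF : Tendsto (cuspForm φ) (𝓝 0) (𝓝 0) :=
    (contDiff_cuspForm hφ).continuous.tendsto' _ _ (cuspForm_zero φ)
  have hfe' : f =ᶠ[𝓝 0] fun p ↦ Φ (cuspForm φ (D p)) := by
    filter_upwards [hfe, hDe, (hF.comp hDt).eventually hΦe] with p h1 h2 h3
    simp only [Function.comp_apply] at h1 h3
    rw [h1, h3, h2]
  refine ⟨Φ, D, e, n, hφ, hΦ, hD, he, hn, by rw [← hDe.self_of_nhds, hD2],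
    by rw [← hee.self_of_nhds, he2], ?_, ?_, ?_, hfe', hne, ?_, ?_⟩
  · filter_upwards [hde, hee, het.eventually hDe] with x h1 h2 h3
    rw [← h2, ← h3, h1]
  · filter_upwards [hinjΦ, hΦe.eventuallyEq_nhds] with x h1 h2
    rwa [h2.fderiv_eq] at h1
  · filter_upwards [hinjD, hDe.eventuallyEq_nhds] with x h1 h2
    rwa [h2.fderiv_eq] at h1
  · rw [← hne.self_of_nhds]; exact hf.normal.ne_zero.self_of_nhds
  · filter_upwards [hf.normal.orthogonal, hfe'.eventuallyEq_nhds, hne] with x h1 h2 h3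
    rwa [h2.fderiv_eq, h3] at h1

theorem singularSet_congr {f f' : (Fin 2 → ℝ) → (Fin 3 → ℝ)} {p : Fin 2 → ℝ}
    (h : f =ᶠ[𝓝 p] f') : p ∈ singularSet f ↔ p ∈ singularSet f' := by
  simp only [singularSet, Set.mem_ofPred_eq, h.fderiv_eq]

theorem isNondegenerateSingularPoint_congr {f f' ν ν' : (Fin 2 → ℝ) → (Fin 3 → ℝ)}
    (hf : f =ᶠ[𝓝 0] f') (hν : ν =ᶠ[𝓝 0] ν') :
    IsNondegenerateSingularPoint f ν ↔ IsNondegenerateSingularPoint f' ν' := by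
  have h : areaDensity f ν =ᶠ[𝓝 0] areaDensity f' ν' := by
    filter_upwards [hf.eventuallyEq_nhds, hν] with p h1 h2
    rw [areaDensity, areaDensity, h1.fderiv_eq, h2]
  rw [IsNondegenerateSingularPoint, IsNondegenerateSingularPoint, singularSet_congr hf, h.fderiv_eq]

theorem IsSingularCurve.tendsto {f : (Fin 2 → ℝ) → (Fin 3 → ℝ)} {γ : ℝ → Fin 2 → ℝ}
    (hγ : IsSingularCurve f γ) : Tendsto γ (𝓝 0) (𝓝 0) := by
  simpa [ContinuousAt, hγ.map_zero] using hγ.smooth.continuousAt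

section Invariants

variable {f ν : (Fin 2 → ℝ) → (Fin 3 → ℝ)} {φ : ℝ × ℝ → ℝ} {Φ : (Fin 3 → ℝ) → (Fin 3 → ℝ)}
  {D e : (Fin 2 → ℝ) → (Fin 2 → ℝ)} {n : (Fin 2 → ℝ) → (Fin 3 → ℝ)}

theorem PreparedData.isNondegenerateSingularPoint (h : PreparedData f ν φ Φ D e n) :
    IsNondegenerateSingularPoint f ν :=
  (isNondegenerateSingularPoint_congr h.f_eq h.ν_eq).2
    (isNondegenerateSingularPoint_prepared h.smooth_φ h.smooth_Φ h.smooth_D h.smooth_n h.n_ne_zero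
      h.perp h.D_zero h.inj_Φ.self_of_nhds h.inj_D.self_of_nhds)

/-- In the prepared coordinates the singular curve runs in the line `v = 0` and the null field is
vertical. -/
theorem PreparedData.singularCurve (h : PreparedData f ν φ Φ D e n) {γ η : ℝ → Fin 2 → ℝ}
    (hγ : IsSingularCurve f γ) (hη : IsNullField f γ η) :
    (∀ᶠ t in 𝓝 (0 : ℝ), D (γ t) 1 = 0) ∧ (∀ᶠ t in 𝓝 (0 : ℝ), fderiv ℝ D (γ t) (η t) 0 = 0) ∧
    fderiv ℝ D 0 (deriv γ 0) 1 = 0 ∧ fderiv ℝ D 0 (deriv γ 0) 0 ≠ 0 ∧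
    fderiv ℝ D 0 (η 0) 1 ≠ 0 := by
  have hF : Tendsto (fun p ↦ cuspForm φ (D p)) (𝓝 0) (𝓝 0) :=
    ((contDiff_cuspForm h.smooth_φ).comp h.smooth_D).continuous.tendsto' _ _ (by
      simp [h.D_zero, cuspForm_zero])
  have hpt : ∀ᶠ p in 𝓝 (0 : Fin 2 → ℝ), (p ∈ singularSet f → D p 1 = 0) ∧
      (D p 1 = 0 → ∀ X, fderiv ℝ f p X = 0 → fderiv ℝ D p X 0 = 0) := by
    filter_upwards [h.inj_D, hF.eventually h.inj_Φ, h.f_eq.eventuallyEq_nhds] with p h1 h2 h3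
    rw [singularSet_congr h3, h3.fderiv_eq]
    exact fderiv_prepared_eq_zero_iff h.smooth_φ h.smooth_Φ h.smooth_D h2 h1
  have hptγ := hγ.tendsto.eventually hpt
  have e1 : ∀ᶠ t in 𝓝 (0 : ℝ), D (γ t) 1 = 0 := by
    filter_upwards [hptγ, hγ.mem] with t h1 h2 using h1.1 h2
  have e2 : ∀ᶠ t in 𝓝 (0 : ℝ), fderiv ℝ D (γ t) (η t) 0 = 0 := by
    filter_upwards [hptγ, e1, hη.ker_eq] with t h1 h2 h3
    exact h1.2 h2 _ ((h3 _).2 ⟨1, by simp⟩)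
  have hDγ := ((h.smooth_D.differentiable (by simp)) 0).hasFDerivAt.comp_hasDerivAt_of_eq (0 : ℝ)
    hγ.smooth.differentiableAt.hasDerivAt hγ.map_zero.symm
  have e3 : fderiv ℝ D 0 (deriv γ 0) 1 = 0 := by
    have h1 := (hasDerivAt_pi.1 hDγ 1).deriv
    rw [← h1]
    have h2 : (fun t ↦ (D ∘ γ) t 1) =ᶠ[𝓝 0] fun _ ↦ 0 := e1
    rw [h2.deriv_eq, deriv_const]
  refine ⟨e1, e2, e3, fun h0 ↦ hγ.regular (h.inj_D.self_of_nhds _ ?_), fun h0 ↦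
    hη.ne_zero.self_of_nhds (h.inj_D.self_of_nhds _ ?_)⟩
  · ext i; fin_cases i
    · exact h0
    · exact e3
  · have := e2.self_of_nhds
    rw [hγ.map_zero] at this
    ext i; fin_cases i
    · exact this
    · exact h0

theorem PreparedData.linearIndependent (h : PreparedData f ν φ Φ D e n) {γ η : ℝ → Fin 2 → ℝ}
    (hγ : IsSingularCurve f γ) (hη : IsNullField f γ η) :
    LinearIndependent ℝ ![deriv γ 0, η 0] := by
  obtain ⟨-, e2, e3, e4, e5⟩ := h.singularCurve hγ hη
  have e2 := e2.self_of_nhds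
  rw [hγ.map_zero] at e2
  refine LinearIndependent.pair_iff.2 fun s t hst ↦ ?_
  have := congrArg (fderiv ℝ D 0) hst
  rw [map_add, map_smul, map_smul, map_zero] at this
  have a := congrFun this 0
  have b := congrFun this 1
  simp [e2, e3, e4, e5] at a b
  exact ⟨a, b⟩

/-- The germ of `ψ` in the prepared coordinates. -/
theorem PreparedData.exists_psi_eq (h : PreparedData f ν φ Φ D e n) {γ η : ℝ → Fin 2 → ℝ}
    (hγ : IsSingularCurve f γ) (hη : IsNullField f γ η) :
    ∃ α m ψ : ℝ → ℝ, ContDiff ℝ ∞ α ∧ α 0 = 0 ∧ deriv α 0 = fderiv ℝ D 0 (deriv γ 0) 0 ∧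
      ContDiff ℝ ∞ ψ ∧ psi f ν γ η =ᶠ[𝓝 0] ψ ∧ ContinuousAt m 0 ∧
      0 < m 0 * (jac (fderiv ℝ Φ 0) * deriv α 0 * fderiv ℝ D 0 (η 0) 1) ∧
      ∀ᶠ t in 𝓝 (0 : ℝ), ψ t = m t * φ (α t, 0) := by
  obtain ⟨g, hg, hgγ⟩ := hγ.smooth.exists_contDiff
  obtain ⟨y, hy, hyη⟩ := hη.smooth.exists_contDiff
  obtain ⟨e1, e2, e3, e4, e5⟩ := h.singularCurve hγ hη
  have hg0 : g 0 = 0 := by rw [← hgγ.self_of_nhds, hγ.map_zero]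
  have hy0 : y 0 = η 0 := hyη.self_of_nhds.symm
  have hg' : deriv g 0 = deriv γ 0 := hgγ.deriv_eq.symm
  obtain ⟨m, hm, hm0, hψ⟩ := exists_psi_prepared h.smooth_φ h.smooth_Φ h.smooth_D h.smooth_n
    h.n_ne_zero h.perp h.D_zero h.inj_Φ.self_of_nhds hg hy hg0
    (by filter_upwards [e1, hgγ] with t h1 h2; rwa [← h2])
    (by filter_upwards [e2, hgγ, hyη] with t h1 h2 h3; rwa [← h2, ← h3])
    (by rwa [hg']) (by rwa [hy0])
  have hα : ContDiff ℝ ∞ fun t ↦ D (g t) 0 := contDiff_pi.1 (h.smooth_D.comp hg) 0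
  have hα' : deriv (fun t ↦ D (g t) 0) 0 = fderiv ℝ D 0 (deriv γ 0) 0 := by
    have h1 := ((h.smooth_D.differentiable (by simp)) 0).hasFDerivAt.comp_hasDerivAt_of_eq (0 : ℝ)
      ((hg.differentiable (by simp)) 0).hasDerivAt hg0.symm
    rw [← hg']
    exact (hasDerivAt_pi.1 h1 0).deriv
  refine ⟨fun t ↦ D (g t) 0, m, _, hα, by simp [hg0, h.D_zero], hα',
    contDiff_psi (contDiff_prepared h.smooth_φ h.smooth_Φ h.smooth_D) h.smooth_n hg hy,
    psi_eventuallyEq h.f_eq h.ν_eq hgγ hyη hγ.tendsto, hm, ?_, hψ⟩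
  rw [hα', ← hg', ← hy0]
  exact hm0

/-- The number `a` in the prepared coordinates. -/
theorem PreparedData.cuspNumber_eq (h : PreparedData f ν φ Φ D e n) {γ η : ℝ → Fin 2 → ℝ}
    (hγ : IsSingularCurve f γ) (hη : IsNullField f γ η) (hφ0 : φ 0 = 0)
    (hφ1 : fderiv ℝ φ 0 (1, 0) = 0) {c : ℝ → Fin 2 → ℝ} {l s : ℝ} (hc : IsCuspCurve f γ η c l)
    (hs : deriv c 0 = s • η 0) :
    cuspNumber f γ c l = 720 * (jac (fderiv ℝ Φ 0) * fderiv ℝ D 0 (deriv γ 0) 0 *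
      (s * fderiv ℝ D 0 (η 0) 1) ^ 7 * fderiv ℝ φ 0 (0, 1)) := by
  obtain ⟨g, hg, hgγ⟩ := hγ.smooth.exists_contDiff
  obtain ⟨d, hd, hdc⟩ := hc.smooth.exists_contDiff
  obtain ⟨-, e2, -⟩ := h.singularCurve hγ hη
  have e2 := e2.self_of_nhds
  rw [hγ.map_zero] at e2
  have hg0 : g 0 = 0 := by rw [← hgγ.self_of_nhds, hγ.map_zero]
  have hd0 : d 0 = 0 := by rw [← hdc.self_of_nhds, hc.map_zero]
  have hg' : deriv g 0 = deriv γ 0 := hgγ.deriv_eq.symm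
  have hd' : deriv d 0 = s • η 0 := by rw [← hs]; exact hdc.deriv_eq.symm
  have hct : Tendsto c (𝓝 0) (𝓝 0) := by
    simpa [ContinuousAt, hc.map_zero] using hc.smooth.continuousAt
  have hcomp := h.f_eq.comp_germ hdc hct
  have key := (cusp_jets_prepared h.smooth_φ h.smooth_Φ h.smooth_D h.D_zero h.inj_Φ.self_of_nhds
    hφ0 hφ1 hg hg0 hd hd0 (by rw [hd', map_smul]; simp [e2])).2.2 l (by
      rw [← hcomp.iteratedDeriv_eq, ← hcomp.iteratedDeriv_eq]; exact hc.third)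
  rw [cuspNumber_congr h.f_eq hgγ hdc hγ.tendsto hct, key, hg', hd', map_smul]
  simp

/-- The vertical line in the prepared coordinates is a cusp curve. -/
theorem PreparedData.exists_isCuspCurve (h : PreparedData f ν φ Φ D e n) {γ η : ℝ → Fin 2 → ℝ}
    (hγ : IsSingularCurve f γ) (hη : IsNullField f γ η) (hφ0 : φ 0 = 0)
    (hφ1 : fderiv ℝ φ 0 (1, 0) = 0) (hφ2 : fderiv ℝ φ 0 (0, 1) ≠ 0) :
    ∃ c, IsCuspCurve f γ η c 0 := by
  obtain ⟨g, hg, hgγ⟩ := hγ.smooth.exists_contDiff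
  obtain ⟨-, e2, e3, e4, e5⟩ := h.singularCurve hγ hη
  have e2 := e2.self_of_nhds
  rw [hγ.map_zero] at e2
  have hg0 : g 0 = 0 := by rw [← hgγ.self_of_nhds, hγ.map_zero]
  have hg' : deriv g 0 = deriv γ 0 := hgγ.deriv_eq.symm
  have hline : ContDiff ℝ ∞ fun t : ℝ ↦ (![0, t] : Fin 2 → ℝ) := contDiff_const.vec2 contDiff_id
  have hl0 : (![0, 0] : Fin 2 → ℝ) = 0 := by ext i; fin_cases i <;> rfl
  have hlt : Tendsto (fun t : ℝ ↦ (![0, t] : Fin 2 → ℝ)) (𝓝 0) (𝓝 0) :=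
    hline.continuous.tendsto' _ _ hl0
  let c : ℝ → Fin 2 → ℝ := fun t ↦ e ![0, t]
  have hc : ContDiff ℝ ∞ c := h.smooth_e.comp hline
  have hc0 : c 0 = 0 := by simp [c, hl0, h.e_zero]
  have hDc : (fun t ↦ D (c t)) =ᶠ[𝓝 0] fun t ↦ ![0, t] := hlt.eventually h.D_e
  have hct : Tendsto c (𝓝 0) (𝓝 0) := hc.continuous.tendsto' _ _ hc0
  have hDc' : fderiv ℝ D 0 (deriv c 0) = ![0, 1] := by
    have h1 := congrFun (deriv_comp_eq h.smooth_D hc) 0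
    rw [hc0] at h1
    rw [← h1, hDc.deriv_eq]
    have : HasDerivAt (fun t : ℝ ↦ (![0, t] : Fin 2 → ℝ)) ![0, 1] 0 := by
      rw [hasDerivAt_pi]
      intro i; fin_cases i
      · exact hasDerivAt_const 0 (0 : ℝ)
      · exact hasDerivAt_id 0
    exact this.deriv
  obtain ⟨k1, k2, k3⟩ := cusp_jets_prepared h.smooth_φ h.smooth_Φ h.smooth_D h.D_zero
    h.inj_Φ.self_of_nhds hφ0 hφ1 hg hg0 hc hc0 (by rw [hDc']; rfl)
  rw [hDc'] at k2 k3
  have hcomp := h.f_eq.comp_germ (EventuallyEq.refl _ c) hct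
  -- the image of the vertical line is `Φ(0, t², t³ φ(0, t²))`
  have hthird : iteratedDeriv 3 ((fun p ↦ Φ (cuspForm φ (D p))) ∘ c) 0 = 0 := by
    have h1 : (fun p ↦ Φ (cuspForm φ (D p))) ∘ c =ᶠ[𝓝 0] fun t ↦ Φ (cuspForm φ ![0, t]) := by
      filter_upwards [hDc] with t ht
      simp only [Function.comp_apply, ht]
    have hF : ContDiff ℝ ∞ fun t : ℝ ↦ cuspForm φ ![0, t] :=
      (contDiff_cuspForm h.smooth_φ).comp hline
    have hd1 : deriv (fun t : ℝ ↦ cuspForm φ ![0, t]) 0 = 0 := by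
      refine (jets_cuspForm_comp h.smooth_φ hline rfl ?_).1
      have := hDc.deriv_eq
      rw [← this, congrFun (deriv_comp_eq h.smooth_D hc) 0, hc0, hDc']; rfl
    rw [h1.iteratedDeriv_eq, (iteratedDeriv_comp_of_deriv_eq_zero h.smooth_Φ hF hd1).2.1]
    have hz : iteratedDeriv 3 (fun t : ℝ ↦ cuspForm φ ![0, t]) 0 = 0 := by
      ext i
      rw [iteratedDeriv_apply_coord hF]
      fin_cases i
      · simp [cuspForm]
      · simp [cuspForm]
      · have h2 : ContDiff ℝ ∞ fun t : ℝ ↦ φ (0, t ^ 2) := by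
          have := h.smooth_φ; fun_prop
        have h3 := (iteratedDeriv_pow_mul h2 3).2
        have h4 : φ (0, 0) = 0 := hφ0
        simpa [cuspForm, h4] using h3
    rw [hz, map_zero]
  refine ⟨c, hc.isSmoothGerm 0, hc0, ⟨(fderiv ℝ D 0 (η 0) 1)⁻¹, inv_ne_zero e5, ?_⟩, ?_, ?_, ?_, ?_⟩
  · rw [← sub_eq_zero]
    refine h.inj_D.self_of_nhds _ ?_
    rw [map_sub, map_smul, hDc']
    ext i; fin_cases i
    · simp [e2]
    · simp [e5]
  · rw [hcomp.deriv_eq]; exact k1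
  · rw [hcomp.iteratedDeriv_eq]; exact k2 (by simp)
  · rw [hcomp.iteratedDeriv_eq, hthird, zero_smul]
  · rw [cuspNumber_congr h.f_eq hgγ (EventuallyEq.refl _ c) hγ.tendsto hct,
      k3 0 (by rw [hthird, zero_smul]), hg']
    have := jac_ne_zero h.inj_Φ.self_of_nhds
    simp [this, e4, hφ2]

end Invariants

/-! ### The sign rule -/

theorem Real.sign_mul_of_pos {x y : ℝ} (hx : 0 < x) : Real.sign (x * y) = Real.sign y := by
  rcases lt_trichotomy y 0 with hy | rfl | hy
  · rw [Real.sign_of_neg hy, Real.sign_of_neg (mul_neg_of_pos_of_neg hx hy)]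
  · rw [mul_zero]
  · rw [Real.sign_of_pos hy, Real.sign_of_pos (mul_pos hx hy)]

theorem Real.sign_mul_sign (x y : ℝ) : Real.sign x * Real.sign y = Real.sign (x * y) := by
  rcases lt_trichotomy x 0 with hx | rfl | hx
  · have : x * y = -x * -y := by ring
    rw [this, Real.sign_mul_of_pos (neg_pos.2 hx), Real.sign_neg, Real.sign_of_neg hx, neg_one_mul]
  · simp
  · rw [Real.sign_mul_of_pos hx, Real.sign_of_pos hx, one_mul]

theorem apply_zero_of_eq_pow_mul {φ : ℝ × ℝ → ℝ} {θ : ℝ → ℝ} {k : ℕ} (hk : 2 ≤ k)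
    (h : ∀ u, φ (u, 0) = u ^ k * θ u) : φ 0 = 0 := by
  have := h 0
  rwa [zero_pow (by omega), zero_mul] at this

theorem fderiv_fst_of_eq_pow_mul {φ : ℝ × ℝ → ℝ} {θ : ℝ → ℝ} {k : ℕ} (hk : 2 ≤ k)
    (hφ : ContDiff ℝ ∞ φ) (hθ : ContDiff ℝ ∞ θ) (h : ∀ u, φ (u, 0) = u ^ k * θ u) :
    fderiv ℝ φ 0 (1, 0) = 0 := by
  have h1 : HasDerivAt (fun u : ℝ ↦ φ (u, 0)) (fderiv ℝ φ 0 (1, 0)) 0 :=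
    ((hφ.differentiable (by simp)) 0).hasFDerivAt.comp_hasDerivAt_of_eq (0 : ℝ)
      ((hasDerivAt_id (0 : ℝ)).prodMk (hasDerivAt_const (0 : ℝ) (0 : ℝ))) rfl
  have h2 := (hasDerivAt_pow k (0 : ℝ)).mul ((hθ.differentiable (by simp)) 0).hasDerivAt
  have h3 : (fun u : ℝ ↦ φ (u, 0)) = (fun u ↦ u ^ k) * θ := funext h
  rw [h3] at h1
  rw [h1.unique h2, zero_pow (by omega), zero_pow (by omega)]
  ring

section Invariants

variable {f ν : (Fin 2 → ℝ) → (Fin 3 → ℝ)} {φ : ℝ × ℝ → ℝ} {Φ : (Fin 3 → ℝ) → (Fin 3 → ℝ)}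
  {D e : (Fin 2 → ℝ) → (Fin 2 → ℝ)} {n : (Fin 2 → ℝ) → (Fin 3 → ℝ)}

/-- If `φ(u, 0) = uᵏ θ(u)`, then `ψ` vanishes below order `k`, and `b = ψ⁽ᵏ⁾(0)` is `k! βᵏ θ(0)` up to a
factor with a known sign, where `β` is the first component of `dD(γ')` at `0`. -/
theorem PreparedData.iteratedDeriv_psi (h : PreparedData f ν φ Φ D e n) {γ η : ℝ → Fin 2 → ℝ}
    (hγ : IsSingularCurve f γ) (hη : IsNullField f γ η) {θ : ℝ → ℝ} (hθ : ContDiff ℝ ∞ θ) {k : ℕ}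
    (hφ : ∀ u, φ (u, 0) = u ^ k * θ u) :
    (∀ i < k, iteratedDeriv i (psi f ν γ η) 0 = 0) ∧
    ∃ m : ℝ, 0 < m * (jac (fderiv ℝ Φ 0) * fderiv ℝ D 0 (deriv γ 0) 0 * fderiv ℝ D 0 (η 0) 1) ∧
      iteratedDeriv k (psi f ν γ η) 0 =
        m * (k.factorial * (fderiv ℝ D 0 (deriv γ 0) 0 ^ k * θ 0)) := by
  obtain ⟨α, m, ψ, hα, hα0, hα', hψ, hψe, hm, hm0, he⟩ := h.exists_psi_eq hγ hη
  obtain ⟨h1, h2⟩ := iteratedDeriv_comp_of_pow_mul hα hα0 hθ k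
  obtain ⟨h3, h4⟩ := iteratedDeriv_of_eq_mul hψ (by fun_prop) hm
    (by filter_upwards [he] with t ht; rw [ht, hφ]) k h1
  refine ⟨fun i hi ↦ ?_, m 0, by rwa [← hα'], ?_⟩
  · rw [hψe.iteratedDeriv_eq, h3 i hi]
  · rw [hψe.iteratedDeriv_eq, h4, h2, hα']

/-- If `ψ` vanishes below order `k`, then so does `u ↦ φ(u, 0)`. -/
theorem PreparedData.exists_eq_pow_mul (h : PreparedData f ν φ Φ D e n) {γ η : ℝ → Fin 2 → ℝ}
    (hγ : IsSingularCurve f γ) (hη : IsNullField f γ η) {k : ℕ}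
    (hψ0 : ∀ i < k, iteratedDeriv i (psi f ν γ η) 0 = 0) :
    ∃ θ : ℝ → ℝ, ContDiff ℝ ∞ θ ∧ ∀ u, φ (u, 0) = u ^ k * θ u := by
  obtain ⟨-, -, -, h4, -⟩ := h.singularCurve hγ hη
  obtain ⟨α, m, ψ, hα, hα0, hα', hψ, hψe, hm, hm0, he⟩ := h.exists_psi_eq hγ hη
  have hm0' : m 0 ≠ 0 := by rintro h0; simp [h0] at hm0
  have hφ := h.smooth_φ
  have hχ : ContDiff ℝ ∞ fun u : ℝ ↦ φ (u, 0) := by fun_prop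
  have h5 := (iteratedDeriv_of_eq_mul (hχ.comp hα) hψ (hm.inv₀ hm0')
    (by
      filter_upwards [he, hm.eventually_ne hm0'] with t ht ht0
      simp only [Function.comp_apply, Pi.inv_apply]
      rw [ht, inv_mul_cancel_left₀ ht0]) k
    fun i hi ↦ by rw [← hψe.iteratedDeriv_eq, hψ0 i hi]).1
  obtain ⟨θ, hθ, hθe, -⟩ := exists_eq_pow_mul_of_comp hα hα0 (by rwa [hα']) hχ k h5
  exact ⟨θ, hθ, hθe⟩

theorem PreparedData.psiVanishesToOrder_iff (h : PreparedData f ν φ Φ D e n)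
    {γ η : ℝ → Fin 2 → ℝ} (hγ : IsSingularCurve f γ) (hη : IsNullField f γ η) {θ : ℝ → ℝ}
    (hθ : ContDiff ℝ ∞ θ) {k : ℕ} (hφ : ∀ u, φ (u, 0) = u ^ k * θ u) :
    PsiVanishesToOrder f ν γ η k ↔ θ 0 ≠ 0 := by
  obtain ⟨-, -, -, h4, -⟩ := h.singularCurve hγ hη
  obtain ⟨h1, m, hm, h2⟩ := h.iteratedDeriv_psi hγ hη hθ hφ
  have hm0 : m ≠ 0 := by rintro rfl; simp at hm
  rw [PsiVanishesToOrder, and_iff_right h1, h2]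
  simp [hm0, h4, Nat.factorial_ne_zero]

/-- For even `k` the sign of `ab` is that of `θ(0) ∂φ/∂w(0)`: with `J` the Jacobian of the target
coordinate change, `β = dD(γ')_0` and `κ = dD(η)_1` at `0`, the product `ab` is
`720 k! s⁷ (m J β κ) κ⁶ βᵏ` times that number. -/
theorem PreparedData.sign_cuspNumber_mul (h : PreparedData f ν φ Φ D e n)
    {γ η c : ℝ → Fin 2 → ℝ} {l s : ℝ} (hγ : IsSingularCurve f γ) (hη : IsNullField f γ η)
    {θ : ℝ → ℝ} (hθ : ContDiff ℝ ∞ θ) {k : ℕ} (hk : 2 ≤ k) (hφ : ∀ u, φ (u, 0) = u ^ k * θ u)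
    (hke : Even k) (hc : IsCuspCurve f γ η c l) (hs0 : 0 < s) (hs : deriv c 0 = s • η 0) :
    Real.sign (cuspNumber f γ c l * iteratedDeriv k (psi f ν γ η) 0) =
      Real.sign (θ 0 * fderiv ℝ φ 0 (0, 1)) := by
  obtain ⟨-, -, -, h4, h5⟩ := h.singularCurve hγ hη
  obtain ⟨-, m, hm, h2⟩ := h.iteratedDeriv_psi hγ hη hθ hφ
  rw [h.cuspNumber_eq hγ hη (apply_zero_of_eq_pow_mul hk hφ)
    (fderiv_fst_of_eq_pow_mul hk h.smooth_φ hθ hφ) hc hs, h2]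
  set J := jac (fderiv ℝ Φ 0)
  set β := fderiv ℝ D 0 (deriv γ 0) 0
  set κ := fderiv ℝ D 0 (η 0) 1
  have hpos : 0 < 720 * (k.factorial : ℝ) * s ^ 7 * (m * (J * β * κ)) * κ ^ 6 * β ^ k := by
    have h6 : 0 < κ ^ 6 := (by decide : Even 6).pow_pos h5
    have h7 : 0 < β ^ k := hke.pow_pos h4
    have h8 : (0 : ℝ) < k.factorial := by exact_mod_cast k.factorial_pos
    positivity
  rw [← Real.sign_mul_of_pos (y := θ 0 * fderiv ℝ φ 0 (0, 1)) hpos]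
  congr 1
  ring

end Invariants

/-! ### The two implications -/

section Main

variable {f ν : (Fin 2 → ℝ) → (Fin 3 → ℝ)} {k : ℕ} {ε : ℝ}

/-- The conditions of the criterion, required for all choices of the auxiliary data. -/
theorem criteria_of_aEquivalent (hf : IsFrontalWithNormal f ν) (hk : 2 ≤ k)
    (hε : ε = 1 ∨ ε = -1) (h : AEquivalent f (cuspidalS (k - 1) ε)) :
    IsNondegenerateSingularPoint f ν ∧
      ∀ γ η : ℝ → (Fin 2 → ℝ), IsSingularCurve f γ → IsNullField f γ η →
        LinearIndependent ℝ ![deriv γ 0, η 0] ∧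
        (∃ (c : ℝ → (Fin 2 → ℝ)) (l : ℝ), IsCuspCurve f γ η c l) ∧
        PsiVanishesToOrder f ν γ η k ∧
        (Even k → ∀ (c : ℝ → (Fin 2 → ℝ)) (l : ℝ), IsCuspCurve f γ η c l →
          IsOrientedChoice γ η c → SignRule f ν γ η c l k ε) := by
  rw [cuspidalS_eq_cuspForm hk] at h
  obtain ⟨Φ, D, e, n, hP⟩ := hf.exists_preparedData
    (φ := fun x : ℝ × ℝ ↦ x.1 ^ k + ε * x.2) (by fun_prop) h
  have hθ : ContDiff ℝ ∞ fun _ : ℝ ↦ (1 : ℝ) := contDiff_const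
  have hφ : ∀ u : ℝ, (fun x : ℝ × ℝ ↦ x.1 ^ k + ε * x.2) (u, 0) = u ^ k * (fun _ ↦ 1) u := by
    simp
  have hφw : fderiv ℝ (fun x : ℝ × ℝ ↦ x.1 ^ k + ε * x.2) 0 (0, 1) = ε := by
    have h1 : HasFDerivAt (fun x : ℝ × ℝ ↦ x.1 ^ k + ε * x.2) _ 0 :=
      (((hasFDerivAt_fst (𝕜 := ℝ) (p := (0 : ℝ × ℝ))).pow k).add
        ((hasFDerivAt_snd (𝕜 := ℝ) (p := (0 : ℝ × ℝ))).const_mul ε))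
    rw [h1.fderiv]
    simp
  have hφ0 := apply_zero_of_eq_pow_mul (φ := fun x : ℝ × ℝ ↦ x.1 ^ k + ε * x.2) hk hφ
  have hφ1 := fderiv_fst_of_eq_pow_mul hk hP.smooth_φ hθ hφ
  have hε0 : ε ≠ 0 := by rcases hε with rfl | rfl <;> norm_num
  refine ⟨hP.isNondegenerateSingularPoint, fun γ η hγ hη ↦ ⟨hP.linearIndependent hγ hη, ?_,
    (hP.psiVanishesToOrder_iff hγ hη hθ hφ).2 one_ne_zero, fun hke c l hc ho ↦ ?_⟩⟩
  · obtain ⟨c, hc⟩ := hP.exists_isCuspCurve hγ hη hφ0 hφ1 (by rwa [hφw])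
    exact ⟨c, 0, hc⟩
  · obtain ⟨-, s, hs0, hs⟩ := ho
    rw [SignRule, hP.sign_cuspNumber_mul hγ hη hθ hk hφ hke hc hs0 hs, hφw, one_mul]
    rcases hε with rfl | rfl
    · exact Real.sign_one
    · exact Real.sign_of_neg (by norm_num)

/-- The conditions for one choice of the auxiliary data give the normal form. By transversality `f` is
equivalent to a prepared form, by the conditions on `c` and `ψ` it has
`φ(u, w) = uᵏ θ(u) + w φ₁(u, w)` with `θ(0), φ₁(0) ≠ 0`, and the sign rule fixes the sign of
`θ(0) φ₁(0)` for even `k`; for odd `k` that sign can be changed. -/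
theorem aEquivalent_of_criteria (hf : IsFrontalWithNormal f ν) (hk : 2 ≤ k)
    (hε : ε = 1 ∨ ε = -1) (hnd : IsNondegenerateSingularPoint f ν) {γ η c : ℝ → (Fin 2 → ℝ)}
    {l : ℝ} (hγ : IsSingularCurve f γ) (hη : IsNullField f γ η)
    (hlin : LinearIndependent ℝ ![deriv γ 0, η 0]) (hc : IsCuspCurve f γ η c l)
    (hψ : PsiVanishesToOrder f ν γ η k)
    (hsign : Even k → IsOrientedChoice γ η c ∧ SignRule f ν γ η c l k ε) :
    AEquivalent f (cuspidalS (k - 1) ε) := by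
  obtain ⟨f', hf', hff⟩ := hf.smooth.exists_contDiff
  obtain ⟨ν', hν', hνν⟩ := hf.normal.smooth.exists_contDiff
  obtain ⟨g, hg, hgγ⟩ := hγ.smooth.exists_contDiff
  obtain ⟨y, hy, hyη⟩ := hη.smooth.exists_contDiff
  obtain ⟨φ, hφ, hfφ⟩ := exists_aEquivalent_cuspForm_of_transverse hf' hν'
    (by rw [← hff.self_of_nhds, hf.map_zero])
    (by
      filter_upwards [hf.normal.orthogonal, hff.eventuallyEq_nhds, hνν] with x h1 h2 h3
      rwa [h2.fderiv_eq, h3] at h1)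
    (by rw [← hνν.self_of_nhds]; exact hf.normal.ne_zero.self_of_nhds)
    ((isNondegenerateSingularPoint_congr hff hνν).1 hnd) hg hy
    (by rw [← hgγ.self_of_nhds, hγ.map_zero])
    (by
      filter_upwards [hγ.mem, hgγ, hγ.tendsto.eventually hff.eventuallyEq_nhds] with t h1 h2 h3
      rw [← h2]; exact (singularSet_congr h3).1 h1)
    (by
      filter_upwards [hη.ker_eq, hgγ, hyη, hγ.tendsto.eventually hff.eventuallyEq_nhds]
        with t h1 h2 h3 h4
      rw [← h2, ← h3, ← h4.fderiv_eq]
      exact (h1 _).2 ⟨1, by simp⟩)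
    (by rwa [← hgγ.deriv_eq, ← hyη.self_of_nhds])
  have hAf : AEquivalent f (cuspForm φ) := (AEquivalent.of_eventuallyEq hff).trans hfφ
  obtain ⟨Φ, D, e, n, hP⟩ := hf.exists_preparedData hφ hAf
  obtain ⟨θ, hθ, hθe⟩ := hP.exists_eq_pow_mul hγ hη hψ.1
  have hθ0 : θ 0 ≠ 0 := (hP.psiVanishesToOrder_iff hγ hη hθ hθe).1 hψ
  have hφw : fderiv ℝ φ 0 (0, 1) ≠ 0 := by
    obtain ⟨s, -, hs⟩ := hc.parallel
    intro h0
    apply hc.number_ne_zero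
    rw [hP.cuspNumber_eq hγ hη (apply_zero_of_eq_pow_mul hk hθe)
      (fderiv_fst_of_eq_pow_mul hk hφ hθ hθe) hc hs, h0, mul_zero, mul_zero]
  obtain ⟨φ₁, hφ₁, hφ₁e⟩ := exists_hadamard φ hφ
  have hφ₁0 : fderiv ℝ φ 0 (0, 1) = φ₁ 0 := by
    have h1 : HasDerivAt (fun w : ℝ ↦ φ (0, w)) (fderiv ℝ φ 0 (0, 1)) 0 :=
      ((hφ.differentiable (by simp)) 0).hasFDerivAt.comp_hasDerivAt_of_eq (0 : ℝ)
        ((hasDerivAt_const (0 : ℝ) (0 : ℝ)).prodMk (hasDerivAt_id (0 : ℝ))) rfl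
    have h2 : ContDiff ℝ ∞ fun w : ℝ ↦ φ₁ (0, w) := by fun_prop
    have h3 := ((hasDerivAt_id (0 : ℝ)).mul ((h2.differentiable (by simp)) 0).hasDerivAt).const_add
      (φ (0, 0))
    have h4 : (fun w : ℝ ↦ φ (0, w)) = fun w ↦ φ (0, 0) + ((id : ℝ → ℝ) * fun w ↦ φ₁ (0, w)) w :=
      funext fun w ↦ by rw [hφ₁e]; rfl
    rw [h4] at h1
    rw [h1.unique h3]
    simp
    rfl
  have hnf := aEquivalent_normalForm φ φ₁ θ (k := k) (by omega) hφ₁ hθ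
    (fun u w ↦ by rw [hφ₁e, hθe, smul_eq_mul]) (hφ₁0 ▸ hφw) hθ0
  rw [Real.sign_mul_sign, ← hφ₁0] at hnf
  rw [cuspidalS_eq_cuspForm hk]
  refine hAf.trans ?_
  rcases Nat.even_or_odd k with hke | hko
  · obtain ⟨⟨-, s, hs0, hs⟩, hr⟩ := hsign hke
    rwa [← hP.sign_cuspNumber_mul hγ hη hθ hk hθe hke hc hs0 hs, hr] at hnf
  · rcases Real.sign_apply_eq_of_ne_zero _ (mul_ne_zero hθ0 hφw) with h1 | h1 <;>
      rw [h1] at hnf <;> rcases hε with rfl | rfl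
    · simpa using hnf.trans (aEquivalent_normalForm_neg hko _)
    · exact hnf
    · exact hnf
    · exact hnf.trans (aEquivalent_normalForm_neg hko _)

theorem IsFrontalWithNormal.exists_isSingularCurve_isNullField (hf : IsFrontalWithNormal f ν)
    (hnd : IsNondegenerateSingularPoint f ν) :
    ∃ γ η : ℝ → (Fin 2 → ℝ), IsSingularCurve f γ ∧ IsNullField f γ η := by
  obtain ⟨f', hf', hff⟩ := hf.smooth.exists_contDiff
  obtain ⟨ν', hν', hνν⟩ := hf.normal.smooth.exists_contDiff
  have hnd' := (isNondegenerateSingularPoint_congr hff hνν).1 hnd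
  obtain ⟨γ, hγ⟩ := exists_isSingularCurve hf' hν'
    (by
      filter_upwards [hf.normal.orthogonal, hff.eventuallyEq_nhds, hνν] with x h1 h2 h3
      rwa [h2.fderiv_eq, h3] at h1)
    (by rw [← hνν.self_of_nhds]; exact hf.normal.ne_zero.self_of_nhds) hnd'
  obtain ⟨η, hη⟩ := exists_isNullField hf' hν' hnd' hγ
  have hffγ := hγ.tendsto.eventually hff.eventuallyEq_nhds
  refine ⟨γ, η, ⟨hγ.smooth, hγ.map_zero, hγ.regular, ?_, fun δ hδ ↦ ?_⟩,
    ⟨hη.smooth, hη.ne_zero, ?_⟩⟩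
  · filter_upwards [hγ.mem, hffγ] with t h1 h2 using (singularSet_congr h2).2 h1
  · filter_upwards [hγ.covers δ hδ, hff.eventuallyEq_nhds] with p h1 h2 h3
    exact h1 ((singularSet_congr h2).1 h3)
  · filter_upwards [hη.ker_eq, hffγ] with t h1 h2
    rwa [h2.fderiv_eq]

theorem IsNullField.neg {γ η : ℝ → (Fin 2 → ℝ)} (hη : IsNullField f γ η) :
    IsNullField f γ (-η) := by
  refine ⟨?_, ?_, ?_⟩
  · filter_upwards [hη.smooth] with t ht using ht.neg
  · filter_upwards [hη.ne_zero] with t ht using neg_ne_zero.2 ht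
  · filter_upwards [hη.ker_eq] with t ht X
    rw [ht X]
    exact ⟨fun ⟨s, hs⟩ ↦ ⟨-s, by simp [hs]⟩, fun ⟨s, hs⟩ ↦ ⟨-s, by simp [hs]⟩⟩

/-- Reversing `c` changes the sign of its third and fifth derivatives, hence of `ℓ` and of `a`. -/
theorem cuspNumber_comp_neg (γ c : ℝ → (Fin 2 → ℝ)) (l : ℝ) :
    cuspNumber f γ (fun t ↦ c (-t)) (-l) = -cuspNumber f γ c l := by
  have h (i : ℕ) : iteratedDeriv i (f ∘ fun t ↦ c (-t)) 0 =
      (-1 : ℝ) ^ i • iteratedDeriv i (f ∘ c) 0 := by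
    have := iteratedDeriv_comp_neg i (f ∘ c) 0
    rwa [neg_zero] at this
  simp only [cuspNumber, h, det₃_eq, Pi.sub_apply, Pi.smul_apply, smul_eq_mul]
  ring

theorem IsCuspCurve.comp_neg {γ η c : ℝ → (Fin 2 → ℝ)} {l : ℝ} (hc : IsCuspCurve f γ η c l) :
    IsCuspCurve f γ η (fun t ↦ c (-t)) (-l) := by
  have h (i : ℕ) : iteratedDeriv i (f ∘ fun t ↦ c (-t)) 0 =
      (-1 : ℝ) ^ i • iteratedDeriv i (f ∘ c) 0 := by
    have := iteratedDeriv_comp_neg i (f ∘ c) 0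
    rwa [neg_zero] at this
  refine ⟨?_, by simp [hc.map_zero], ?_, ?_, ?_, ?_, ?_⟩
  · refine IsSmoothGerm.comp (g := c) (f := fun t : ℝ ↦ -t) ?_ (contDiff_neg.isSmoothGerm 0)
    simpa using hc.smooth
  · obtain ⟨s, hs0, hs⟩ := hc.parallel
    exact ⟨-s, neg_ne_zero.2 hs0, by rw [deriv_comp_neg, neg_zero, hs, neg_smul]⟩
  · rw [← iteratedDeriv_one, h, iteratedDeriv_one, hc.first, smul_zero]
  · rw [h]; simpa using hc.second
  · rw [h, h, hc.third, ← smul_assoc, ← smul_assoc]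
    norm_num
  · rw [cuspNumber_comp_neg]; exact neg_ne_zero.2 hc.number_ne_zero

theorem IsCuspCurve.exists_pos_parallel {γ η c : ℝ → (Fin 2 → ℝ)} {l : ℝ}
    (hc : IsCuspCurve f γ η c l) :
    ∃ c l, IsCuspCurve f γ η c l ∧ ∃ s : ℝ, 0 < s ∧ deriv c 0 = s • η 0 := by
  obtain ⟨s, hs0, hs⟩ := hc.parallel
  rcases lt_or_gt_of_ne hs0 with h | h
  · exact ⟨_, _, hc.comp_neg, -s, neg_pos.2 h, by rw [deriv_comp_neg, neg_zero, hs, neg_smul]⟩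
  · exact ⟨c, l, hc, s, h, hs⟩

theorem exists_det₂_pos {γ η : ℝ → (Fin 2 → ℝ)} (hη : IsNullField f γ η)
    (hlin : LinearIndependent ℝ ![deriv γ 0, η 0]) :
    ∃ η, IsNullField f γ η ∧ 0 < det₂ (deriv γ 0) (η 0) := by
  rcases lt_or_gt_of_ne (det₂_ne_zero_of_linearIndependent hlin) with h | h
  · refine ⟨-η, hη.neg, ?_⟩
    rw [det₂_eq] at h ⊢
    simp only [Pi.neg_apply]
    linarith
  · exact ⟨η, hη, h⟩

/-- Reversing `η` and the parameter of `c`, if necessary, makes the choices oriented. -/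
theorem IsFrontalWithNormal.exists_isOrientedChoice (hf : IsFrontalWithNormal f ν)
    (hnd : IsNondegenerateSingularPoint f ν)
    (hall : ∀ γ η : ℝ → (Fin 2 → ℝ), IsSingularCurve f γ → IsNullField f γ η →
      LinearIndependent ℝ ![deriv γ 0, η 0] ∧
      ∃ (c : ℝ → (Fin 2 → ℝ)) (l : ℝ), IsCuspCurve f γ η c l) :
    ∃ (γ η c : ℝ → (Fin 2 → ℝ)) (l : ℝ), IsSingularCurve f γ ∧ IsNullField f γ η ∧
      IsCuspCurve f γ η c l ∧ IsOrientedChoice γ η c := by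
  obtain ⟨γ, η₀, hγ, hη₀⟩ := hf.exists_isSingularCurve_isNullField hnd
  obtain ⟨η, hη, hdet⟩ := exists_det₂_pos hη₀ (hall γ η₀ hγ hη₀).1
  obtain ⟨c₀, l₀, hc₀⟩ := (hall γ η hγ hη).2
  obtain ⟨c, l, hc, hs⟩ := hc₀.exists_pos_parallel
  exact ⟨γ, η, c, l, hγ, hη, hc, hdet, hs⟩

end Main

/-- Criteria for the cuspidal `S_{k-1}^±` singularity. The conditions that involve the auxiliary
choices `γ`, `η`, `c`, `ℓ` are stated twice: first for all choices, then for some choice. -/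
theorem theorem3p2 (f ν : (Fin 2 → ℝ) → (Fin 3 → ℝ)) (hf : IsFrontalWithNormal f ν)
    (k : ℕ) (hk : 2 ≤ k) (ε : ℝ) (hε : ε = 1 ∨ ε = -1) :
    (AEquivalent f (cuspidalS (k - 1) ε) ↔
      IsNondegenerateSingularPoint f ν ∧
        ∀ γ η : ℝ → (Fin 2 → ℝ), IsSingularCurve f γ → IsNullField f γ η →
          LinearIndependent ℝ ![deriv γ 0, η 0] ∧
          (∃ (c : ℝ → (Fin 2 → ℝ)) (l : ℝ), IsCuspCurve f γ η c l) ∧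
          PsiVanishesToOrder f ν γ η k ∧
          (Even k → ∀ (c : ℝ → (Fin 2 → ℝ)) (l : ℝ), IsCuspCurve f γ η c l →
            IsOrientedChoice γ η c → SignRule f ν γ η c l k ε)) ∧
    (AEquivalent f (cuspidalS (k - 1) ε) ↔
      IsNondegenerateSingularPoint f ν ∧
        ∃ γ η : ℝ → (Fin 2 → ℝ), IsSingularCurve f γ ∧ IsNullField f γ η ∧
          LinearIndependent ℝ ![deriv γ 0, η 0] ∧
          ∃ (c : ℝ → (Fin 2 → ℝ)) (l : ℝ), IsCuspCurve f γ η c l ∧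
            PsiVanishesToOrder f ν γ η k ∧
            (Even k → IsOrientedChoice γ η c ∧ SignRule f ν γ η c l k ε)) := by
  refine ⟨⟨criteria_of_aEquivalent hf hk hε, fun ⟨hnd, hall⟩ ↦ ?_⟩, ⟨fun h ↦ ?_,
    fun ⟨hnd, γ, η, hγ, hη, hlin, c, l, hc, hψ, hsign⟩ ↦
      aEquivalent_of_criteria hf hk hε hnd hγ hη hlin hc hψ hsign⟩⟩
  · obtain ⟨γ, η, c, l, hγ, hη, hc, ho⟩ := hf.exists_isOrientedChoice hnd fun γ η hγ hη ↦
      ⟨(hall γ η hγ hη).1, (hall γ η hγ hη).2.1⟩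
    obtain ⟨hlin, -, hψ, hsign⟩ := hall γ η hγ hη
    exact aEquivalent_of_criteria hf hk hε hnd hγ hη hlin hc hψ fun hke ↦
      ⟨ho, hsign hke c l hc ho⟩
  · obtain ⟨hnd, hall⟩ := criteria_of_aEquivalent hf hk hε h
    obtain ⟨γ, η, c, l, hγ, hη, hc, ho⟩ := hf.exists_isOrientedChoice hnd fun γ η hγ hη ↦
      ⟨(hall γ η hγ hη).1, (hall γ η hγ hη).2.1⟩
    obtain ⟨hlin, -, hψ, hsign⟩ := hall γ η hγ hη
    exact ⟨hnd, γ, η, hγ, hη, hlin, c, l, hc, hψ, fun hke ↦ ⟨ho, hsign hke c l hc ho⟩⟩
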